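/- **Setting.** Let $\mathfrak g$ be a finite-dimensional complex semisimple Lie algebra with Cartan subalgebra $\mathfrak h$ and simple roots $\alpha_1,\dots,\alpha_n$. Let $\mathcal P$ be the weight lattice, i.e. the group of all $\lambda\in\mathfrak h^*$ in the $\mathbb Q$-span of the roots with $\lambda(\alpha^\vee)\in\mathbb Z$ for every root $\alpha$. Let $(\cdot,\cdot)$ be a symmetric Weyl-group-invariant bilinear form on $\mathfrak h^*$ with $(\alpha,\alpha)\in\mathbb Q_{>0}$ for every root $\alpha$ (for example the form induced by the Killing form, or a rescaling of it). Let $q=e^{\hbar}\in\mathbb C^*$ not be a root of unity; write $q^x=e^{\hbar x}$ and $q_i=q^{(\alpha_i,\alpha_i)/2}$. Let $\widetilde U_q^+$ be the Hopf algebra generated by $E_i$ ($1\le i\le n$) and $K_\lambda$ ($\lambda\in\mathcal P$) with relations $K_0=1$, $K_\lambda K_\mu=K_{\lambda+\mu}$, $K_\lambda E_i=q^{(\alpha_i,\lambda)}E_iK_\lambda$, where $\Delta(K_\lambda)=K_\lambda\otimes K_\lambda$, $\Delta(E_i)=E_i\otimes K_{\alpha_i}^{-1}+1\otimes E_i$,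 $\varepsilon(K_\lambda)=1$, $\varepsilon(E_i)=0$. Let $\widetilde U_q^-$ be the Hopf algebra generated by $F_i$ and $K'_\lambda$ with $K'_0=1$, $K'_\lambda K'_\mu=K'_{\lambda+\mu}$, $K'_\lambda F_i=q^{-(\alpha_i,\lambda)}F_iK'_\lambda$, where $\Delta(K'_\lambda)=K'_\lambda\otimes K'_\lambda$, $\Delta(F_i)=F_i\otimes1+K'_{\alpha_i}\otimes F_i$, $\varepsilon(K'_\lambda)=1$, $\varepsilon(F_i)=0$. Let $\varphi:\widetilde U_q^+\times\widetilde U_q^-\to\mathbb C$ be the bilinear form with $$\varphi(a,bb')=\sum\varphi(a_{(1)},b)\varphi(a_{(2)},b'),\quad \varphi(aa',b)=\sum\varphi(a,b_{(2)})\varphi(a',b_{(1)}),\quad \varphi(a,1)=\varepsilon(a),\quad \varphi(1,b)=\varepsilon(b),$$ $\varphi(E_i,F_j)=\delta_{ij}/(q_i^{-1}-q_i)$, $\varphi(K_\lambda,K'_\mu)=q^{-(\lambda,\mu)}$, $\varphi(E_i,K'_\lambda)=\varphi(K_\lambda,F_i)=0$. Let $U_q^+$, $U_q^-$ be the quotients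 of $\widetilde U_q^+$, $\widetilde U_q^-$ by the left and right radicals of $\varphi$, with the induced pairing, again denoted $\varphi$, and put $E'_i=(q_i^{-1}-q_i)K_{\alpha_i}E_i\in U_q^+$. The quantum double $D=D_\varphi(U_q^+,U_q^-)$ is the coalgebra $U_q^+\otimes U_q^-$ with product $(a\otimes b)(a'\otimes b')=\sum\varphi(S^{-1}(a'_{(1)}),b_{(1)})\varphi(a'_{(3)},b_{(3)})\,aa'_{(2)}\otimes b_{(2)}b'$. The Heisenberg double $\mathcal H=H_\varphi(U_q^+,U_q^-)$ is the space $U_q^-\otimes U_q^+$, with pure tensors written $b\sharp a$ and product $(b\sharp a)(b'\sharp a')=\sum\varphi(a_{(1)},b'_{(1)})\,bb'_{(2)}\sharp a_{(2)}a'$. $D$ acts on $U_q^+$ and $U_q^-$ by the Schrödinger representations $$(a\otimes b).x=\sum\varphi(x_{(1)},S(b))\,a_{(1)}x_{(2)}S(a_{(2)}),\qquad (a\otimes b).y=\sum\varphi(a,b_{(1)}y_{(1)}S(b_{(4)}))\,b_{(2)}y_{(2)}S(b_{(3)}),$$ and on $\mathcal H$ by $d.(b\sharp a)=\sum d_{(1)}.b\,\sharp\,d_{(2)}.a$;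 moreover let $\delta:\mathcal H\to D\otimes\mathcal H$, $\delta(b\sharp a)=\sum(1\otimes b_{(1)})(a_{(1)}\otimes1)\otimes b_{(2)}\sharp a_{(2)}$. The quantum group is the quotient Hopf algebra $U_q(\mathfrak g)=D/(K_\lambda\otimes1-1\otimes K'_\lambda:\lambda\in\mathcal P)$, with projection $\pi:D\to U_q(\mathfrak g)$. The $q$-boson algebra $B_q(\mathfrak g)$ is generated by $e_i,f_i,t_\lambda$ subject to the relations holding in $U_q^+$ (with $E_i\mapsto e_i$, $K_\lambda\mapsto t_\lambda$), the relations holding in $U_q^-$ (with $F_i\mapsto f_i$, $K'_\lambda\mapsto t_\lambda$), and $e'_if_j=q^{-(\alpha_i,\alpha_j)}f_je'_i+\delta_{ij}$, where $e'_i=(q_i^{-1}-q_i)t_{\alpha_i}e_i$. The quantized Weyl algebra $W_q(\mathfrak g)$ is the subalgebra of $B_q(\mathfrak g)$ generated by all $e'_i$ and $f_i$. **Proposition.** There is an injective algebra homomorphism $j:W_q(\mathfrak g)\to\mathcal H$ with $j(e'_i)=1\sharp E'_i$ and $j(f_i)=F_i\sharp1$. The action of $D$ and the coaction $\delta$ on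 $\mathcal H$ descend along $\pi$ to $W_q(\mathfrak g)$: there are an action of $U_q(\mathfrak g)$ on $W_q(\mathfrak g)$ and a coaction $\rho:W_q(\mathfrak g)\to U_q(\mathfrak g)\otimes W_q(\mathfrak g)$ such that $$j(\pi(d).w)=d.j(w),\qquad (\mathrm{id}\otimes j)(\rho(w))=(\pi\otimes\mathrm{id})(\delta(j(w)))\qquad(d\in D,\ w\in W_q(\mathfrak g)).$$ With this action $W_q(\mathfrak g)$ is a $U_q(\mathfrak g)$-module algebra, i.e. $h.(vw)=\sum(h_{(1)}.v)(h_{(2)}.w)$ and $h.1=\varepsilon(h)1$; with this action and coaction it is a left $U_q(\mathfrak g)$-Yetter–Drinfeld module, i.e. $\sum h_{(1)}w_{(-1)}\otimes h_{(2)}.w_{(0)}=\sum(h_{(1)}.w)_{(-1)}h_{(2)}\otimes(h_{(1)}.w)_{(0)}$. -/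

import Mathlib

namespace QuantumWeyl
noncomputable section
open scoped TensorProduct
open Coalgebra HopfAlgebra WithConv
set_option linter.unusedSectionVars false
set_option linter.unusedSimpArgs false
set_option linter.unusedVariables false

section Twist
variable {k : Type*} [CommRing k]

section scal
variable {C C' A A' : Type*} [AddCommGroup C] [Module k C] [Coalgebra k C]
  [AddCommGroup C'] [Module k C'] [Coalgebra k C'] [Ring A] [Algebra k A] [Ring A'] [Algebra k A']

/-- A linear functional seen as an element of the convolution algebra `Hom(C, A)`. -/
def scal (A : Type*) [Ring A] [Algebra k A] (s : WithConv (C →ₗ[k] k)) : WithConv (C →ₗ[k] A) :=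
  toConv (Algebra.linearMap k A ∘ₗ s.ofConv)

theorem scal_apply (s : WithConv (C →ₗ[k] k)) (c : C) : scal A s c = algebraMap k A (s c) := rfl

theorem scal_mul (s t : WithConv (C →ₗ[k] k)) : scal A (s * t) = scal A s * scal A t :=
  congrArg toConv (LinearMap.algHom_comp_convMul_distrib (Algebra.ofId k A) s t)

theorem scal_one : scal A (1 : WithConv (C →ₗ[k] k)) = 1 := rfl

theorem scal_self (s : WithConv (C →ₗ[k] k)) : scal k s = s := by
  ext c; simp [scal_apply]

theorem comp_mul (f g : WithConv (C →ₗ[k] A)) (h : C' →ₗc[k] C) :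
    toConv ((f * g).ofConv ∘ₗ h.toLinearMap) =
      toConv (f.ofConv ∘ₗ h.toLinearMap) * toConv (g.ofConv ∘ₗ h.toLinearMap) :=
  congrArg toConv (LinearMap.convMul_comp_coalgHom_distrib f g h)

theorem alg_comp_mul (i : A →ₐ[k] A') (f g : WithConv (C →ₗ[k] A)) :
    toConv (i.toLinearMap ∘ₗ (f * g).ofConv) =
      toConv (i.toLinearMap ∘ₗ f.ofConv) * toConv (i.toLinearMap ∘ₗ g.ofConv) :=
  congrArg toConv (LinearMap.algHom_comp_convMul_distrib i f g)

/-- `s ⊗ ε`. -/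
def extR (C' : Type*) [AddCommGroup C'] [Module k C'] [Coalgebra k C']
    (s : WithConv (C →ₗ[k] k)) : WithConv (C ⊗[k] C' →ₗ[k] k) :=
  toConv (LinearMap.mul' k k ∘ₗ TensorProduct.map s.ofConv counit)

/-- `ε ⊗ s`. -/
def extL (C' : Type*) [AddCommGroup C'] [Module k C'] [Coalgebra k C']
    (s : WithConv (C →ₗ[k] k)) : WithConv (C' ⊗[k] C →ₗ[k] k) :=
  toConv (LinearMap.mul' k k ∘ₗ TensorProduct.map counit s.ofConv)

theorem conv_tmul' {ι κ : Type*} (f g : WithConv (C ⊗[k] C' →ₗ[k] A)) {u : C} {z : C'}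
    (r : Repr k u ι) (r' : Repr k z κ) :
    (f * g).ofConv (u ⊗ₜ[k] z) = ∑ i ∈ r.index, ∑ j ∈ r'.index,
      f (r.left i ⊗ₜ r'.left j) * g (r.right i ⊗ₜ r'.right j) := by
  rw [LinearMap.convMul_apply, TensorProduct.comul_tmul, ← r.eq, ← r'.eq]
  simpa [TensorProduct.sum_tmul, TensorProduct.tmul_sum] using Finset.sum_comm

theorem conv_tmul (f g : WithConv (C ⊗[k] C' →ₗ[k] A)) (u : C) (z : C') :
    (f * g).ofConv (u ⊗ₜ[k] z) = ∑ i ∈ (ℛ k u).index, ∑ j ∈ (ℛ k z).index,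
      f ((ℛ k u).left i ⊗ₜ (ℛ k z).left j) * g ((ℛ k u).right i ⊗ₜ (ℛ k z).right j) :=
  conv_tmul' f g _ _

theorem sum_smul_counit {z : C} {ι : Type*} (r : Repr k z ι) :
    ∑ x ∈ r.index, counit (R := k) (r.right x) • r.left x = z := by
  simpa only [map_sum, TensorProduct.rid_tmul, one_smul] using
    congrArg (TensorProduct.rid k C) (sum_tmul_counit_eq r)

theorem extR_mul (s t : WithConv (C →ₗ[k] k)) : extR C' s * extR C' t = extR C' (s * t) := by
  ext u z
  simp only [TensorProduct.AlgebraTensorModule.curry_apply, TensorProduct.curry_apply,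
    LinearMap.coe_restrictScalars]
  rw [conv_tmul]
  simp only [extR, LinearMap.comp_apply, TensorProduct.map_tmul, LinearMap.mul'_apply,
    (ℛ k u).convMul_apply]
  have := congrArg (counit (R := k)) (Coalgebra.sum_counit_smul (R := k) (ℛ k z))
  simp only [map_sum, map_smul, smul_eq_mul] at this
  rw [← this, Finset.sum_mul_sum]
  exact Finset.sum_congr rfl fun i _ => Finset.sum_congr rfl fun j _ => by ring

theorem extL_mul (s t : WithConv (C →ₗ[k] k)) : extL C' s * extL C' t = extL C' (s * t) := by
  ext z u
  simp only [TensorProduct.AlgebraTensorModule.curry_apply, TensorProduct.curry_apply,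
    LinearMap.coe_restrictScalars]
  rw [conv_tmul]
  simp only [extL, LinearMap.comp_apply, TensorProduct.map_tmul, LinearMap.mul'_apply,
    (ℛ k u).convMul_apply]
  have := congrArg (counit (R := k)) (Coalgebra.sum_counit_smul (R := k) (ℛ k z))
  simp only [map_sum, map_smul, smul_eq_mul] at this
  rw [← this, Finset.sum_mul_sum]
  exact Finset.sum_congr rfl fun i _ => Finset.sum_congr rfl fun j _ => by ring

theorem extR_one : extR C' (1 : WithConv (C →ₗ[k] k)) = 1 := by
  ext u z; simp [extR, mul_comm]

theorem extL_one : extL C' (1 : WithConv (C →ₗ[k] k)) = 1 := by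
  ext u z; simp [extL, mul_comm]

theorem comp_scal_left {A : Type*} [Ring A] [Algebra k A] (f : A ⊗[k] C' →ₗ[k] A')
    (s : WithConv (C →ₗ[k] k)) (g : WithConv (C →ₗ[k] A)) :
    toConv (f ∘ₗ (scal A s * g).ofConv.rTensor C') =
      scal A' (extR C' s) * toConv (f ∘ₗ g.ofConv.rTensor C') := by
  ext u z
  simp only [TensorProduct.AlgebraTensorModule.curry_apply, TensorProduct.curry_apply,
    LinearMap.coe_restrictScalars]
  rw [conv_tmul]
  simp only [LinearMap.comp_apply, LinearMap.rTensor_tmul, (ℛ k u).convMul_apply,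
    scal_apply, extR,
    TensorProduct.map_tmul, LinearMap.mul'_apply, ← Algebra.smul_def, TensorProduct.sum_tmul,
    map_sum, ← TensorProduct.smul_tmul', map_smul, mul_smul, ← Finset.smul_sum]
  refine Finset.sum_congr rfl fun i _ => ?_
  conv_lhs => rw [← Coalgebra.sum_counit_smul (ℛ k z)]
  simp only [TensorProduct.tmul_sum, map_sum, TensorProduct.tmul_smul, map_smul]

theorem comp_scal_right {A : Type*} [Ring A] [Algebra k A] (f : A ⊗[k] C' →ₗ[k] A')
    (s : WithConv (C →ₗ[k] k)) (g : WithConv (C →ₗ[k] A)) :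
    toConv (f ∘ₗ (g * scal A s).ofConv.rTensor C') =
      toConv (f ∘ₗ g.ofConv.rTensor C') * scal A' (extR C' s) := by
  ext u z
  simp only [TensorProduct.AlgebraTensorModule.curry_apply, TensorProduct.curry_apply,
    LinearMap.coe_restrictScalars]
  rw [conv_tmul]
  simp only [LinearMap.comp_apply, LinearMap.rTensor_tmul, (ℛ k u).convMul_apply,
    scal_apply, extR, TensorProduct.map_tmul, LinearMap.mul'_apply, ← Algebra.commutes,
    ← Algebra.smul_def, TensorProduct.sum_tmul,
    map_sum, ← TensorProduct.smul_tmul', map_smul, mul_smul, ← Finset.smul_sum]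
  refine Finset.sum_congr rfl fun i _ => ?_
  conv_lhs => rw [← sum_smul_counit (ℛ k z)]
  simp only [TensorProduct.tmul_sum, map_sum, TensorProduct.tmul_smul, map_smul]

theorem comp_scal_left' {A : Type*} [Ring A] [Algebra k A] (f : C' ⊗[k] A →ₗ[k] A')
    (s : WithConv (C →ₗ[k] k)) (g : WithConv (C →ₗ[k] A)) :
    toConv (f ∘ₗ (scal A s * g).ofConv.lTensor C') =
      scal A' (extL C' s) * toConv (f ∘ₗ g.ofConv.lTensor C') := by
  ext z u
  simp only [TensorProduct.AlgebraTensorModule.curry_apply, TensorProduct.curry_apply,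
    LinearMap.coe_restrictScalars]
  rw [conv_tmul, Finset.sum_comm]
  simp only [LinearMap.comp_apply, LinearMap.lTensor_tmul, (ℛ k u).convMul_apply,
    scal_apply, extL, TensorProduct.map_tmul, LinearMap.mul'_apply, ← Algebra.smul_def,
    TensorProduct.tmul_sum, mul_comm (counit _) (s.ofConv _),
    map_sum, TensorProduct.tmul_smul, map_smul, mul_smul, ← Finset.smul_sum]
  refine Finset.sum_congr rfl fun i _ => ?_
  conv_lhs => rw [← Coalgebra.sum_counit_smul (ℛ k z)]
  simp only [TensorProduct.sum_tmul, map_sum, ← TensorProduct.smul_tmul', map_smul]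

theorem comp_scal_right' {A : Type*} [Ring A] [Algebra k A] (f : C' ⊗[k] A →ₗ[k] A')
    (s : WithConv (C →ₗ[k] k)) (g : WithConv (C →ₗ[k] A)) :
    toConv (f ∘ₗ (g * scal A s).ofConv.lTensor C') =
      toConv (f ∘ₗ g.ofConv.lTensor C') * scal A' (extL C' s) := by
  ext z u
  simp only [TensorProduct.AlgebraTensorModule.curry_apply, TensorProduct.curry_apply,
    LinearMap.coe_restrictScalars]
  rw [conv_tmul, Finset.sum_comm]
  simp only [LinearMap.comp_apply, LinearMap.lTensor_tmul, (ℛ k u).convMul_apply,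
    scal_apply, extL, TensorProduct.map_tmul, LinearMap.mul'_apply, ← Algebra.commutes,
    ← Algebra.smul_def, TensorProduct.tmul_sum, mul_comm (counit _) (s.ofConv _),
    map_sum, TensorProduct.tmul_smul, map_smul, mul_smul, ← Finset.smul_sum]
  refine Finset.sum_congr rfl fun i _ => ?_
  conv_lhs => rw [← sum_smul_counit (ℛ k z)]
  simp only [TensorProduct.sum_tmul, map_sum, ← TensorProduct.smul_tmul', map_smul]

end scal

variable {H : Type*} [Ring H] [Bialgebra k H]

/-- The multiplication of `H`, in the convolution algebra `Hom(H ⊗ H, H)`. -/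
def mulC (k H : Type*) [CommRing k] [Ring H] [Bialgebra k H] : WithConv (H ⊗[k] H →ₗ[k] H) :=
  toConv (LinearMap.mul' k H)

variable (k H) in
/-- A normalised convolution-invertible 2-cocycle `σ` on the bialgebra `H`, with inverse `τ`. In
Sweedler notation the last condition is
`∑ σ(x₁, y₁) σ(x₂ y₂, z) = ∑ σ(y₁, z₁) σ(x, y₂ z₂)`. -/
structure TwoCocycle where
  σ : WithConv (H ⊗[k] H →ₗ[k] k)
  τ : WithConv (H ⊗[k] H →ₗ[k] k)
  mul_inv : σ * τ = 1
  inv_mul : τ * σ = 1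
  one_left : ∀ x, σ (1 ⊗ₜ x) = counit x
  one_right : ∀ x, σ (x ⊗ₜ 1) = counit x
  cocycle : ∀ x y z, σ ((scal H σ * mulC k H) (x ⊗ₜ y) ⊗ₜ z) =
    σ (x ⊗ₜ (scal H σ * mulC k H) (y ⊗ₜ z))

namespace TwoCocycle
variable (c : TwoCocycle k H)

/-- `x ∘ y = ∑ σ(x₁, y₁) x₂ y₂` -/
def lmul : WithConv (H ⊗[k] H →ₗ[k] H) := scal H c.σ * mulC k H

/-- `x • y = ∑ σ(x₁, y₁) x₂ y₂ σ⁻¹(x₃, y₃)` -/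
def dmul : WithConv (H ⊗[k] H →ₗ[k] H) := scal H c.σ * mulC k H * scal H c.τ

/-- `m ⊗ id` -/
abbrev mL (k H : Type*) [CommRing k] [Ring H] [Bialgebra k H] : (H ⊗[k] H) ⊗[k] H →ₗc[k] H ⊗[k] H :=
  Coalgebra.TensorProduct.map (Bialgebra.mulCoalgHom k H) (.id k H)

abbrev mR (k H : Type*) [CommRing k] [Ring H] [Bialgebra k H] : H ⊗[k] (H ⊗[k] H) →ₗc[k] H ⊗[k] H :=
  Coalgebra.TensorProduct.map (.id k H) (Bialgebra.mulCoalgHom k H)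

abbrev asc (k H : Type*) [CommRing k] [Ring H] [Bialgebra k H] :
    (H ⊗[k] H) ⊗[k] H →ₗc[k] H ⊗[k] (H ⊗[k] H) :=
  (Coalgebra.TensorProduct.assoc k k H H H : _ ≃ₗc[k] _)

theorem lmul_rT (X : Type*) [Ring X] [Algebra k X] (f : WithConv (H ⊗[k] H →ₗ[k] X)) :
    toConv (f.ofConv ∘ₗ c.lmul.ofConv.rTensor H) =
      scal X (extR H c.σ) * toConv (f.ofConv ∘ₗ (mL k H).toLinearMap) :=
  comp_scal_left _ _ _

theorem lmul_lT (X : Type*) [Ring X] [Algebra k X] (f : WithConv (H ⊗[k] H →ₗ[k] X)) :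
    toConv (f.ofConv ∘ₗ c.lmul.ofConv.lTensor H) =
      scal X (extL H c.σ) * toConv (f.ofConv ∘ₗ (mR k H).toLinearMap) :=
  comp_scal_left' _ _ _

/-- Precomposition with the associator. -/
def pre {X : Type*} [Ring X] [Algebra k X] (f : WithConv (H ⊗[k] (H ⊗[k] H) →ₗ[k] X)) :
    WithConv ((H ⊗[k] H) ⊗[k] H →ₗ[k] X) := toConv (f.ofConv ∘ₗ (asc k H).toLinearMap)

theorem pre_mul {X : Type*} [Ring X] [Algebra k X] (f g : WithConv (H ⊗[k] (H ⊗[k] H) →ₗ[k] X)) :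
    pre (f * g) = pre f * pre g := comp_mul f g (asc k H)

theorem pre_one {X : Type*} [Ring X] [Algebra k X] :
    pre (1 : WithConv (H ⊗[k] (H ⊗[k] H) →ₗ[k] X)) = 1 := by
  ext x y z; simp [pre, mul_assoc]

theorem pre_scal {X : Type*} [Ring X] [Algebra k X] (f : WithConv (H ⊗[k] (H ⊗[k] H) →ₗ[k] k)) :
    pre (scal X f) = scal X (pre f) := rfl

/-- The cocycle identity in the convolution algebra. -/
theorem cocycle_conv : extR H c.σ * toConv (c.σ.ofConv ∘ₗ (mL k H).toLinearMap) =
    pre (extL H c.σ * toConv (c.σ.ofConv ∘ₗ (mR k H).toLinearMap)) := by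
  have h1 := c.lmul_rT k c.σ
  have h2 := c.lmul_lT k c.σ
  rw [scal_self] at h1 h2
  rw [← h1, ← h2]
  ext x y z
  exact c.cocycle x y z

theorem cocycle_conv_inv : toConv (c.τ.ofConv ∘ₗ (mL k H).toLinearMap) * extR H c.τ =
    pre (toConv (c.τ.ofConv ∘ₗ (mR k H).toLinearMap) * extL H c.τ) := by
  refine left_inv_eq_right_inv (a := extR H c.σ * toConv (c.σ.ofConv ∘ₗ (mL k H).toLinearMap)) ?_ ?_
  · rw [mul_assoc, ← mul_assoc (extR H c.τ), extR_mul, c.inv_mul, extR_one, one_mul, ← comp_mul,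
      c.inv_mul]
    ext x y z; simp [mul_comm]
  · rw [cocycle_conv, ← pre_mul, mul_assoc, ← mul_assoc (toConv (c.σ.ofConv ∘ₗ _)),
      ← comp_mul, c.mul_inv]
    have : toConv ((1 : WithConv (H ⊗[k] H →ₗ[k] k)).ofConv ∘ₗ (mR k H).toLinearMap) = 1 := by
      ext x y z; simp [mul_comm, mul_left_comm]
    rw [this, one_mul, extL_mul, c.mul_inv, extL_one, pre_one]

theorem mulC_assoc : toConv ((mulC k H).ofConv ∘ₗ (mL k H).toLinearMap) =
    pre (toConv ((mulC k H).ofConv ∘ₗ (mR k H).toLinearMap)) := by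
  ext x y z; simp [pre, mulC, mul_assoc]

theorem lmul_assoc : toConv (c.lmul.ofConv ∘ₗ c.lmul.ofConv.rTensor H) =
    pre (toConv (c.lmul.ofConv ∘ₗ c.lmul.ofConv.lTensor H)) := by
  rw [lmul_rT, lmul_lT]
  simp only [lmul, comp_mul, pre_mul, pre_scal, ← mulC_assoc]
  have := congrArg (scal H) c.cocycle_conv
  simp only [pre_mul, scal_mul] at this
  rw [← mul_assoc, ← mul_assoc]
  exact congrArg (· * _) this

theorem dmul_rT (X : Type*) [Ring X] [Algebra k X] (f : WithConv (H ⊗[k] H →ₗ[k] X)) :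
    toConv (f.ofConv ∘ₗ c.dmul.ofConv.rTensor H) =
      scal X (extR H c.σ) * toConv (f.ofConv ∘ₗ (mL k H).toLinearMap) * scal X (extR H c.τ) :=
  (comp_scal_right _ _ _).trans (congrArg (· * _) (comp_scal_left _ _ _))

theorem dmul_lT (X : Type*) [Ring X] [Algebra k X] (f : WithConv (H ⊗[k] H →ₗ[k] X)) :
    toConv (f.ofConv ∘ₗ c.dmul.ofConv.lTensor H) =
      scal X (extL H c.σ) * toConv (f.ofConv ∘ₗ (mR k H).toLinearMap) * scal X (extL H c.τ) :=
  (comp_scal_right' _ _ _).trans (congrArg (· * _) (comp_scal_left' _ _ _))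

theorem dmul_assoc : toConv (c.dmul.ofConv ∘ₗ c.dmul.ofConv.rTensor H) =
    pre (toConv (c.dmul.ofConv ∘ₗ c.dmul.ofConv.lTensor H)) := by
  rw [dmul_rT, dmul_lT]
  simp only [dmul, comp_mul, pre_mul, pre_scal, ← mulC_assoc]
  have h1 := congrArg (scal H) c.cocycle_conv
  have h2 := congrArg (scal H) c.cocycle_conv_inv
  simp only [pre_mul, scal_mul] at h1 h2
  have e1 : ∀ t, toConv ((scal H t).ofConv ∘ₗ (mL k H).toLinearMap) =
    scal H (toConv (t.ofConv ∘ₗ (mL k H).toLinearMap)) := fun _ => rfl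
  have e2 : ∀ t, pre (toConv ((scal H t).ofConv ∘ₗ (mR k H).toLinearMap)) =
    scal H (pre (toConv (t.ofConv ∘ₗ (mR k H).toLinearMap))) := fun _ => rfl
  rw [e1, e1, e2, e2]
  simp only [mul_assoc] at h1 h2 ⊢
  rw [h2, ← mul_assoc, h1]
  simp only [mul_assoc]

/-- `Δ(1) = 1 ⊗ 1`. -/
def reprOne (k H : Type*) [CommRing k] [Ring H] [Bialgebra k H] : Repr k (1 : H) Unit where
  index := {()}
  left _ := 1
  right _ := 1
  eq := by simp [Algebra.TensorProduct.one_def]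

theorem τ_one_left (x : H) : c.τ (1 ⊗ₜ x) = counit x := by
  have h := congrArg (fun f => f.ofConv ((1 : H) ⊗ₜ[k] x)) c.inv_mul
  simp only [conv_tmul' _ _ (reprOne k H) (ℛ k x)] at h
  simp only [reprOne, Finset.sum_singleton, c.one_left, mul_comm _ (counit _)] at h
  conv_lhs => rw [← sum_smul_counit (ℛ k x)]
  simpa [TensorProduct.tmul_sum] using h

theorem τ_one_right (x : H) : c.τ (x ⊗ₜ 1) = counit x := by
  have h := congrArg (fun f => f.ofConv (x ⊗ₜ[k] (1 : H))) c.inv_mul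
  simp only [conv_tmul' _ _ (ℛ k x) (reprOne k H)] at h
  simp only [reprOne, Finset.sum_singleton, c.one_right, mul_comm _ (counit _)] at h
  conv_lhs => rw [← sum_smul_counit (ℛ k x)]
  simpa [TensorProduct.sum_tmul, ← TensorProduct.smul_tmul'] using h

theorem lmul_one_left (x : H) : c.lmul (1 ⊗ₜ x) = x := by
  rw [lmul, conv_tmul' _ _ (reprOne k H) (ℛ k x)]
  simp only [reprOne, Finset.sum_singleton, scal_apply, c.one_left, ← Algebra.smul_def]
  simpa [mulC] using Coalgebra.sum_counit_smul (ℛ k x)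

theorem lmul_one_right (x : H) : c.lmul (x ⊗ₜ 1) = x := by
  rw [lmul, conv_tmul' _ _ (ℛ k x) (reprOne k H)]
  simp only [reprOne, Finset.sum_singleton, scal_apply, c.one_right, ← Algebra.smul_def]
  simpa [mulC] using Coalgebra.sum_counit_smul (ℛ k x)

theorem dmul_one_left (x : H) : c.dmul (1 ⊗ₜ x) = x := by
  change (c.lmul * scal H c.τ).ofConv _ = _
  rw [conv_tmul' _ _ (reprOne k H) (ℛ k x)]
  simp only [reprOne, Finset.sum_singleton, scal_apply, c.τ_one_left, ← Algebra.commutes,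
    ← Algebra.smul_def, lmul_one_left]
  exact sum_smul_counit (ℛ k x)

theorem dmul_one_right (x : H) : c.dmul (x ⊗ₜ 1) = x := by
  change (c.lmul * scal H c.τ).ofConv _ = _
  rw [conv_tmul' _ _ (ℛ k x) (reprOne k H)]
  simp only [reprOne, Finset.sum_singleton, scal_apply, c.τ_one_right, ← Algebra.commutes,
    ← Algebra.smul_def, lmul_one_right]
  exact sum_smul_counit (ℛ k x)

/-- `ε(x • y) = ε(x) ε(y)` -/
theorem counit_dmul (x y : H) : counit (R := k) (c.dmul (x ⊗ₜ y)) = counit x * counit y := by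
  have h : toConv (counit (R := k) ∘ₗ c.dmul.ofConv) = (1 : WithConv (H ⊗[k] H →ₗ[k] k)) := by
    change toConv ((Bialgebra.counitAlgHom k H).toLinearMap ∘ₗ c.dmul.ofConv) = _
    have e1 : toConv ((Bialgebra.counitAlgHom k H).toLinearMap ∘ₗ (scal H c.σ).ofConv) = c.σ := by
      ext; simp [scal]
    have e2 : toConv ((Bialgebra.counitAlgHom k H).toLinearMap ∘ₗ (scal H c.τ).ofConv) = c.τ := by
      ext; simp [scal]
    have e3 : toConv ((Bialgebra.counitAlgHom k H).toLinearMap ∘ₗ (mulC k H).ofConv) = 1 := by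
      ext; simp [mulC, mul_comm]
    rw [dmul, alg_comp_mul, alg_comp_mul, e1, e2, e3, mul_one, c.mul_inv]
  have := congrArg (fun f => f.ofConv (x ⊗ₜ[k] y)) h
  simpa [mul_comm] using this

/-- `Δ(x • y) = ∑ (x₁ • y₁) ⊗ (x₂ • y₂)` -/
theorem comul_dmul (x y : H) : comul (R := k) (c.dmul (x ⊗ₜ y)) =
    ∑ i ∈ (ℛ k x).index, ∑ j ∈ (ℛ k y).index,
      c.dmul ((ℛ k x).left i ⊗ₜ (ℛ k y).left j) ⊗ₜ
        c.dmul ((ℛ k x).right i ⊗ₜ (ℛ k y).right j) := by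
  let i1 : H →ₐ[k] H ⊗[k] H := Algebra.TensorProduct.includeLeft
  let i2 : H →ₐ[k] H ⊗[k] H := Algebra.TensorProduct.includeRight
  have push : ∀ i : H →ₐ[k] H ⊗[k] H, toConv (i.toLinearMap ∘ₗ c.dmul.ofConv) =
      scal _ c.σ * toConv (i.toLinearMap ∘ₗ (mulC k H).ofConv) * scal _ c.τ := by
    intro i
    have e1 : ∀ s : WithConv (H ⊗[k] H →ₗ[k] k),
        toConv (i.toLinearMap ∘ₗ (scal H s).ofConv) = scal _ s := by
      intro s; ext; simp [scal]
    rw [dmul, alg_comp_mul, alg_comp_mul, e1, e1]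
  have hm : toConv ((Bialgebra.comulAlgHom k H).toLinearMap ∘ₗ (mulC k H).ofConv) =
      toConv (i1.toLinearMap ∘ₗ (mulC k H).ofConv) *
        toConv (i2.toLinearMap ∘ₗ (mulC k H).ofConv) := by
    ext u v
    simp only [TensorProduct.AlgebraTensorModule.curry_apply, TensorProduct.curry_apply,
      LinearMap.coe_restrictScalars]
    rw [conv_tmul]
    simp only [mulC, LinearMap.comp_apply, LinearMap.mul'_apply, AlgHom.toLinearMap_apply,
      map_mul, Bialgebra.comulAlgHom_apply]
    conv_lhs => rw [← (ℛ k u).eq, ← (ℛ k v).eq]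
    simp [Finset.sum_mul_sum, i1, i2]
  have h : toConv ((Bialgebra.comulAlgHom k H).toLinearMap ∘ₗ c.dmul.ofConv) =
      toConv (i1.toLinearMap ∘ₗ c.dmul.ofConv) * toConv (i2.toLinearMap ∘ₗ c.dmul.ofConv) := by
    rw [push, push, push, hm]
    have : scal (H ⊗[k] H) c.τ * scal (H ⊗[k] H) c.σ = 1 := by
      rw [← scal_mul, c.inv_mul, scal_one]
    simp only [mul_assoc]
    rw [← mul_assoc (scal _ c.τ) (scal _ c.σ), this, one_mul]
  have := congrArg (fun f => f.ofConv (x ⊗ₜ[k] y)) h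
  simp only [conv_tmul] at this
  simpa [i1, i2] using this

end TwoCocycle

/-- The algebra `_σ H`: the module `H` with product `x ∘ y = ∑ σ(x₁, y₁) x₂ y₂`. -/
def LTwist (_c : TwoCocycle k H) : Type _ := H

/-- The algebra `H^σ`: the coalgebra `H` with product
`x • y = ∑ σ(x₁, y₁) x₂ y₂ σ⁻¹(x₃, y₃)`. -/
def Twist (_c : TwoCocycle k H) : Type _ := H

variable (c : TwoCocycle k H)

instance : AddCommGroup (LTwist c) := inferInstanceAs (AddCommGroup H)
instance : Module k (LTwist c) := inferInstanceAs (Module k H)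
instance : AddCommGroup (Twist c) := inferInstanceAs (AddCommGroup H)
instance : Module k (Twist c) := inferInstanceAs (Module k H)
instance : Coalgebra k (Twist c) := inferInstanceAs (Coalgebra k H)

instance : Ring (LTwist c) where
  __ := (inferInstance : AddCommGroup (LTwist c))
  mul x y := c.lmul.ofConv (x ⊗ₜ[k] y)
  one := (1 : H)
  mul_assoc x y z := congrArg (fun f => f.ofConv ((x ⊗ₜ[k] y) ⊗ₜ[k] z)) c.lmul_assoc
  one_mul := c.lmul_one_left
  mul_one := c.lmul_one_right
  left_distrib x y z := (congrArg c.lmul.ofConv (TensorProduct.tmul_add (R := k) (M := H) x y z)).trans (map_add _ _ _)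
  right_distrib x y z := (congrArg c.lmul.ofConv (TensorProduct.add_tmul (R := k) (M := H) x y z)).trans (map_add _ _ _)
  zero_mul x := (congrArg c.lmul.ofConv (TensorProduct.zero_tmul (R := k) H (x : H))).trans (map_zero _)
  mul_zero x := (congrArg c.lmul.ofConv (TensorProduct.tmul_zero (R := k) H (x : H))).trans (map_zero _)

instance : Algebra k (LTwist c) := Algebra.ofModule
  (fun r x y => (congrArg c.lmul.ofConv (TensorProduct.smul_tmul' (R := k) (M := H) r x y).symm).trans (map_smul _ _ _))
  (fun r x y => (congrArg c.lmul.ofConv (TensorProduct.tmul_smul (R := k) (M := H) r x y)).trans (map_smul _ _ _))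

instance : Ring (Twist c) where
  __ := (inferInstance : AddCommGroup (Twist c))
  mul x y := c.dmul.ofConv (x ⊗ₜ[k] y)
  one := (1 : H)
  mul_assoc x y z := congrArg (fun f => f.ofConv ((x ⊗ₜ[k] y) ⊗ₜ[k] z)) c.dmul_assoc
  one_mul := c.dmul_one_left
  mul_one := c.dmul_one_right
  left_distrib x y z := (congrArg c.dmul.ofConv (TensorProduct.tmul_add (R := k) (M := H) x y z)).trans (map_add _ _ _)
  right_distrib x y z := (congrArg c.dmul.ofConv (TensorProduct.add_tmul (R := k) (M := H) x y z)).trans (map_add _ _ _)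
  zero_mul x := (congrArg c.dmul.ofConv (TensorProduct.zero_tmul (R := k) H (x : H))).trans (map_zero _)
  mul_zero x := (congrArg c.dmul.ofConv (TensorProduct.tmul_zero (R := k) H (x : H))).trans (map_zero _)

instance : Algebra k (Twist c) := Algebra.ofModule
  (fun r x y => (congrArg c.dmul.ofConv (TensorProduct.smul_tmul' (R := k) (M := H) r x y).symm).trans (map_smul _ _ _))
  (fun r x y => (congrArg c.dmul.ofConv (TensorProduct.tmul_smul (R := k) (M := H) r x y)).trans (map_smul _ _ _))

instance : Bialgebra k (Twist c) := Bialgebra.mk' k (Twist c)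
  (Bialgebra.counit_one (R := k) (A := H)) (fun {x y} => c.counit_dmul x y)
  (Bialgebra.comul_one (R := k) (A := H)) (fun {x y} => by
    have h := c.comul_dmul x y
    refine Eq.trans h ?_
    rw [← (ℛ k x).eq, ← (ℛ k y).eq, Finset.sum_mul_sum]
    simp only [Algebra.TensorProduct.tmul_mul_tmul]
    rfl)

end Twist

section Pairing
variable (k A B : Type*) [CommRing k] [Ring A] [Ring B] [HopfAlgebra k A] [HopfAlgebra k B]

/-- The antipode of `A` is invertible. -/
class HasBijectiveAntipode : Prop where
  bijective : Function.Bijective (antipode k : A →ₗ[k] A)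

/-- The inverse of the antipode. -/
def antipodeInv [HasBijectiveAntipode k A] : A →ₗ[k] A :=
  (LinearEquiv.ofBijective (antipode k) (HasBijectiveAntipode.bijective (k := k) (A := A))).symm

/-- A generalized Hopf pairing `φ : A × B → k`:
`φ(a, b b') = ∑ φ(a₁, b) φ(a₂, b')`, `φ(a a', b) = ∑ φ(a, b₂) φ(a', b₁)`,
`φ(a, 1) = ε(a)`, `φ(1, b) = ε(b)`. -/
structure HopfPairing where
  toFun : A →ₗ[k] B →ₗ[k] k
  mul_right : ∀ a b b', toFun a (b * b') =
    ∑ i ∈ (ℛ k a).index, toFun ((ℛ k a).left i) b * toFun ((ℛ k a).right i) b'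
  mul_left : ∀ a a' b, toFun (a * a') b =
    ∑ i ∈ (ℛ k b).index, toFun a ((ℛ k b).right i) * toFun a' ((ℛ k b).left i)
  one_right : ∀ a, toFun a 1 = counit a
  one_left : ∀ b, toFun 1 b = counit b

variable {k A B}

@[simp] theorem antipodeInv_antipode [HasBijectiveAntipode k A] (a : A) :
    antipodeInv k A (antipode k a) = a :=
  (LinearEquiv.ofBijective (antipode k) _).symm_apply_apply a

@[simp] theorem antipode_antipodeInv [HasBijectiveAntipode k A] (a : A) :
    antipode k (antipodeInv k A a) = a :=
  (LinearEquiv.ofBijective (antipode k) _).apply_symm_apply a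

theorem repr_sum {C M : Type*} [AddCommGroup C] [Module k C] [Coalgebra k C] [AddCommGroup M]
    [Module k M] {c : C} {ι : Type*} (r : Repr k c ι) (f : C →ₗ[k] C →ₗ[k] M) :
    ∑ i ∈ r.index, f (r.left i) (r.right i) = TensorProduct.lift f (comul c) := by
  simp [← r.eq]

namespace HopfPairing
variable (φ : HopfPairing k A B)

instance : CoeFun (HopfPairing k A B) fun _ => A → B →ₗ[k] k := ⟨fun φ => φ.toFun⟩

theorem mul_right' {ι : Type*} {a : A} (r : Repr k a ι) (b b' : B) :
    φ a (b * b') = ∑ i ∈ r.index, φ (r.left i) b * φ (r.right i) b' := by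
  rw [φ.mul_right]
  have h := repr_sum (ℛ k a) (((LinearMap.mul k k).compl₂ (φ.toFun.flip b')) ∘ₗ φ.toFun.flip b)
  have h' := repr_sum r (((LinearMap.mul k k).compl₂ (φ.toFun.flip b')) ∘ₗ φ.toFun.flip b)
  exact h.trans h'.symm

theorem mul_left' {ι : Type*} {b : B} (r : Repr k b ι) (a a' : A) :
    φ (a * a') b = ∑ i ∈ r.index, φ a (r.right i) * φ a' (r.left i) := by
  rw [φ.mul_left]
  have h := repr_sum (ℛ k b) (((LinearMap.mul k k).compl₂ (φ.toFun a')) ∘ₗ φ.toFun a).flip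
  have h' := repr_sum r (((LinearMap.mul k k).compl₂ (φ.toFun a')) ∘ₗ φ.toFun a).flip
  exact h.trans h'.symm

/-- `∑ a₂ S⁻¹(a₁) = ε(a)` -/
theorem sum_mul_antipodeInv [HasBijectiveAntipode k A] (a : A) :
    ∑ i ∈ (ℛ k a).index, (ℛ k a).right i * antipodeInv k A ((ℛ k a).left i) =
      algebraMap k A (counit a) := by
  apply (HasBijectiveAntipode.bijective (k := k) (A := A)).1
  simp only [map_sum, antipode_mul_antidistrib, antipode_antipodeInv]
  rw [sum_mul_antipode_eq_smul]
  simp [Algebra.algebraMap_eq_smul_one]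

/-- `φ(S⁻¹ a, b) = φ(a, S b)` -/
theorem antipodeInv_left [HasBijectiveAntipode k A] (a : A) (b : B) :
    φ (antipodeInv k A a) b = φ a (antipode k b) := by
  let f : WithConv (A ⊗[k] B →ₗ[k] k) := toConv (TensorProduct.lift φ.toFun)
  let g : WithConv (A ⊗[k] B →ₗ[k] k) := toConv (TensorProduct.lift (φ.toFun.compl₂ (antipode k)))
  let f' : WithConv (A ⊗[k] B →ₗ[k] k) :=
    toConv (TensorProduct.lift (φ.toFun ∘ₗ antipodeInv k A))
  have h1 : f' * f = 1 := by
    ext a b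
    simp only [TensorProduct.AlgebraTensorModule.curry_apply, TensorProduct.curry_apply,
      LinearMap.coe_restrictScalars]
    rw [conv_tmul]
    have := congrArg (fun x => φ x b) (sum_mul_antipodeInv (k := k) a)
    simp only [map_sum, LinearMap.sum_apply, φ.mul_left] at this
    simp only [f, f', TensorProduct.lift.tmul, LinearMap.comp_apply]
    simp only [mul_comm]
    rw [this]
    simp [Algebra.algebraMap_eq_smul_one, φ.one_left, mul_comm]
  have h2 : f * g = 1 := by
    ext a b
    simp only [TensorProduct.AlgebraTensorModule.curry_apply, TensorProduct.curry_apply,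
      LinearMap.coe_restrictScalars]
    rw [conv_tmul]
    have := congrArg (fun x => φ a x) (sum_mul_antipode_eq_smul (ℛ k b))
    simp only [map_sum, φ.mul_right] at this
    rw [Finset.sum_comm] at this
    simp only [f, g, TensorProduct.lift.tmul, LinearMap.compl₂_apply]
    rw [this]
    simp [φ.one_right, mul_comm]
  have h3 : f' = g := left_inv_eq_right_inv h1 h2
  have := congrArg (fun f => f.ofConv (a ⊗ₜ[k] b)) h3
  simpa [f', g] using this

theorem antipode_antipode [HasBijectiveAntipode k A] (a : A) (b : B) :
    φ (antipode k a) (antipode k b) = φ a b := by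
  rw [← φ.antipodeInv_left, antipodeInv_antipode]

/-- The Hopf pairing `(b, a) ↦ φ(S⁻¹ a, b)` between `B` and `A`. -/
def inv [HasBijectiveAntipode k A] : HopfPairing k B A where
  toFun := (φ.toFun ∘ₗ antipodeInv k A).flip
  mul_right b a a' := by
    have h : antipodeInv k A (a * a') = antipodeInv k A a' * antipodeInv k A a := by
      apply (HasBijectiveAntipode.bijective (k := k) (A := A)).1
      simp [antipode_mul_antidistrib]
    simp only [LinearMap.flip_apply, LinearMap.comp_apply, h, φ.mul_left]
    exact Finset.sum_congr rfl fun i _ => mul_comm _ _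
  mul_left b b' a := by
    change φ (antipodeInv k A a) (b * b') =
      ∑ i ∈ (ℛ k a).index, φ (antipodeInv k A ((ℛ k a).right i)) b *
        φ (antipodeInv k A ((ℛ k a).left i)) b'
    rw [antipodeInv_left, antipode_mul_antidistrib, φ.mul_right]
    simp only [antipodeInv_left]
    exact Finset.sum_congr rfl fun i _ => mul_comm _ _
  one_right b := by
    have h : antipodeInv k A 1 = 1 := by
      apply (HasBijectiveAntipode.bijective (k := k) (A := A)).1
      simp
    simp [h, φ.one_left]
  one_left a := by
    change φ (antipodeInv k A a) 1 = _
    rw [antipodeInv_left, antipode_one, φ.one_right]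

section cocycle
variable {H : Type*} [Ring H] [Bialgebra k H]

/-- The bilinear form `(x, y) ↦ φ(p(x), p'(y))` on `H`. -/
def form (p : H →ₐc[k] A) (p' : H →ₐc[k] B) : WithConv (H ⊗[k] H →ₗ[k] k) :=
  toConv (TensorProduct.lift φ.toFun ∘ₗ TensorProduct.map (p : H →ₗ[k] A) (p' : H →ₗ[k] B))

/-- The bilinear form `(x, y) ↦ φ(p(x), S(p'(y)))` on `H`. -/
def formInv (p : H →ₐc[k] A) (p' : H →ₐc[k] B) : WithConv (H ⊗[k] H →ₗ[k] k) :=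
  toConv (TensorProduct.lift (φ.toFun.compl₂ (antipode k)) ∘ₗ
    TensorProduct.map (p : H →ₗ[k] A) (p' : H →ₗ[k] B))

theorem form_apply (p : H →ₐc[k] A) (p' : H →ₐc[k] B) (x y : H) :
    φ.form p p' (x ⊗ₜ y) = φ (p x) (p' y) := by simp [form]

theorem formInv_apply (p : H →ₐc[k] A) (p' : H →ₐc[k] B) (x y : H) :
    φ.formInv p p' (x ⊗ₜ y) = φ (p x) (antipode k (p' y)) := by simp [formInv]

/-- The 2-cocycle `σ(x, y) = φ(p(x), p'(y))` on `H` attached to a Hopf pairing between `A` and `B`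
and to bialgebra morphisms `p : H → A`, `p' : H → B` with
`∑ p(x₁) ⊗ p'(x₂) = ∑ p(x₂) ⊗ p'(x₁)`. -/
def cocycle (p : H →ₐc[k] A) (p' : H →ₐc[k] B)
    (hp : ∀ x, ∑ i ∈ (ℛ k x).index, p ((ℛ k x).left i) ⊗ₜ[k] p' ((ℛ k x).right i) =
      ∑ i ∈ (ℛ k x).index, p ((ℛ k x).right i) ⊗ₜ[k] p' ((ℛ k x).left i)) : TwoCocycle k H where
  σ := φ.form p p'
  τ := φ.formInv p p'
  mul_inv := by
    ext x y
    simp only [TensorProduct.AlgebraTensorModule.curry_apply, TensorProduct.curry_apply,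
      LinearMap.coe_restrictScalars]
    rw [conv_tmul, Finset.sum_comm]
    simp only [form_apply, formInv_apply]
    have := congrArg (fun z => φ (p x) z)
      (sum_mul_antipode_eq_smul ((ℛ k y).induced p'))
    simp only [map_sum, φ.mul_right' ((ℛ k x).induced p)] at this
    simp only [Repr.induced] at this
    refine Eq.trans ?_ (this.trans ?_)
    · rfl
    · simp [φ.one_right, mul_comm]
  inv_mul := by
    ext x y
    simp only [TensorProduct.AlgebraTensorModule.curry_apply, TensorProduct.curry_apply,
      LinearMap.coe_restrictScalars]
    rw [conv_tmul, Finset.sum_comm]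
    simp only [form_apply, formInv_apply]
    have := congrArg (fun z => φ (p x) z)
      (sum_antipode_mul_eq_smul ((ℛ k y).induced p'))
    simp only [map_sum, φ.mul_right' ((ℛ k x).induced p)] at this
    simp only [Repr.induced] at this
    refine Eq.trans ?_ (this.trans ?_)
    · rfl
    · simp [φ.one_right, mul_comm]
  one_left x := by simp [form_apply, φ.one_left]
  one_right x := by simp [form_apply, φ.one_right]
  cocycle x y z := by
    have e : ∀ x y, (scal H (φ.form p p') * mulC k H) (x ⊗ₜ y) =
      ∑ i ∈ (ℛ k x).index, ∑ j ∈ (ℛ k y).index,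
        φ (p ((ℛ k x).left i)) (p' ((ℛ k y).left j)) • ((ℛ k x).right i * (ℛ k y).right j) := by
      intro x y
      rw [conv_tmul]
      simp only [scal_apply, form_apply, ← Algebra.smul_def, mulC, LinearMap.mul'_apply]
    rw [e, e]
    simp only [TensorProduct.sum_tmul, TensorProduct.tmul_sum, map_sum, ← TensorProduct.smul_tmul',
      TensorProduct.tmul_smul, map_smul, form_apply, map_mul, smul_eq_mul]
    simp only [φ.mul_left' ((ℛ k z).induced p'), φ.mul_right' ((ℛ k x).induced p)]
    simp only [Repr.induced, Finset.mul_sum, Function.comp_apply]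
    have key : ∀ u v, ∑ j ∈ (ℛ k y).index, φ u (p' ((ℛ k y).left j)) * φ (p ((ℛ k y).right j)) v =
        ∑ j ∈ (ℛ k y).index, φ (p ((ℛ k y).left j)) v * φ u (p' ((ℛ k y).right j)) := by
      intro u v
      have := congrArg (TensorProduct.lift ((LinearMap.mul k k).compl₁₂ (φ.toFun.flip v)
        (φ.toFun u))) (hp y)
      simp only [map_sum, TensorProduct.lift.tmul, LinearMap.compl₁₂_apply, LinearMap.flip_apply,
        LinearMap.mul_apply'] at this
      rw [this]
      exact Finset.sum_congr rfl fun i _ => mul_comm _ _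
    calc _ = ∑ i ∈ (ℛ k x).index, ∑ l ∈ (ℛ k z).index,
          (∑ j ∈ (ℛ k y).index, φ (p ((ℛ k x).left i)) (p' ((ℛ k y).left j)) *
            φ (p ((ℛ k y).right j)) (p' ((ℛ k z).left l))) *
            φ (p ((ℛ k x).right i)) (p' ((ℛ k z).right l)) := by
          refine Finset.sum_congr rfl fun i _ => ?_
          simp only [Finset.sum_mul]
          rw [Finset.sum_comm]
          exact Finset.sum_congr rfl fun l _ => Finset.sum_congr rfl fun j _ => by ring
      _ = ∑ i ∈ (ℛ k x).index, ∑ l ∈ (ℛ k z).index,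
          (∑ j ∈ (ℛ k y).index, φ (p ((ℛ k y).left j)) (p' ((ℛ k z).left l)) *
            φ (p ((ℛ k x).left i)) (p' ((ℛ k y).right j))) *
            φ (p ((ℛ k x).right i)) (p' ((ℛ k z).right l)) := by
          simp only [key]
      _ = _ := by
          simp only [Finset.sum_mul]
          rw [Finset.sum_comm]
          conv_rhs => rw [Finset.sum_comm]
          refine Finset.sum_congr rfl fun l _ => ?_
          rw [Finset.sum_comm]
          exact Finset.sum_congr rfl fun j _ => Finset.sum_congr rfl fun i _ => by ring

end cocycle
end HopfPairing
end Pairing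

section Doubles
variable {k A B : Type*} [CommRing k] [Ring A] [Ring B] [HopfAlgebra k A] [HopfAlgebra k B]

section proj
variable (k) (X Y : Type*) [Ring X] [Ring Y] [Bialgebra k X] [Bialgebra k Y]

/-- `x ⊗ y ↦ ε(y) x` -/
def projL : X ⊗[k] Y →ₐc[k] X :=
  ((Bialgebra.TensorProduct.rid k k X : _ ≃ₐc[k] _) : X ⊗[k] k →ₐc[k] X).comp
    (Bialgebra.TensorProduct.map (.id k X) (Bialgebra.counitBialgHom k Y))

/-- `x ⊗ y ↦ ε(x) y` -/
def projR : X ⊗[k] Y →ₐc[k] Y :=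
  ((Bialgebra.TensorProduct.lid k Y : _ ≃ₐc[k] _) : k ⊗[k] Y →ₐc[k] Y).comp
    (Bialgebra.TensorProduct.map (Bialgebra.counitBialgHom k X) (.id k Y))

variable {X Y}
@[simp] theorem projL_tmul (x : X) (y : Y) : projL k X Y (x ⊗ₜ y) = counit (R := k) y • x := by
  simp [projL]

@[simp] theorem projR_tmul (x : X) (y : Y) : projR k X Y (x ⊗ₜ y) = counit (R := k) x • y := by
  simp [projR]

theorem sum_tmul_repr {C D M : Type*} [AddCommGroup C] [Module k C] [Coalgebra k C]
    [AddCommGroup D] [Module k D] [Coalgebra k D] [AddCommGroup M] [Module k M]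
    (f : C ⊗[k] D →ₗ[k] C ⊗[k] D →ₗ[k] M) (c : C) (d : D) :
    ∑ i ∈ (ℛ k (c ⊗ₜ[k] d)).index,
      f ((ℛ k (c ⊗ₜ[k] d)).left i) ((ℛ k (c ⊗ₜ[k] d)).right i) =
    ∑ i ∈ (ℛ k c).index, ∑ j ∈ (ℛ k d).index,
      f ((ℛ k c).left i ⊗ₜ (ℛ k d).left j) ((ℛ k c).right i ⊗ₜ (ℛ k d).right j) := by
  rw [repr_sum, TensorProduct.comul_tmul]
  conv_lhs => rw [← (ℛ k c).eq, ← (ℛ k d).eq]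
  simpa [TensorProduct.sum_tmul, TensorProduct.tmul_sum] using Finset.sum_comm

theorem proj_comm₁ (x : X ⊗[k] Y) :
    ∑ i ∈ (ℛ k x).index, projR k X Y ((ℛ k x).left i) ⊗ₜ[k] projL k X Y ((ℛ k x).right i) =
      TensorProduct.comm k X Y x := by
  let f : X ⊗[k] Y →ₗ[k] X ⊗[k] Y →ₗ[k] Y ⊗[k] X :=
    (TensorProduct.mk k Y X).compl₁₂ (projR k X Y : _ →ₗ[k] _) (projL k X Y : _ →ₗ[k] _)
  change ∑ i ∈ (ℛ k x).index, f ((ℛ k x).left i) ((ℛ k x).right i) = _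
  rw [repr_sum]
  induction x using TensorProduct.induction_on with
  | zero => simp
  | add x y hx hy => simp only [map_add, hx, hy]
  | tmul x y =>
    rw [← repr_sum (ℛ k _), sum_tmul_repr]
    simp only [f, LinearMap.compl₁₂_apply, TensorProduct.mk_apply, LinearMap.coe_coe, projL_tmul,
      projR_tmul, TensorProduct.comm_tmul]
    conv_rhs => rw [← sum_smul_counit (ℛ k y), ← sum_counit_smul (ℛ k x)]
    simp only [TensorProduct.sum_tmul, TensorProduct.tmul_sum, ← TensorProduct.smul_tmul',
      TensorProduct.tmul_smul]
    simp only [Finset.smul_sum]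
    exact Finset.sum_congr rfl fun i _ => Finset.sum_congr rfl fun j _ => smul_comm (M := k) _ _ _

theorem proj_comm₂ (x : X ⊗[k] Y) :
    ∑ i ∈ (ℛ k x).index, projR k X Y ((ℛ k x).right i) ⊗ₜ[k] projL k X Y ((ℛ k x).left i) =
      TensorProduct.comm k X Y x := by
  let f : X ⊗[k] Y →ₗ[k] X ⊗[k] Y →ₗ[k] Y ⊗[k] X :=
    ((TensorProduct.mk k Y X).compl₁₂ (projR k X Y : _ →ₗ[k] _) (projL k X Y : _ →ₗ[k] _)).flip
  change ∑ i ∈ (ℛ k x).index, f ((ℛ k x).left i) ((ℛ k x).right i) = _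
  rw [repr_sum]
  induction x using TensorProduct.induction_on with
  | zero => simp
  | add x y hx hy => simp only [map_add, hx, hy]
  | tmul x y =>
    rw [← repr_sum (ℛ k _), sum_tmul_repr]
    simp only [f, LinearMap.compl₁₂_apply, TensorProduct.mk_apply, LinearMap.coe_coe, projL_tmul,
      projR_tmul, TensorProduct.comm_tmul, LinearMap.flip_apply]
    conv_rhs => rw [← sum_counit_smul (ℛ k y), ← sum_smul_counit (ℛ k x)]
    simp only [TensorProduct.sum_tmul, TensorProduct.tmul_sum, ← TensorProduct.smul_tmul',
      TensorProduct.tmul_smul]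
    simp only [Finset.smul_sum]
    exact Finset.sum_congr rfl fun i _ => Finset.sum_congr rfl fun j _ => smul_comm (M := k) _ _ _

end proj

namespace HopfPairing
variable (φ : HopfPairing k A B)

/-- The 2-cocycle `σ(b ⊗ a, b' ⊗ a') = ε(b) φ(a, b') ε(a')` on the bialgebra `B ⊗ A`. -/
def tensorCocycle : TwoCocycle k (B ⊗[k] A) :=
  φ.cocycle (projR k B A) (projL k B A) fun x => (proj_comm₁ k x).trans (proj_comm₂ k x).symm

theorem tensorCocycle_σ (a a' : A) (b b' : B) :
    φ.tensorCocycle.σ ((b ⊗ₜ a) ⊗ₜ (b' ⊗ₜ a')) = counit (R := k) b * φ a b' * counit (R := k) a' := by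
  change φ.form _ _ _ = _
  rw [form_apply]
  simp; ring

theorem tensorCocycle_τ (a a' : A) (b b' : B) :
    φ.tensorCocycle.τ ((b ⊗ₜ a) ⊗ₜ (b' ⊗ₜ a')) =
      counit (R := k) b * φ a (antipode k b') * counit (R := k) a' := by
  change φ.formInv _ _ _ = _
  rw [formInv_apply]
  simp; ring

/-- The Heisenberg double `H_φ(A, B)`: the module `B ⊗ A` with the product
`(b ♯ a)(b' ♯ a') = ∑ φ(a₁, b'₁) b b'₂ ♯ a₂ a'`, see `heis_mul`. -/
abbrev Heis : Type _ := LTwist φ.tensorCocycle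

/-- `b ♯ a` -/
def sharp (b : B) (a : A) : φ.Heis := (b ⊗ₜ[k] a : B ⊗[k] A)

theorem heis_mul' {ι κ : Type*} (a a' : A) (b b' : B) (r : Repr k a ι) (r' : Repr k b' κ) :
    φ.tensorCocycle.lmul ((b ⊗ₜ a) ⊗ₜ (b' ⊗ₜ a')) =
    ∑ i ∈ r.index, ∑ j ∈ r'.index, φ (r.left i) (r'.left j) •
      ((b * r'.right j) ⊗ₜ[k] (r.right i * a') : B ⊗[k] A) := by
  rw [TwoCocycle.lmul, conv_tmul' _ _ ((ℛ k b).tmul r) (r'.tmul (ℛ k a'))]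
  simp only [Repr.tmul_index, Repr.tmul_left, Repr.tmul_right, Finset.sum_product, scal_apply,
    tensorCocycle_σ, ← Algebra.smul_def, mulC, LinearMap.mul'_apply,
    Algebra.TensorProduct.tmul_mul_tmul]
  rw [Finset.sum_comm]
  refine Finset.sum_congr rfl fun i _ => ?_
  rw [Finset.sum_comm]
  refine Finset.sum_congr rfl fun j _ => ?_
  conv_rhs => rw [← sum_counit_smul (ℛ k b), ← sum_counit_smul (ℛ k a')]
  simp only [Finset.sum_mul, Finset.mul_sum, TensorProduct.sum_tmul, TensorProduct.tmul_sum,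
    Finset.smul_sum, smul_mul_assoc, mul_smul_comm, ← TensorProduct.smul_tmul',
    TensorProduct.tmul_smul, smul_smul]
  rw [Finset.sum_comm]
  exact Finset.sum_congr rfl fun x _ => Finset.sum_congr rfl fun y _ =>
    congrArg (fun r : k => r • _) (by ring)

theorem heis_mul (a a' : A) (b b' : B) : φ.sharp b a * φ.sharp b' a' =
    ∑ i ∈ (ℛ k a).index, ∑ j ∈ (ℛ k b').index, φ ((ℛ k a).left i) ((ℛ k b').left j) •
      φ.sharp (b * (ℛ k b').right j) ((ℛ k a).right i * a') :=
  φ.heis_mul' a a' b b' _ _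

/-- The quantum double `D_φ(A, B)`: the coalgebra `A ⊗ B` with the product
`(a ⊗ b)(a' ⊗ b') = ∑ φ(S⁻¹(a'₁), b₁) φ(a'₃, b₃) a a'₂ ⊗ b₂ b'`, see `double_mul`. -/
abbrev Double [HasBijectiveAntipode k A] : Type _ := Twist φ.inv.tensorCocycle

/-- `a ⊗ b` as an element of the quantum double. -/
def dtmul [HasBijectiveAntipode k A] (a : A) (b : B) : φ.Double := (a ⊗ₜ[k] b : A ⊗[k] B)


theorem double_mul' [HasBijectiveAntipode k A] {ι κ : Type*} (a a' : A) (b b' : B)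
    (r : Repr k b ι) (r' : Repr k a' κ) :
    φ.inv.tensorCocycle.dmul ((a ⊗ₜ b) ⊗ₜ (a' ⊗ₜ b')) =
    ∑ i ∈ r.index, ∑ j ∈ r'.index, φ (r'.right j) (r.right i) •
      φ.inv.tensorCocycle.lmul ((a ⊗ₜ r.left i) ⊗ₜ (r'.left j ⊗ₜ b')) := by
  change (φ.inv.tensorCocycle.lmul * scal _ φ.inv.tensorCocycle.τ).ofConv _ = _
  rw [conv_tmul' _ _ ((ℛ k a).tmul r) (r'.tmul (ℛ k b'))]
  simp only [Repr.tmul_index, Repr.tmul_left, Repr.tmul_right, Finset.sum_product, scal_apply,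
    tensorCocycle_τ, ← Algebra.smul_def, ← Algebra.commutes]
  rw [Finset.sum_comm]
  refine Finset.sum_congr rfl fun i _ => ?_
  rw [Finset.sum_comm]
  refine Finset.sum_congr rfl fun j _ => ?_
  have h : φ.inv (r.right i) (antipode k (r'.right j)) = φ (r'.right j) (r.right i) := by
    change φ (antipodeInv k A _) _ = _
    rw [antipodeInv_antipode]
  rw [h]
  conv_rhs => rw [← sum_smul_counit (ℛ k a), ← sum_smul_counit (ℛ k b')]
  simp only [TensorProduct.sum_tmul, TensorProduct.tmul_sum,
    Finset.smul_sum, ← TensorProduct.smul_tmul', map_sum, map_smul,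
    TensorProduct.tmul_smul, smul_smul]
  rw [Finset.sum_comm]
  exact Finset.sum_congr rfl fun x _ => Finset.sum_congr rfl fun y _ =>
    congrArg (fun r : k => r • _) (by ring)

theorem double_mul [HasBijectiveAntipode k A] (a a' : A) (b b' : B) :
    φ.dtmul a b * φ.dtmul a' b' =
    ∑ i ∈ (ℛ k b).index, ∑ j ∈ (ℛ k a').index,
      ∑ r ∈ (ℛ k ((ℛ k b).left i)).index, ∑ s ∈ (ℛ k ((ℛ k a').left j)).index,
        (φ (antipodeInv k A ((ℛ k ((ℛ k a').left j)).left s)) ((ℛ k ((ℛ k b).left i)).left r) *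
          φ ((ℛ k a').right j) ((ℛ k b).right i)) •
        φ.dtmul (a * (ℛ k ((ℛ k a').left j)).right s) ((ℛ k ((ℛ k b).left i)).right r * b') := by
  refine (φ.double_mul' a a' b b' (ℛ k b) (ℛ k a')).trans ?_
  refine Finset.sum_congr rfl fun i _ => Finset.sum_congr rfl fun j _ => ?_
  rw [φ.inv.heis_mul' _ _ _ _ (ℛ k _) (ℛ k _)]
  simp only [Finset.smul_sum, smul_smul]
  refine Finset.sum_congr rfl fun x _ => Finset.sum_congr rfl fun y _ => ?_
  rw [mul_comm]
  rfl

variable [HasBijectiveAntipode k A]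

theorem dtmul_mul_left (a a' : A) (b : B) : φ.dtmul a 1 * φ.dtmul a' b = φ.dtmul (a * a') b := by
  refine (φ.double_mul' a a' 1 b (TwoCocycle.reprOne k B) (ℛ k a')).trans ?_
  have : ∀ x : A, φ.inv.tensorCocycle.lmul ((a ⊗ₜ (1 : B)) ⊗ₜ (x ⊗ₜ b)) = (a * x) ⊗ₜ b := by
    intro x
    rw [φ.inv.heis_mul' _ _ _ _ (TwoCocycle.reprOne k B) (ℛ k x)]
    simp only [TwoCocycle.reprOne, Finset.sum_singleton, φ.inv.one_left, one_mul]
    conv_rhs => rw [← sum_counit_smul (ℛ k x)]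
    simp only [Finset.mul_sum, TensorProduct.sum_tmul, mul_smul_comm, TensorProduct.smul_tmul']
  simp only [TwoCocycle.reprOne, Finset.sum_singleton, this, φ.one_right]
  change _ = (a * a') ⊗ₜ b
  conv_rhs => rw [← sum_smul_counit (ℛ k a')]
  simp only [Finset.mul_sum, TensorProduct.sum_tmul, mul_smul_comm, TensorProduct.smul_tmul']

theorem dtmul_mul_right (a : A) (b b' : B) : φ.dtmul a b * φ.dtmul 1 b' = φ.dtmul a (b * b') := by
  refine (φ.double_mul' a 1 b b' (ℛ k b) (TwoCocycle.reprOne k A)).trans ?_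
  have : ∀ x : B, φ.inv.tensorCocycle.lmul ((a ⊗ₜ x) ⊗ₜ ((1 : A) ⊗ₜ b')) = a ⊗ₜ (x * b') := by
    intro x
    rw [φ.inv.heis_mul' _ _ _ _ (ℛ k x) (TwoCocycle.reprOne k A)]
    simp only [TwoCocycle.reprOne, Finset.sum_singleton, φ.inv.one_right, mul_one]
    conv_rhs => rw [← sum_counit_smul (ℛ k x)]
    simp only [Finset.sum_mul, TensorProduct.tmul_sum, smul_mul_assoc, TensorProduct.tmul_smul]
  simp only [TwoCocycle.reprOne, Finset.sum_singleton, this, φ.one_left]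
  change _ = a ⊗ₜ (b * b')
  conv_rhs => rw [← sum_smul_counit (ℛ k b)]
  simp only [Finset.sum_mul, TensorProduct.tmul_sum, smul_mul_assoc, TensorProduct.tmul_smul]

/-- `a ↦ a ⊗ 1` -/
def inlD : A →ₐ[k] φ.Double := AlgHom.ofLinearMap ((TensorProduct.mk k A B).flip 1) rfl
  fun a a' => (φ.dtmul_mul_left a a' 1).symm

/-- `b ↦ 1 ⊗ b` -/
def inrD : B →ₐ[k] φ.Double := AlgHom.ofLinearMap (TensorProduct.mk k A B 1) rfl
  fun b b' => (φ.dtmul_mul_right 1 b b').symm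

theorem inlD_mul_inrD (a : A) (b : B) : φ.inlD a * φ.inrD b = φ.dtmul a b := by
  refine (φ.dtmul_mul_left a 1 b).trans ?_
  rw [mul_one]

/-- `S(a ⊗ b) = (1 ⊗ S(b)) (S(a) ⊗ 1)` -/
def antipodeD : φ.Double →ₗ[k] φ.Double :=
  TensorProduct.lift (((LinearMap.mul k φ.Double).compl₁₂ (φ.inrD.toLinearMap ∘ₗ antipode k)
    (φ.inlD.toLinearMap ∘ₗ antipode k)).flip)

theorem antipodeD_dtmul (a : A) (b : B) :
    φ.antipodeD (φ.dtmul a b) = φ.inrD (antipode k b) * φ.inlD (antipode k a) :=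
  TensorProduct.lift.tmul _ _

/-- `Δ(a ⊗ b) = ∑ (a₁ ⊗ b₁) ⊗ (a₂ ⊗ b₂)` -/
theorem comul_dtmul {ι κ : Type*} (a : A) (b : B) (r : Repr k a ι) (r' : Repr k b κ) :
    comul (R := k) (φ.dtmul a b) = ∑ i ∈ r.index, ∑ j ∈ r'.index,
      φ.dtmul (r.left i) (r'.left j) ⊗ₜ[k] φ.dtmul (r.right i) (r'.right j) := by
  have := (r.tmul r').eq
  simp only [Repr.tmul_index, Repr.tmul_left, Repr.tmul_right, Finset.sum_product] at this
  exact this.symm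

theorem counit_dtmul (a : A) (b : B) :
    counit (R := k) (φ.dtmul a b) = counit (R := k) a * counit (R := k) b := by
  change counit (R := k) (a ⊗ₜ[k] b) = _
  simp [mul_comm]

theorem antipodeD_mul_id (a : A) (b : B) :
    LinearMap.mul' k φ.Double (φ.antipodeD.rTensor φ.Double (comul (φ.dtmul a b))) =
      algebraMap k φ.Double (counit (φ.dtmul a b)) := by
  rw [φ.comul_dtmul a b (ℛ k a) (ℛ k b), counit_dtmul]
  have e : ∀ (a a' : A) (b b' : B), φ.antipodeD (φ.dtmul a b) * φ.dtmul a' b' =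
      φ.inrD (antipode k b) * φ.inlD (antipode k a * a') * φ.inrD b' := by
    intro a a' b b'
    rw [antipodeD_dtmul, ← inlD_mul_inrD, map_mul]
    simp only [mul_assoc]
  simp only [map_sum, LinearMap.rTensor_tmul, LinearMap.mul'_apply, e]
  rw [Finset.sum_comm]
  simp only [← Finset.sum_mul, ← Finset.mul_sum, ← map_sum, sum_antipode_mul_eq_smul, map_smul,
    map_one, mul_smul_comm, mul_one, smul_mul_assoc, ← Finset.smul_sum]
  simp only [← map_mul, ← map_sum, sum_antipode_mul_eq_smul, map_smul, map_one, smul_smul,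
    Algebra.algebraMap_eq_smul_one]

theorem id_mul_antipodeD (a : A) (b : B) :
    LinearMap.mul' k φ.Double (φ.antipodeD.lTensor φ.Double (comul (φ.dtmul a b))) =
      algebraMap k φ.Double (counit (φ.dtmul a b)) := by
  rw [φ.comul_dtmul a b (ℛ k a) (ℛ k b), counit_dtmul]
  have e : ∀ (a a' : A) (b b' : B), φ.dtmul a b * φ.antipodeD (φ.dtmul a' b') =
      φ.inlD a * φ.inrD (b * antipode k b') * φ.inlD (antipode k a') := by
    intro a a' b b'
    rw [antipodeD_dtmul, ← inlD_mul_inrD, map_mul]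
    simp only [mul_assoc]
  simp only [map_sum, LinearMap.lTensor_tmul, LinearMap.mul'_apply, e]
  simp only [← Finset.sum_mul, ← Finset.mul_sum, ← map_sum, sum_mul_antipode_eq_algebraMap_counit,
    AlgHom.commutes, ← Algebra.commutes]
  simp only [mul_assoc, ← map_mul, ← Finset.mul_sum, ← map_sum,
    sum_mul_antipode_eq_algebraMap_counit, AlgHom.commutes]
  rw [mul_comm]

theorem double_hom_ext {f g : φ.Double →ₗ[k] φ.Double}
    (h : ∀ a b, f (φ.dtmul a b) = g (φ.dtmul a b)) : f = g :=
  TensorProduct.ext' (M := A) (N := B) h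

instance : HopfAlgebra k φ.Double where
  antipode := φ.antipodeD
  mul_antipode_rTensor_comul := φ.double_hom_ext φ.antipodeD_mul_id
  mul_antipode_lTensor_comul := φ.double_hom_ext φ.id_mul_antipodeD

end HopfPairing
end Doubles

section YetterDrinfeld
variable {k H V : Type*} [CommRing k] [Ring H] [Bialgebra k H] [AddCommGroup V] [Module k V]

/-- `act : H ⊗ V → V` is a left `H`-module structure on `V`. -/
structure IsModuleAction (act : H →ₗ[k] V →ₗ[k] V) : Prop where
  one_act : ∀ v, act 1 v = v
  mul_act : ∀ g h v, act (g * h) v = act g (act h v)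

/-- `coact : V → H ⊗ V` is a left `H`-comodule structure on `V`. -/
structure IsComoduleCoaction (coact : V →ₗ[k] H ⊗[k] V) : Prop where
  coassoc : TensorProduct.assoc k H H V ∘ₗ (comul.rTensor V) ∘ₗ coact = coact.lTensor H ∘ₗ coact
  counit : (counit (R := k) (A := H)).rTensor V ∘ₗ coact = TensorProduct.mk k k V 1

/-- The left `H`-Yetter–Drinfeld modules: `H`-modules and `H`-comodules with
`∑ h₁ v₋₁ ⊗ h₂.v₀ = ∑ (h₁.v)₋₁ h₂ ⊗ (h₁.v)₀`. -/
structure IsYetterDrinfeld (act : H →ₗ[k] V →ₗ[k] V) (coact : V →ₗ[k] H ⊗[k] V) : Prop where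
  module : IsModuleAction act
  comodule : IsComoduleCoaction coact
  compat : ∀ h v,
    ∑ i ∈ (ℛ k h).index, TensorProduct.map (LinearMap.mulLeft k ((ℛ k h).left i))
      (act ((ℛ k h).right i)) (coact v) =
    ∑ i ∈ (ℛ k h).index, (LinearMap.mulRight k ((ℛ k h).right i)).rTensor V
      (coact (act ((ℛ k h).left i) v))

/-- The left `H`-module algebras: algebras `V` with an `H`-module structure such that
`h.(v w) = ∑ (h₁.v)(h₂.w)` and `h.1 = ε(h) 1`. -/
structure IsModuleAlgebra {V : Type*} [Ring V] [Algebra k V] (act : H →ₗ[k] V →ₗ[k] V) : Prop where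
  module : IsModuleAction act
  act_mul : ∀ h v w, act h (v * w) =
    ∑ i ∈ (ℛ k h).index, act ((ℛ k h).left i) v * act ((ℛ k h).right i) w
  act_one : ∀ h, act h 1 = counit (R := k) h • (1 : V)

end YetterDrinfeld

namespace HopfPairing

section Schrodinger
variable {k A B : Type*} [CommRing k] [Ring A] [Ring B] [HopfAlgebra k A] [HopfAlgebra k B]

/-- The adjoint action `(a, x) ↦ ∑ a₁ x S(a₂)`. -/
def adj (k A : Type*) [CommRing k] [Ring A] [HopfAlgebra k A] : A →ₗ[k] A →ₗ[k] A :=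
  TensorProduct.lift (LinearMap.compl₁₂ (LinearMap.mul k (Module.End k A))
    (LinearMap.mul k A) ((LinearMap.mul k A).flip ∘ₗ antipode k)) ∘ₗ comul

theorem adj_apply (a x : A) : adj k A a x =
    ∑ i ∈ (ℛ k a).index, (ℛ k a).left i * (x * antipode k ((ℛ k a).right i)) := by
  rw [adj, LinearMap.comp_apply, ← (ℛ k a).eq]
  simp

variable [HasBijectiveAntipode k A] (φ : HopfPairing k A B)

/-- `(b, x) ↦ (1 ⊗ b).x = ∑ φ(x₁, S(b)) x₂` -/
def coadjA : B →ₗ[k] A →ₗ[k] A :=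
  LinearMap.mk₂ k
    (fun b x => TensorProduct.lid k A ((φ.toFun.flip (antipode k b)).rTensor A (comul x)))
    (by simp [LinearMap.rTensor_add]) (by simp [LinearMap.rTensor_smul]) (by simp) (by simp)

/-- `(a, y) ↦ (a ⊗ 1).y = ∑ φ(a, y₁) y₂` -/
def coadjB : A →ₗ[k] B →ₗ[k] B :=
  LinearMap.mk₂ k
    (fun a y => TensorProduct.lid k B ((φ.toFun a).rTensor B (comul y)))
    (by simp [LinearMap.rTensor_add]) (by simp [LinearMap.rTensor_smul]) (by simp) (by simp)

/-- The Schrödinger representation of `D_φ(A, B)` on `A`. -/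
def schrA : φ.Double →ₗ[k] A →ₗ[k] A :=
  TensorProduct.lift ((LinearMap.mul k (Module.End k A)).compl₁₂ (adj k A) φ.coadjA)

/-- The Schrödinger representation of `D_φ(A, B)` on `B`. -/
def schrB : φ.Double →ₗ[k] B →ₗ[k] B :=
  TensorProduct.lift ((LinearMap.mul k (Module.End k B)).compl₁₂ φ.coadjB (adj k B))

/-- `(a ⊗ b).x = ∑ φ(x₁, S(b)) a₁ x₂ S(a₂)` -/
theorem schrA_dtmul (a x : A) (b : B) : φ.schrA (φ.dtmul a b) x =
    ∑ j ∈ (ℛ k x).index, φ ((ℛ k x).left j) (antipode k b) • adj k A a ((ℛ k x).right j) := by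
  change adj k A a (φ.coadjA b x) = _
  rw [coadjA, LinearMap.mk₂_apply, ← (ℛ k x).eq]
  simp

/-- `(a ⊗ b).y = (a ⊗ 1).(∑ b₁ y S(b₂))` -/
theorem schrB_dtmul (a : A) (b y : B) : φ.schrB (φ.dtmul a b) y = φ.coadjB a (adj k B b y) := rfl

theorem coadjB_apply (a : A) (y : B) : φ.coadjB a y =
    ∑ j ∈ (ℛ k y).index, φ a ((ℛ k y).left j) • (ℛ k y).right j := by
  rw [coadjB, LinearMap.mk₂_apply, ← (ℛ k y).eq]
  simp

/-- The diagonal action of `D_φ(A, B)` on `H_φ(A, B)`: `d.(b ♯ a) = ∑ d₁.b ♯ d₂.a`. -/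
def heisAct : φ.Double →ₗ[k] φ.Heis →ₗ[k] φ.Heis :=
  (TensorProduct.homTensorHomMap (RingHom.id k) B A B A ∘ₗ TensorProduct.map φ.schrB φ.schrA ∘ₗ comul :
    φ.Double →ₗ[k] (B ⊗[k] A →ₗ[k] B ⊗[k] A))

theorem heisAct_sharp (d : φ.Double) (a : A) (b : B) : φ.heisAct d (φ.sharp b a) =
    ∑ i ∈ (ℛ k d).index,
      φ.sharp (φ.schrB ((ℛ k d).left i) b) (φ.schrA ((ℛ k d).right i) a) := by
  change (TensorProduct.homTensorHomMap (RingHom.id k) B A B A (TensorProduct.map φ.schrB φ.schrA (comul d)))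
    (b ⊗ₜ a) = _
  rw [← (ℛ k d).eq]
  simp [sharp]
  rfl

/-- The coaction `b ♯ a ↦ ∑ (1 ⊗ b₁)(a₁ ⊗ 1) ⊗ b₂ ♯ a₂` of `D_φ(A, B)` on `H_φ(A, B)`. -/
def heisCoact : φ.Heis →ₗ[k] φ.Double ⊗[k] φ.Heis :=
  ((TensorProduct.lift ((LinearMap.mul k φ.Double).compl₁₂ φ.inrD.toLinearMap
    φ.inlD.toLinearMap)).rTensor (B ⊗[k] A) ∘ₗ comul : B ⊗[k] A →ₗ[k] φ.Double ⊗[k] (B ⊗[k] A))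

theorem heisCoact_sharp (a : A) (b : B) : φ.heisCoact (φ.sharp b a) =
    ∑ i ∈ (ℛ k b).index, ∑ j ∈ (ℛ k a).index,
      (φ.dtmul 1 ((ℛ k b).left i) * φ.dtmul ((ℛ k a).left j) 1) ⊗ₜ
        φ.sharp ((ℛ k b).right i) ((ℛ k a).right j) := by
  change (TensorProduct.lift ((LinearMap.mul k φ.Double).compl₁₂ φ.inrD.toLinearMap
    φ.inlD.toLinearMap)).rTensor (B ⊗[k] A) (comul (b ⊗ₜ[k] a)) = _
  rw [← ((ℛ k b).tmul (ℛ k a)).eq]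
  simp only [Coalgebra.Repr.tmul_index, Coalgebra.Repr.tmul_left, Coalgebra.Repr.tmul_right,
    Finset.sum_product, map_sum, LinearMap.rTensor_tmul]
  rfl

end Schrodinger

section Radicals
variable {k A B : Type*} [Field k] [Ring A] [Ring B] [HopfAlgebra k A] [HopfAlgebra k B]
variable (φ : HopfPairing k A B)

theorem eq_zero_of_forall {Q Q' : Type*} [AddCommGroup Q] [Module k Q] [AddCommGroup Q']
    [Module k Q'] {B B' : Type*} [AddCommGroup B] [Module k B] [AddCommGroup B'] [Module k B']
    (f : Q →ₗ[k] B →ₗ[k] k) (g : Q' →ₗ[k] B' →ₗ[k] k) (hf : Function.Injective f)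
    (hg : Function.Injective g) (t : Q ⊗[k] Q')
    (h : ∀ b b', LinearMap.mul' k k (TensorProduct.map (f.flip b) (g.flip b') t) = 0) : t = 0 := by
  classical
  let c := Module.Basis.ofVectorSpace k Q'
  let e := TensorProduct.equivFinsuppOfBasisRight (M := Q) c
  have h1 : ∀ (t : Q ⊗[k] Q') b b', LinearMap.mul' k k (TensorProduct.map (f.flip b) (g.flip b') t) =
      g (TensorProduct.lid k Q' ((f.flip b).rTensor Q' t)) b' := by
    intro t b b'
    induction t using TensorProduct.induction_on with
    | zero => simp
    | add x y hx hy => simp only [map_add, hx, hy, LinearMap.add_apply]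
    | tmul x y => simp
  have h2 : ∀ (t : Q ⊗[k] Q') b i,
      c.repr (TensorProduct.lid k Q' ((f.flip b).rTensor Q' t)) i = f (e t i) b := by
    intro t b i
    induction t using TensorProduct.induction_on with
    | zero => simp
    | add x y hx hy => simp only [map_add, hx, hy, LinearMap.add_apply, Finsupp.add_apply]
    | tmul x y => simp [e, mul_comm]
  apply e.injective
  rw [map_zero]
  ext i
  apply hf
  ext b
  have h3 : TensorProduct.lid k Q' ((f.flip b).rTensor Q' t) = 0 := by
    apply hg
    ext b'
    rw [← h1, h]
    simp
  rw [← h2, h3]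
  simp

/-- The left radical `{a | φ(a, b) = 0 for all b}`. -/
def radL : Ideal A where
  carrier := {a | ∀ b, φ a b = 0}
  zero_mem' := by simp
  add_mem' := by
    intro x y hx hy b
    simp [hx b, hy b]
  smul_mem' := by
    intro c x hx b
    rw [smul_eq_mul, φ.mul_left]
    simp [hx _]

/-- The right radical `{b | φ(a, b) = 0 for all a}`. -/
def radR : Ideal B where
  carrier := {b | ∀ a, φ a b = 0}
  zero_mem' := by simp
  add_mem' := by
    intro x y hx hy a
    simp [hx a, hy a]
  smul_mem' := by
    intro c x hx a
    rw [smul_eq_mul, φ.mul_right]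
    simp [hx _]

theorem mem_radL {a : A} : a ∈ φ.radL ↔ ∀ b, φ a b = 0 := Iff.rfl
theorem mem_radR {b : B} : b ∈ φ.radR ↔ ∀ a, φ a b = 0 := Iff.rfl

instance : φ.radL.IsTwoSided := ⟨fun _ ha b => by rw [φ.mul_left]; simp [φ.mem_radL.1 ha]⟩
instance : φ.radR.IsTwoSided := ⟨fun _ ha b => by rw [φ.mul_right]; simp [φ.mem_radR.1 ha]⟩

/-- The pairing induced on `A / I_l` -/
def quotL : (A ⧸ φ.radL) →ₗ[k] B →ₗ[k] k :=
  (φ.radL.restrictScalars k).liftQ φ.toFun fun a ha => LinearMap.ext ha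

theorem quotL_mk (a : A) : φ.quotL (Ideal.Quotient.mk _ a) = φ.toFun a := rfl

theorem quotL_injective : Function.Injective φ.quotL := by
  rw [injective_iff_map_eq_zero]
  intro x hx
  obtain ⟨a, rfl⟩ := Ideal.Quotient.mk_surjective x
  exact Ideal.Quotient.eq_zero_iff_mem.2 fun b => by rw [← φ.quotL_mk, hx]; rfl

def quotR : (B ⧸ φ.radR) →ₗ[k] A →ₗ[k] k :=
  (φ.radR.restrictScalars k).liftQ φ.toFun.flip fun b hb => LinearMap.ext hb

theorem quotR_mk (b : B) : φ.quotR (Ideal.Quotient.mk _ b) = φ.toFun.flip b := rfl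

theorem quotR_injective : Function.Injective φ.quotR := by
  rw [injective_iff_map_eq_zero]
  intro x hx
  obtain ⟨a, rfl⟩ := Ideal.Quotient.mk_surjective x
  exact Ideal.Quotient.eq_zero_iff_mem.2 fun b => by
    have := LinearMap.congr_fun hx b
    rwa [φ.quotR_mk] at this

/-- The pairing induced by `φ` between `A / I_l` and `B / I_r`. -/
def quotLR : (A ⧸ φ.radL) →ₗ[k] (B ⧸ φ.radR) →ₗ[k] k :=
  ((φ.radR.restrictScalars k).liftQ φ.quotL.flip fun b hb => by
    refine LinearMap.ext fun x => ?_
    obtain ⟨a, rfl⟩ := Ideal.Quotient.mk_surjective x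
    exact hb a).flip

theorem quotLR_mk (a : A) (b : B) :
    φ.quotLR (Ideal.Quotient.mk _ a) (Ideal.Quotient.mk _ b) = φ a b := rfl

/-- `(x, x') ↦ φ(x, y) φ(x', y')` -/
def bilinR (y y' : B ⧸ φ.radR) : (A ⧸ φ.radL) →ₗ[k] (A ⧸ φ.radL) →ₗ[k] k :=
  (LinearMap.mul k k).compl₁₂ (φ.quotLR.flip y) (φ.quotLR.flip y')

/-- `(y', y) ↦ φ(x, y) φ(x', y')` -/
def bilinL (x x' : A ⧸ φ.radL) : (B ⧸ φ.radR) →ₗ[k] (B ⧸ φ.radR) →ₗ[k] k :=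
  ((LinearMap.mul k k).compl₁₂ (φ.quotLR x) (φ.quotLR x')).flip

variable [HasBijectiveAntipode k A] [HasBijectiveAntipode k B]

instance : φ.radL.IsHopfIdeal k where
  counit_eq_zero a ha := by rw [← φ.one_right]; exact ha 1
  map_mkQ_comul_eq_zero a ha := by
    let f : (A ⧸ φ.radL.restrictScalars k) →ₗ[k] B →ₗ[k] k := φ.quotL
    have hf : Function.Injective f := φ.quotL_injective
    refine eq_zero_of_forall f f hf hf _ fun b b' => ?_
    have := φ.mul_right a b b'
    rw [φ.mem_radL.1 ha] at this
    rw [← (ℛ k a).eq, map_sum, map_sum, map_sum]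
    exact this.symm
  antipode_mem a ha b := by
    rw [← antipode_antipodeInv (k := k) b, φ.antipode_antipode]; exact ha _

instance : φ.radR.IsHopfIdeal k where
  counit_eq_zero b hb := by rw [← φ.one_left]; exact hb 1
  map_mkQ_comul_eq_zero b hb := by
    let f : (B ⧸ φ.radR.restrictScalars k) →ₗ[k] A →ₗ[k] k := φ.quotR
    have hf : Function.Injective f := φ.quotR_injective
    refine eq_zero_of_forall f f hf hf _ fun a a' => ?_
    have := φ.mul_left a' a b
    rw [φ.mem_radR.1 hb] at this
    rw [← (ℛ k b).eq, map_sum, map_sum, map_sum]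
    refine Eq.trans (Finset.sum_congr rfl fun i _ => ?_) this.symm
    exact mul_comm _ _
  antipode_mem b hb a := by
    rw [← antipode_antipodeInv (k := k) a, φ.antipode_antipode]; exact hb _

instance : HasBijectiveAntipode k (A ⧸ φ.radL) where
  bijective := by
    constructor
    · rw [injective_iff_map_eq_zero]
      intro x hx
      obtain ⟨a, rfl⟩ := Ideal.Quotient.mk_surjective x
      rw [HopfAlgebra.Quotient.antipode_mk, Ideal.Quotient.eq_zero_iff_mem] at hx
      exact Ideal.Quotient.eq_zero_iff_mem.2 fun b => by
        rw [← φ.antipode_antipode]; exact hx _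
    · intro x
      obtain ⟨a, rfl⟩ := Ideal.Quotient.mk_surjective x
      exact ⟨Ideal.Quotient.mk _ (antipodeInv k A a), by
        rw [HopfAlgebra.Quotient.antipode_mk, antipode_antipodeInv]⟩

/-- The nondegenerate Hopf pairing induced by `φ` between `A / I_l` and `B / I_r`. -/
def reduced : HopfPairing k (A ⧸ φ.radL) (B ⧸ φ.radR) where
  toFun := φ.quotLR
  mul_right x y y' := by
    obtain ⟨a, rfl⟩ := Ideal.Quotient.mk_surjective x
    obtain ⟨b, rfl⟩ := Ideal.Quotient.mk_surjective y
    obtain ⟨b', rfl⟩ := Ideal.Quotient.mk_surjective y'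
    have h := repr_sum (ℛ k (Ideal.Quotient.mk φ.radL a)) (φ.bilinR (Ideal.Quotient.mk _ b) (Ideal.Quotient.mk _ b'))
    have h' := repr_sum ((ℛ k a).induced (Bialgebra.Quotient.mkBialgHom (R := k) φ.radL))
      (φ.bilinR (Ideal.Quotient.mk _ b) (Ideal.Quotient.mk _ b'))
    exact (φ.mul_right a b b').trans (h'.trans h.symm)
  mul_left x x' y := by
    obtain ⟨a, rfl⟩ := Ideal.Quotient.mk_surjective x
    obtain ⟨a', rfl⟩ := Ideal.Quotient.mk_surjective x'
    obtain ⟨b, rfl⟩ := Ideal.Quotient.mk_surjective y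
    have h := repr_sum (ℛ k (Ideal.Quotient.mk φ.radR b)) (φ.bilinL (Ideal.Quotient.mk _ a) (Ideal.Quotient.mk _ a'))
    have h' := repr_sum ((ℛ k b).induced (Bialgebra.Quotient.mkBialgHom (R := k) φ.radR))
      (φ.bilinL (Ideal.Quotient.mk _ a) (Ideal.Quotient.mk _ a'))
    exact (φ.mul_left a a' b).trans (h'.trans h.symm)
  one_right x := by
    obtain ⟨a, rfl⟩ := Ideal.Quotient.mk_surjective x
    exact φ.one_right a
  one_left y := by
    obtain ⟨b, rfl⟩ := Ideal.Quotient.mk_surjective y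
    exact φ.one_left b

end Radicals
end HopfPairing

/-- Data for a Hopf algebra generated by group-likes `K_λ`, `λ ∈ P`, and by elements `X_i`, `i ∈ ι`,
with `K_λ X_i = wt i λ X_i K_λ` and `Δ(X_i) = X_i ⊗ K_{c i} + K_{d i} ⊗ X_i`. -/
structure BorelDatum (ι P : Type*) [AddCommGroup P] where
  wt : ι → P → ℂ
  wt_zero : ∀ i, wt i 0 = 1
  wt_add : ∀ i l m, wt i (l + m) = wt i l * wt i m
  c : ι → P
  d : ι → P

namespace BorelDatum
variable {ι P : Type*} [AddCommGroup P] (D : BorelDatum ι P)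

/-- The defining relations: `K_0 = 1`, `K_λ K_μ = K_{λ + μ}`, `K_λ X_i = wt i λ X_i K_λ`; the
generators are `X_i` (left summand) and `K_λ` (right summand). -/
inductive Rel : FreeAlgebra ℂ (ι ⊕ P) → FreeAlgebra ℂ (ι ⊕ P) → Prop
  | K_zero : Rel (FreeAlgebra.ι ℂ (Sum.inr 0)) 1
  | K_add (l m : P) : Rel (FreeAlgebra.ι ℂ (Sum.inr (l + m)))
      (FreeAlgebra.ι ℂ (Sum.inr l) * FreeAlgebra.ι ℂ (Sum.inr m))
  | K_X (l : P) (i : ι) : Rel (FreeAlgebra.ι ℂ (Sum.inr l) * FreeAlgebra.ι ℂ (Sum.inl i))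
      (D.wt i l • (FreeAlgebra.ι ℂ (Sum.inl i) * FreeAlgebra.ι ℂ (Sum.inr l)))

/-- The algebra generated by `K_λ`, `X_i`. -/
def Alg : Type _ := RingQuot D.Rel

instance : Ring D.Alg := inferInstanceAs (Ring (RingQuot D.Rel))
instance : Algebra ℂ D.Alg := inferInstanceAs (Algebra ℂ (RingQuot D.Rel))

/-- The quotient map from the free algebra -/
def ofFree : FreeAlgebra ℂ (ι ⊕ P) →ₐ[ℂ] D.Alg := RingQuot.mkAlgHom ℂ D.Rel

/-- The generator `K_λ` -/
def K (l : P) : D.Alg := D.ofFree (FreeAlgebra.ι ℂ (Sum.inr l))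
/-- The generator `X_i` -/
def X (i : ι) : D.Alg := D.ofFree (FreeAlgebra.ι ℂ (Sum.inl i))

theorem K_zero : D.K 0 = 1 := (RingQuot.mkAlgHom_rel ℂ Rel.K_zero).trans (map_one _)
theorem K_add (l m : P) : D.K (l + m) = D.K l * D.K m :=
  (RingQuot.mkAlgHom_rel ℂ (Rel.K_add l m)).trans (map_mul _ _ _)
theorem K_X (l : P) (i : ι) : D.K l * D.X i = D.wt i l • (D.X i * D.K l) := by
  have := RingQuot.mkAlgHom_rel ℂ (Rel.K_X (D := D) l i)
  rw [map_mul, map_smul, map_mul] at this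
  exact this
theorem K_neg_mul (l : P) : D.K (-l) * D.K l = 1 := by rw [← K_add, neg_add_cancel, K_zero]
theorem K_mul_neg (l : P) : D.K l * D.K (-l) = 1 := by rw [← K_add, add_neg_cancel, K_zero]
theorem wt_mul_neg (i : ι) (l : P) : D.wt i l * D.wt i (-l) = 1 := by
  rw [← D.wt_add, add_neg_cancel, D.wt_zero]
theorem X_K (l : P) (i : ι) : D.X i * D.K l = D.wt i (-l) • (D.K l * D.X i) := by
  rw [K_X, smul_smul, mul_comm, wt_mul_neg, one_smul]

section lift
variable {C : Type*} [Semiring C] [Algebra ℂ C] (x : ι → C) (t : P → C) (h0 : t 0 = 1)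
  (h1 : ∀ l m, t (l + m) = t l * t m) (h2 : ∀ l i, t l * x i = D.wt i l • (x i * t l))

/-- The universal property -/
def lift : D.Alg →ₐ[ℂ] C :=
  RingQuot.liftAlgHom ℂ ⟨FreeAlgebra.lift ℂ (Sum.elim x t), by
    intro a b h
    induction h with
    | K_zero => simp [h0]
    | K_add l m => simp [h1]
    | K_X l i => simp [h2]⟩

theorem lift_K (l : P) : D.lift x t h0 h1 h2 (D.K l) = t l := by
  refine (RingQuot.liftAlgHom_mkAlgHom_apply ℂ _ _ _).trans ?_
  simp
theorem lift_X (i : ι) : D.lift x t h0 h1 h2 (D.X i) = x i := by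
  refine (RingQuot.liftAlgHom_mkAlgHom_apply ℂ _ _ _).trans ?_
  simp

end lift

theorem hom_ext {C : Type*} [Semiring C] [Algebra ℂ C] {f g : D.Alg →ₐ[ℂ] C}
    (hK : ∀ l, f (D.K l) = g (D.K l)) (hX : ∀ i, f (D.X i) = g (D.X i)) : f = g := by
  apply RingQuot.ringQuot_ext'
  ext (i | l)
  · exact hX i
  · exact hK l

theorem induction {p : D.Alg → Prop} (hK : ∀ l, p (D.K l)) (hX : ∀ i, p (D.X i))
    (hc : ∀ z, p (algebraMap ℂ D.Alg z)) (hadd : ∀ a b, p a → p b → p (a + b))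
    (hmul : ∀ a b, p a → p b → p (a * b)) (a : D.Alg) : p a := by
  obtain ⟨a, rfl⟩ := RingQuot.mkAlgHom_surjective ℂ D.Rel a
  change p (D.ofFree a)
  induction a using FreeAlgebra.induction with
  | grade0 r => rw [AlgHom.commutes]; exact hc r
  | grade1 x =>
    rcases x with i | l
    · exact hX i
    · exact hK l
  | mul a b ha hb => rw [map_mul]; exact hmul _ _ ha hb
  | add a b ha hb => rw [map_add]; exact hadd _ _ ha hb

theorem comul_aux (l m : P) : D.K (l + m) ⊗ₜ[ℂ] D.K (l + m) =
    D.K l ⊗ₜ[ℂ] D.K l * D.K m ⊗ₜ[ℂ] D.K m := by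
  simp [K_add]

theorem comul_aux' (l : P) (i : ι) :
    D.K l ⊗ₜ[ℂ] D.K l * (D.X i ⊗ₜ[ℂ] D.K (D.c i) + D.K (D.d i) ⊗ₜ[ℂ] D.X i) =
      D.wt i l • ((D.X i ⊗ₜ[ℂ] D.K (D.c i) + D.K (D.d i) ⊗ₜ[ℂ] D.X i) * D.K l ⊗ₜ[ℂ] D.K l) := by
  simp only [mul_add, add_mul, Algebra.TensorProduct.tmul_mul_tmul, ← K_add, K_X, smul_add,
    ← TensorProduct.smul_tmul', TensorProduct.tmul_smul, add_comm l]

/-- `Δ(K_λ) = K_λ ⊗ K_λ`, `Δ(X_i) = X_i ⊗ K_{c i} + K_{d i} ⊗ X_i` -/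
def comulHom : D.Alg →ₐ[ℂ] D.Alg ⊗[ℂ] D.Alg :=
  D.lift (fun i => D.X i ⊗ₜ D.K (D.c i) + D.K (D.d i) ⊗ₜ D.X i) (fun l => D.K l ⊗ₜ D.K l)
    (by rw [K_zero]; rfl) D.comul_aux D.comul_aux'

/-- `ε(K_λ) = 1`, `ε(X_i) = 0` -/
def counitHom : D.Alg →ₐ[ℂ] ℂ :=
  D.lift (fun _ => 0) (fun _ => 1) rfl (by simp) (by simp)

theorem comulHom_K (l : P) : D.comulHom (D.K l) = D.K l ⊗ₜ D.K l := by rw [comulHom, lift_K]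
theorem comulHom_X (i : ι) : D.comulHom (D.X i) =
    D.X i ⊗ₜ D.K (D.c i) + D.K (D.d i) ⊗ₜ D.X i := by rw [comulHom, lift_X]
theorem counitHom_K (l : P) : D.counitHom (D.K l) = 1 := by rw [counitHom, lift_K]
theorem counitHom_X (i : ι) : D.counitHom (D.X i) = 0 := by rw [counitHom, lift_X]

instance : Bialgebra ℂ D.Alg := Bialgebra.ofAlgHom D.comulHom D.counitHom
  (D.hom_ext (fun l => by simp [comulHom_K]) (fun i => by
    simp [comulHom_K, comulHom_X, TensorProduct.add_tmul, TensorProduct.tmul_add, add_assoc]))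
  (D.hom_ext (fun l => by simp [comulHom_K, counitHom_K]) (fun i => by
    simp [comulHom_X, counitHom_K, counitHom_X]))
  (D.hom_ext (fun l => by simp [comulHom_K, counitHom_K]) (fun i => by
    simp [comulHom_X, counitHom_K, counitHom_X]))

theorem comul_K (l : P) : comul (R := ℂ) (D.K l) = D.K l ⊗ₜ D.K l := D.comulHom_K l
theorem comul_X (i : ι) : comul (R := ℂ) (D.X i) =
    D.X i ⊗ₜ D.K (D.c i) + D.K (D.d i) ⊗ₜ D.X i := D.comulHom_X i
theorem counit_K (l : P) : counit (R := ℂ) (D.K l) = 1 := D.counitHom_K l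
theorem counit_X (i : ι) : counit (R := ℂ) (D.X i) = 0 := D.counitHom_X i

/-- The anti-homomorphism `K_λ ↦ K_{-λ}`, `X_i ↦ -K_{-b i} X_i K_{-a i}`. -/
def antiHom (a b : ι → P) : D.Alg →ₐ[ℂ] D.Algᵐᵒᵖ :=
  D.lift (fun i => .op (-(D.K (-b i) * D.X i * D.K (-a i)))) (fun l => .op (D.K (-l)))
    (by rw [neg_zero, K_zero]; rfl) (fun l m => by
      rw [← MulOpposite.op_mul, ← K_add, neg_add_rev]) (fun l i => by
      rw [← MulOpposite.op_mul, ← MulOpposite.op_mul, ← MulOpposite.op_smul]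
      congr 1
      have e1 : D.K (-a i) * D.K (-l) = D.K (-l) * D.K (-a i) := by
        rw [← K_add, add_comm, K_add]
      have e2 : D.K (-l) * D.K (-b i) = D.K (-b i) * D.K (-l) := by
        rw [← K_add, add_comm, K_add]
      rw [neg_mul, mul_neg, smul_neg, mul_assoc, e1, ← mul_assoc (D.K (-l)), ← mul_assoc (D.K (-l)),
        e2, mul_assoc (D.K (-b i)) (D.K (-l)), K_X D (-l), mul_smul_comm, smul_mul_assoc, smul_smul,
        wt_mul_neg, one_smul]
      simp only [mul_assoc])

theorem antiHom_K (a b : ι → P) (l : P) : D.antiHom a b (D.K l) = .op (D.K (-l)) :=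
  D.lift_K _ _ _ _ _ l
theorem antiHom_X (a b : ι → P) (i : ι) :
    D.antiHom a b (D.X i) = .op (-(D.K (-b i) * D.X i * D.K (-a i))) := D.lift_X _ _ _ _ _ i

theorem antiHom_antiHom (a b : ι → P) (x : D.Alg) :
    (D.antiHom b a (D.antiHom a b x).unop).unop = x := by
  induction x using D.induction with
  | hK l => simp [antiHom_K]
  | hX i =>
    simp only [antiHom_X, antiHom_K, MulOpposite.unop_op, map_neg, map_mul, MulOpposite.unop_neg,
      MulOpposite.unop_mul, neg_neg, mul_neg, neg_mul]
    rw [mul_assoc, mul_assoc, K_neg_mul, mul_one, ← mul_assoc, K_mul_neg, one_mul]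
  | hc z => simp [MulOpposite.algebraMap_apply]
  | hadd x y hx hy => simp only [map_add, MulOpposite.unop_add, hx, hy]
  | hmul x y hx hy => simp only [map_mul, MulOpposite.unop_mul, hx, hy]

/-- `S(K_λ) = K_{-λ}`, `S(X_i) = -K_{-d i} X_i K_{-c i}` -/
def antipodeMap : D.Alg →ₗ[ℂ] D.Alg :=
  (MulOpposite.opLinearEquiv ℂ).symm.toLinearMap ∘ₗ (D.antiHom D.c D.d).toLinearMap

theorem antipodeMap_apply (x : D.Alg) : D.antipodeMap x = (D.antiHom D.c D.d x).unop := rfl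
theorem antipodeMap_mul (x y : D.Alg) :
    D.antipodeMap (x * y) = D.antipodeMap y * D.antipodeMap x := by
  simp [antipodeMap_apply]

theorem antipode_left_aux (t u : D.Alg ⊗[ℂ] D.Alg) (r s : ℂ)
    (ht : LinearMap.mul' ℂ D.Alg (D.antipodeMap.rTensor D.Alg t) = algebraMap ℂ _ r)
    (hu : LinearMap.mul' ℂ D.Alg (D.antipodeMap.rTensor D.Alg u) = algebraMap ℂ _ s) :
    LinearMap.mul' ℂ D.Alg (D.antipodeMap.rTensor D.Alg (t * u)) = algebraMap ℂ _ (r * s) := by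
  rw [RingHom.map_mul, ← hu]
  clear hu
  induction u using TensorProduct.induction_on with
  | zero => simp
  | add u u' h h' => simp only [mul_add, map_add, h, h']
  | tmul x y =>
    have : ∀ t : D.Alg ⊗[ℂ] D.Alg,
        LinearMap.mul' ℂ D.Alg (D.antipodeMap.rTensor D.Alg (t * x ⊗ₜ y)) =
        D.antipodeMap x * LinearMap.mul' ℂ D.Alg (D.antipodeMap.rTensor D.Alg t) * y := by
      intro t
      induction t using TensorProduct.induction_on with
      | zero => simp
      | add u u' h h' => simp only [add_mul, mul_add, map_add, h, h']
      | tmul x' y' => simp [antipodeMap_mul, mul_assoc]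
    rw [this, ht, ← Algebra.commutes, mul_assoc]
    simp

theorem antipode_right_aux (t u : D.Alg ⊗[ℂ] D.Alg) (r s : ℂ)
    (ht : LinearMap.mul' ℂ D.Alg (D.antipodeMap.lTensor D.Alg t) = algebraMap ℂ _ r)
    (hu : LinearMap.mul' ℂ D.Alg (D.antipodeMap.lTensor D.Alg u) = algebraMap ℂ _ s) :
    LinearMap.mul' ℂ D.Alg (D.antipodeMap.lTensor D.Alg (t * u)) = algebraMap ℂ _ (r * s) := by
  rw [mul_comm, RingHom.map_mul, ← ht]; rw [Algebra.commutes s]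
  clear ht
  induction t using TensorProduct.induction_on with
  | zero => simp
  | add u u' h h' => simp only [add_mul, map_add, h, h']
  | tmul x y =>
    have : ∀ t : D.Alg ⊗[ℂ] D.Alg,
        LinearMap.mul' ℂ D.Alg (D.antipodeMap.lTensor D.Alg (x ⊗ₜ y * t)) =
        x * LinearMap.mul' ℂ D.Alg (D.antipodeMap.lTensor D.Alg t) * D.antipodeMap y := by
      intro t
      induction t using TensorProduct.induction_on with
      | zero => simp
      | add u u' h h' => simp only [add_mul, mul_add, map_add, h, h']
      | tmul x' y' => simp [antipodeMap_mul, mul_assoc]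
    rw [this, hu, ← Algebra.commutes, mul_assoc, Algebra.commutes]
    simp

theorem antipode_left (x : D.Alg) :
    LinearMap.mul' ℂ D.Alg (D.antipodeMap.rTensor D.Alg (comul x)) =
      algebraMap ℂ D.Alg (counit x) := by
  induction x using D.induction with
  | hK l => simp [comul_K, counit_K, antipodeMap_apply, antiHom_K, K_neg_mul]
  | hX i =>
    simp only [comul_X, counit_X, antipodeMap_apply, antiHom_X, antiHom_K, map_add, map_zero,
      LinearMap.rTensor_tmul, LinearMap.mul'_apply, MulOpposite.unop_op, neg_mul]
    rw [mul_assoc, K_neg_mul, mul_one, neg_add_cancel]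
  | hc z => simp [antipodeMap_apply, Algebra.TensorProduct.algebraMap_apply,
      MulOpposite.algebraMap_apply]
  | hadd x y hx hy => simp only [map_add, hx, hy]
  | hmul x y hx hy =>
    rw [Bialgebra.comul_mul, Bialgebra.counit_mul]
    exact D.antipode_left_aux _ _ _ _ hx hy

theorem antipode_right (x : D.Alg) :
    LinearMap.mul' ℂ D.Alg (D.antipodeMap.lTensor D.Alg (comul x)) =
      algebraMap ℂ D.Alg (counit x) := by
  induction x using D.induction with
  | hK l => simp [comul_K, counit_K, antipodeMap_apply, antiHom_K, K_mul_neg]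
  | hX i =>
    simp only [comul_X, counit_X, antipodeMap_apply, antiHom_X, antiHom_K, map_add, map_zero,
      LinearMap.lTensor_tmul, LinearMap.mul'_apply, MulOpposite.unop_op, mul_neg]
    rw [← mul_assoc, ← mul_assoc, K_mul_neg, one_mul, add_neg_cancel]
  | hc z => simp [antipodeMap_apply, Algebra.TensorProduct.algebraMap_apply,
      MulOpposite.algebraMap_apply]
  | hadd x y hx hy => simp only [map_add, hx, hy]
  | hmul x y hx hy =>
    rw [Bialgebra.comul_mul, Bialgebra.counit_mul]
    exact D.antipode_right_aux _ _ _ _ hx hy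

instance : HopfAlgebra ℂ D.Alg where
  antipode := D.antipodeMap
  mul_antipode_rTensor_comul := LinearMap.ext D.antipode_left
  mul_antipode_lTensor_comul := LinearMap.ext D.antipode_right

theorem antipode_K (l : P) : antipode ℂ (D.K l) = D.K (-l) :=
  congrArg MulOpposite.unop (D.antiHom_K D.c D.d l)
theorem antipode_X (i : ι) : antipode ℂ (D.X i) = -(D.K (-D.d i) * D.X i * D.K (-D.c i)) :=
  congrArg MulOpposite.unop (D.antiHom_X D.c D.d i)

instance : HasBijectiveAntipode ℂ D.Alg where
  bijective := Function.bijective_iff_has_inverse.2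
    ⟨fun x => (D.antiHom D.d D.c x).unop, D.antiHom_antiHom D.c D.d, D.antiHom_antiHom D.d D.c⟩

end BorelDatum

/-- An abelian group `P` with elements `α_i`, a symmetric bilinear form, and `ħ ∈ ℂ`, `q = exp ħ`. -/
structure QDatum (ι P : Type*) [AddCommGroup P] where
  root : ι → P
  form : P →+ P →+ ℂ
  symm : ∀ l m, form l m = form m l
  hbar : ℂ

section conv
variable {U M : Type*} [Ring U] [Bialgebra ℂ U] [Ring M] [Algebra ℂ M]

/-- `y ↦ ∑ χ(y₂) ρ(y₁)` -/
def twR (r : U →ₐ[ℂ] M) (x : U →ₐ[ℂ] ℂ) : U →ₐ[ℂ] M :=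
  ((Algebra.TensorProduct.rid ℂ ℂ M).toAlgHom.comp (Algebra.TensorProduct.map r x)).comp
    (Bialgebra.comulAlgHom ℂ U)

/-- `y ↦ ∑ χ(y₁) ρ(y₂)` -/
def twL (x : U →ₐ[ℂ] ℂ) (r : U →ₐ[ℂ] M) : U →ₐ[ℂ] M :=
  ((Algebra.TensorProduct.lid ℂ M).toAlgHom.comp (Algebra.TensorProduct.map x r)).comp
    (Bialgebra.comulAlgHom ℂ U)

theorem twR_apply (r : U →ₐ[ℂ] M) (x : U →ₐ[ℂ] ℂ) (f : M →ₗ[ℂ] ℂ) (y : U) :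
    f (twR r x y) = (toConv (f ∘ₗ r.toLinearMap) * toConv x.toLinearMap :
      WithConv (U →ₗ[ℂ] ℂ)).ofConv y := by
  simp only [LinearMap.convMul_apply, twR, AlgHom.comp_apply, Bialgebra.comulAlgHom_apply]
  generalize comul (R := ℂ) y = t
  induction t using TensorProduct.induction_on with
  | zero => simp
  | add u v hu hv => simp only [map_add, hu, hv]
  | tmul u v => simp [mul_comm]

theorem twL_apply (r : U →ₐ[ℂ] M) (x : U →ₐ[ℂ] ℂ) (f : M →ₗ[ℂ] ℂ) (y : U) :
    f (twL x r y) = (toConv x.toLinearMap * toConv (f ∘ₗ r.toLinearMap) :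
      WithConv (U →ₗ[ℂ] ℂ)).ofConv y := by
  simp only [LinearMap.convMul_apply, twL, AlgHom.comp_apply, Bialgebra.comulAlgHom_apply]
  generalize comul (R := ℂ) y = t
  induction t using TensorProduct.induction_on with
  | zero => simp
  | add u v hu hv => simp only [map_add, hu, hv]
  | tmul u v => simp

theorem twR_grouplike (r : U →ₐ[ℂ] M) (x : U →ₐ[ℂ] ℂ) {y : U} (h : comul (R := ℂ) y = y ⊗ₜ y) :
    twR r x y = x y • r y := by
  simp [twR, h]
theorem twL_grouplike (r : U →ₐ[ℂ] M) (x : U →ₐ[ℂ] ℂ) {y : U} (h : comul (R := ℂ) y = y ⊗ₜ y) :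
    twL x r y = x y • r y := by
  simp [twL, h]
theorem twR_skew (r : U →ₐ[ℂ] M) (x : U →ₐ[ℂ] ℂ) {y g h : U}
    (hy : comul (R := ℂ) y = y ⊗ₜ g + h ⊗ₜ y) : twR r x y = x g • r y + x y • r h := by
  simp [twR, hy]
theorem twL_skew (r : U →ₐ[ℂ] M) (x : U →ₐ[ℂ] ℂ) {y g h : U}
    (hy : comul (R := ℂ) y = y ⊗ₜ g + h ⊗ₜ y) : twL x r y = x y • r g + x h • r y := by
  simp [twL, hy]
end conv

namespace QDatum
variable {ι P : Type*} [AddCommGroup P] (Q : QDatum ι P)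

/-- `q ^ x = exp(ħ x)` -/
def qpow (x : ℂ) : ℂ := Complex.exp (Q.hbar * x)

theorem qpow_zero : Q.qpow 0 = 1 := by simp [qpow]
theorem qpow_add (x y : ℂ) : Q.qpow (x + y) = Q.qpow x * Q.qpow y := by
  simp [qpow, mul_add, Complex.exp_add]

/-- `q_i = q ^ ((α_i, α_i) / 2)` -/
def qi (i : ι) : ℂ := Q.qpow (Q.form (Q.root i) (Q.root i) / 2)

/-- `K_λ E_i = q^(α_i, λ) E_i K_λ`, `Δ(E_i) = E_i ⊗ K_{-α_i} + 1 ⊗ E_i` -/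
def plus : BorelDatum ι P where
  wt i l := Q.qpow (Q.form (Q.root i) l)
  wt_zero i := by simp [qpow_zero]
  wt_add i l m := by simp [qpow_add]
  c i := -Q.root i
  d _ := 0

/-- `K'_λ F_i = q^(-(α_i, λ)) F_i K'_λ`, `Δ(F_i) = F_i ⊗ 1 + K'_{α_i} ⊗ F_i` -/
def minus : BorelDatum ι P where
  wt i l := Q.qpow (-Q.form (Q.root i) l)
  wt_zero i := by simp [qpow_zero]
  wt_add i l m := by simp [qpow_add, add_comm]
  c _ := 0
  d i := Q.root i

/-- The Hopf algebra generated by `E_i`, `K_λ`, without Serre relations -/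
abbrev UTildePlus : Type _ := Q.plus.Alg
/-- The Hopf algebra generated by `F_i`, `K'_λ`, without Serre relations -/
abbrev UTildeMinus : Type _ := Q.minus.Alg

/-- The character `φ(K_λ, ·)`: `K'_μ ↦ q^(-(λ, μ))`, `F_i ↦ 0`. -/
def chi (l : P) : Q.UTildeMinus →ₐ[ℂ] ℂ :=
  Q.minus.lift (fun _ => 0) (fun m => Q.qpow (-Q.form l m)) (by simp [qpow_zero])
    (fun m n => by simp [qpow_add, add_comm]) (by simp)

theorem chi_K (l m : P) : Q.chi l (Q.minus.K m) = Q.qpow (-Q.form l m) := by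
  rw [chi, BorelDatum.lift_K]
theorem chi_X (l : P) (i : ι) : Q.chi l (Q.minus.X i) = 0 := by
  rw [chi, BorelDatum.lift_X]

open scoped Classical in
/-- `φ(E_i, F_j) = δ_ij / (q_i⁻¹ - q_i)` -/
def pairEF (i j : ι) : ℂ := if i = j then 1 / ((Q.qi i)⁻¹ - Q.qi i) else 0

theorem rho_aux (i : ι) (m : P) (j : ι) :
    (!![1, 0; 0, Q.qpow (Q.form (Q.root i) m)] * !![0, Q.pairEF i j; 0, 0] :
      Matrix (Fin 2) (Fin 2) ℂ) = Q.minus.wt j m •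
    (!![0, Q.pairEF i j; 0, 0] * !![1, 0; 0, Q.qpow (Q.form (Q.root i) m)]) := by
  by_cases h : i = j
  · subst h
    simp [minus, mul_comm (Q.pairEF i i), ← mul_assoc, ← qpow_add, qpow_zero]
  · simp [pairEF, h]

/-- The representation with matrix coefficients `φ(1, ·)`, `φ(E_i, ·)`, `0`, `φ(K_{-α_i}, ·)`. -/
def rho (i : ι) : Q.UTildeMinus →ₐ[ℂ] Matrix (Fin 2) (Fin 2) ℂ :=
  Q.minus.lift (fun j => !![0, Q.pairEF i j; 0, 0])
    (fun m => !![1, 0; 0, Q.qpow (Q.form (Q.root i) m)])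
    (by simp [qpow_zero, Matrix.one_fin_two]) (fun l m => by simp [qpow_add])
    (fun m j => Q.rho_aux i m j)

theorem rho_K (i : ι) (m : P) :
    Q.rho i (Q.minus.K m) = !![1, 0; 0, Q.qpow (Q.form (Q.root i) m)] := by
  rw [rho, BorelDatum.lift_K]
theorem rho_X (i j : ι) : Q.rho i (Q.minus.X j) = !![0, Q.pairEF i j; 0, 0] := by
  rw [rho, BorelDatum.lift_X]

/-- The matrix entry in position `(0, 1)` -/
def entry : Matrix (Fin 2) (Fin 2) ℂ →ₗ[ℂ] ℂ := Matrix.entryLinearMap ℂ ℂ 0 1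

/-- The functional `φ(E_i, ·)`. -/
def eta (i : ι) : Q.UTildeMinus →ₗ[ℂ] ℂ :=
  entry ∘ₗ (Q.rho i).toLinearMap

theorem eta_apply (i : ι) (y : Q.UTildeMinus) : Q.eta i y = Q.rho i y 0 1 := rfl

/-- The dual algebra of `U_q^-` with the convolution product. -/
abbrev DualMinus : Type _ := WithConv (Q.UTildeMinus →ₗ[ℂ] ℂ)

theorem chi_mul_chi (l m : P) : (toConv (Q.chi l).toLinearMap * toConv (Q.chi m).toLinearMap :
    Q.DualMinus) = toConv (Q.chi (l + m)).toLinearMap := by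
  have hf : twR (Q.chi l) (Q.chi m) = Q.chi (l + m) := by
    apply Q.minus.hom_ext
    · intro n
      rw [twR_grouplike _ _ (BorelDatum.comul_K _ n), chi_K, chi_K, chi_K, smul_eq_mul,
        ← qpow_add, map_add, AddMonoidHom.add_apply, neg_add, add_comm]
    · intro i
      rw [twR_skew _ _ (BorelDatum.comul_X _ i), chi_X, chi_X, chi_X]
      simp
  rw [← hf]
  ext y
  exact (twR_apply (Q.chi l) (Q.chi m) LinearMap.id y).symm

theorem chi_zero : (toConv (Q.chi 0).toLinearMap : Q.DualMinus) = 1 := by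
  have hf : Bialgebra.counitAlgHom ℂ Q.UTildeMinus = Q.chi 0 := by
    apply Q.minus.hom_ext
    · intro n
      simp [chi_K, qpow_zero, BorelDatum.counit_K]
    · intro i
      simp [chi_X, BorelDatum.counit_X]
  rw [← hf]
  rfl

theorem tw_comm (i : ι) (l : P) (y : Q.UTildeMinus) :
    !![Q.qpow (Q.form (Q.root i) l), 0; 0, 1] * twL (Q.chi l) (Q.rho i) y =
      twR (Q.rho i) (Q.chi l) y * !![Q.qpow (Q.form (Q.root i) l), 0; 0, 1] := by
  induction y using Q.minus.induction with
  | hK m =>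
    rw [twR_grouplike _ _ (BorelDatum.comul_K _ m), twL_grouplike _ _ (BorelDatum.comul_K _ m),
      rho_K]
    simp [mul_comm]
  | hX j =>
    rw [twR_skew _ _ (BorelDatum.comul_X _ j), twL_skew _ _ (BorelDatum.comul_X _ j), rho_X,
      chi_X, chi_K, chi_K]
    by_cases h : i = j
    · subst h
      simp only [minus, map_zero, neg_zero, qpow_zero, one_smul, zero_smul, zero_add, add_zero]
      rw [Q.symm l]
      simp [← mul_assoc, ← qpow_add, qpow_zero]
    · simp [pairEF, h]
  | hc z => simp only [AlgHom.commutes, Algebra.commutes]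
  | hadd a b ha hb => simp only [map_add, mul_add, add_mul, ha, hb]
  | hmul a b ha hb =>
    rw [map_mul, map_mul, ← mul_assoc, ha, mul_assoc, hb, mul_assoc]

theorem eta_mul_chi (i : ι) (l : P) :
    (toConv (Q.eta i) * toConv (Q.chi l).toLinearMap : Q.DualMinus) =
      Q.qpow (Q.form (Q.root i) l) • (toConv (Q.chi l).toLinearMap * toConv (Q.eta i)) := by
  ext y
  have h := congrFun (congrFun (Q.tw_comm i l y) 0) 1
  have h1 := twR_apply (Q.rho i) (Q.chi l) entry y
  have h2 := twL_apply (Q.rho i) (Q.chi l) entry y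
  change twR (Q.rho i) (Q.chi l) y 0 1 = _ at h1
  change twL (Q.chi l) (Q.rho i) y 0 1 = _ at h2
  simp only [Matrix.mul_apply, Fin.sum_univ_two, h1, h2] at h
  simp [h2] at h
  exact h.symm

/-- `x ↦ φ(x, ·)` -/
def pairHom : Q.UTildePlus →ₐ[ℂ] Q.DualMinusᵐᵒᵖ :=
  Q.plus.lift (fun i => .op (toConv (Q.eta i))) (fun l => .op (toConv (Q.chi l).toLinearMap))
    (by rw [chi_zero]; rfl)
    (fun l m => by rw [← MulOpposite.op_mul, chi_mul_chi, add_comm])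
    (fun l i => by
      rw [← MulOpposite.op_mul, ← MulOpposite.op_mul, ← MulOpposite.op_smul, eta_mul_chi]
      rfl)

theorem pairHom_K (l : P) : Q.pairHom (Q.plus.K l) = .op (toConv (Q.chi l).toLinearMap) := by
  rw [pairHom, BorelDatum.lift_K]
theorem pairHom_X (i : ι) : Q.pairHom (Q.plus.X i) = .op (toConv (Q.eta i)) := by
  rw [pairHom, BorelDatum.lift_X]

/-- The bilinear map underlying the pairing. -/
def pairMap : Q.UTildePlus →ₗ[ℂ] Q.UTildeMinus →ₗ[ℂ] ℂ :=
  (WithConv.linearEquiv ℂ _).toLinearMap ∘ₗ (MulOpposite.opLinearEquiv ℂ).symm.toLinearMap ∘ₗ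
    Q.pairHom.toLinearMap

theorem pairMap_apply (x : Q.UTildePlus) (y : Q.UTildeMinus) :
    Q.pairMap x y = (Q.pairHom x).unop.ofConv y := rfl

theorem pairMap_K (l : P) (y : Q.UTildeMinus) : Q.pairMap (Q.plus.K l) y = Q.chi l y := by
  rw [pairMap_apply, pairHom_K]; rfl
theorem pairMap_X (i : ι) (y : Q.UTildeMinus) : Q.pairMap (Q.plus.X i) y = Q.rho i y 0 1 := by
  rw [pairMap_apply, pairHom_X]; rfl
theorem pairMap_one (y : Q.UTildeMinus) : Q.pairMap 1 y = counit (R := ℂ) y := by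
  rw [pairMap_apply, map_one]; rfl

theorem pairMap_mul_left (x x' : Q.UTildePlus) (y : Q.UTildeMinus) : Q.pairMap (x * x') y =
    LinearMap.mul' ℂ ℂ (TensorProduct.map (Q.pairMap x') (Q.pairMap x) (comul y)) := by
  rw [pairMap_apply, map_mul]
  rfl

/-- `x ⊗ x' ↦ φ(x, y) φ(x', y')` -/
def pair2 (y y' : Q.UTildeMinus) : Q.UTildePlus ⊗[ℂ] Q.UTildePlus →ₗ[ℂ] ℂ :=
  LinearMap.mul' ℂ ℂ ∘ₗ TensorProduct.map (Q.pairMap.flip y) (Q.pairMap.flip y')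

theorem rho_form (i : ι) (y : Q.UTildeMinus) :
    Q.rho i y 0 0 = counit (R := ℂ) y ∧ Q.rho i y 1 0 = 0 ∧
      Q.rho i y 1 1 = Q.chi (-Q.root i) y := by
  induction y using Q.minus.induction with
  | hK m => simp [rho_K, BorelDatum.counit_K, chi_K]
  | hX j => simp [rho_X, BorelDatum.counit_X, chi_X]
  | hc z => simp [Matrix.algebraMap_matrix_apply]
  | hadd a b ha hb => simp [ha, hb]
  | hmul a b ha hb => simp [Matrix.mul_apply, Fin.sum_univ_two, ha, hb]

theorem pair2_mul (t u : Q.UTildePlus ⊗[ℂ] Q.UTildePlus) (y y' : Q.UTildeMinus) :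
    Q.pair2 y y' (t * u) = ∑ i ∈ (ℛ ℂ y).index, ∑ j ∈ (ℛ ℂ y').index,
      Q.pair2 ((ℛ ℂ y).left i) ((ℛ ℂ y').left j) u *
        Q.pair2 ((ℛ ℂ y).right i) ((ℛ ℂ y').right j) t := by
  induction t using TensorProduct.induction_on with
  | zero => simp
  | add t t' h h' => simp only [add_mul, mul_add, map_add, h, h', Finset.sum_add_distrib]
  | tmul x x' =>
    induction u using TensorProduct.induction_on with
    | zero => simp
    | add t t' h h' => simp only [add_mul, mul_add, map_add, h, h', Finset.sum_add_distrib]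
    | tmul z z' =>
      simp only [pair2, LinearMap.comp_apply, Algebra.TensorProduct.tmul_mul_tmul,
        TensorProduct.map_tmul, LinearMap.mul'_apply, LinearMap.flip_apply, pairMap_mul_left]
      rw [← (ℛ ℂ y).eq, ← (ℛ ℂ y').eq]
      simp only [map_sum, TensorProduct.map_tmul, LinearMap.mul'_apply, Finset.sum_mul_sum]
      exact Finset.sum_congr rfl fun i _ => Finset.sum_congr rfl fun j _ => by ring

theorem comul_E (i : ι) : comul (R := ℂ) (Q.plus.X i) =
    Q.plus.X i ⊗ₜ Q.plus.K (-Q.root i) + 1 ⊗ₜ Q.plus.X i := by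
  rw [← BorelDatum.K_zero]
  exact BorelDatum.comul_X _ i

theorem pairMap_mul_right (x : Q.UTildePlus) (y y' : Q.UTildeMinus) :
    Q.pairMap x (y * y') = Q.pair2 y y' (comul x) := by
  induction x using Q.plus.induction generalizing y y' with
  | hK l => simp [pair2, BorelDatum.comul_K, pairMap_K]
  | hX i =>
    have h := Q.rho_form i
    simp [pair2, comul_E, pairMap_K, pairMap_X, Matrix.mul_apply, Fin.sum_univ_two, h, pairMap_one]
    ring
  | hc z =>
    have : ∀ w : ℂ, algebraMap ℂ Q.plus.Alg w = w • 1 := Algebra.algebraMap_eq_smul_one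
    simp [this, pair2, pairMap_one, Algebra.TensorProduct.one_def]
    try ring
  | hadd a b ha hb => simp only [map_add, LinearMap.add_apply, ha, hb]
  | hmul a b ha hb =>
    rw [Bialgebra.comul_mul, pair2_mul, pairMap_mul_left, Bialgebra.comul_mul]
    rw [← (ℛ ℂ y).eq, ← (ℛ ℂ y').eq]
    simp only [Finset.sum_mul_sum, Algebra.TensorProduct.tmul_mul_tmul, map_sum,
      TensorProduct.map_tmul, LinearMap.mul'_apply, ha, hb]

/-- The Hopf pairing with `φ(K_λ, K'_μ) = q^(-(λ, μ))`, `φ(E_i, F_j) = δ_ij / (q_i⁻¹ - q_i)`,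
`φ(K_λ, F_i) = 0 = φ(E_i, K'_λ)`. -/
def pairing : HopfPairing ℂ Q.UTildePlus Q.UTildeMinus where
  toFun := Q.pairMap
  mul_right x y y' := by
    rw [pairMap_mul_right, ← (ℛ ℂ x).eq]
    simp [pair2]
  mul_left x x' y := by
    rw [pairMap_mul_left, ← (ℛ ℂ y).eq]
    simp [mul_comm]
  one_right x := by
    induction x using Q.plus.induction with
    | hK l => simp [pairMap_K, BorelDatum.counit_K]
    | hX i => simp [pairMap_X, BorelDatum.counit_X]
    | hc z =>
      have : ∀ w : ℂ, algebraMap ℂ Q.plus.Alg w = w • 1 := Algebra.algebraMap_eq_smul_one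
      simp [this, pairMap_one]
    | hadd a b ha hb => simp only [map_add, LinearMap.add_apply, ha, hb]
    | hmul a b ha hb =>
      rw [pairMap_mul_left, Bialgebra.comul_one, Algebra.TensorProduct.one_def,
        TensorProduct.map_tmul, ha, hb, Bialgebra.counit_mul, LinearMap.mul'_apply, mul_comm]
  one_left y := Q.pairMap_one y

theorem pairing_K_K (l m : P) : Q.pairing (Q.plus.K l) (Q.minus.K m) = Q.qpow (-Q.form l m) :=
  (Q.pairMap_K _ _).trans (Q.chi_K l m)
theorem pairing_K_X (l : P) (i : ι) : Q.pairing (Q.plus.K l) (Q.minus.X i) = 0 :=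
  (Q.pairMap_K _ _).trans (Q.chi_X l i)
theorem pairing_X_K (i : ι) (l : P) : Q.pairing (Q.plus.X i) (Q.minus.K l) = 0 :=
  (Q.pairMap_X _ _).trans (by simp [rho_K])
theorem pairing_X_X (i j : ι) : Q.pairing (Q.plus.X i) (Q.minus.X j) = Q.pairEF i j :=
  (Q.pairMap_X _ _).trans (by simp [rho_X])

end QDatum

namespace QDatum
variable {ι P : Type*} [AddCommGroup P] (Q : QDatum ι P)

/-- `U_q^+`, the quotient by the left radical of the pairing -/
abbrev UPlus : Type _ := Q.UTildePlus ⧸ Q.pairing.radL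
/-- `U_q^-`, the quotient by the right radical of the pairing -/
abbrev UMinus : Type _ := Q.UTildeMinus ⧸ Q.pairing.radR
/-- The nondegenerate Hopf pairing between `U_q^+` and `U_q^-` -/
abbrev phi : HopfPairing ℂ Q.UPlus Q.UMinus := Q.pairing.reduced

/-- `E_i ∈ U_q^+` -/
def E (i : ι) : Q.UPlus := Ideal.Quotient.mk _ (Q.plus.X i)
/-- `K_λ ∈ U_q^+` -/
def K (l : P) : Q.UPlus := Ideal.Quotient.mk _ (Q.plus.K l)
/-- `F_i ∈ U_q^-` -/
def F (i : ι) : Q.UMinus := Ideal.Quotient.mk _ (Q.minus.X i)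
/-- `K'_λ ∈ U_q^-` -/
def K' (l : P) : Q.UMinus := Ideal.Quotient.mk _ (Q.minus.K l)
/-- `e'_i = (q_i⁻¹ - q_i) K_{α_i} E_i ∈ U_q^+` -/
def E' (i : ι) : Q.UPlus := ((Q.qi i)⁻¹ - Q.qi i) • (Q.K (Q.root i) * Q.E i)

/-- The quantum double `D_φ(U_q^+, U_q^-)` -/
abbrev Dbl : Type _ := Q.phi.Double
/-- The Heisenberg double `H_φ(U_q^+, U_q^-)` -/
abbrev Hei : Type _ := Q.phi.Heis

/-- The two-sided ideal generated by the elements `K_λ ⊗ 1 - 1 ⊗ K'_λ`. -/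
def idealK : Ideal Q.Dbl :=
  (TwoSidedIdeal.span (Set.range fun l => Q.phi.dtmul (Q.K l) 1 - Q.phi.dtmul 1 (Q.K' l))).asIdeal

instance : Q.idealK.IsTwoSided := inferInstanceAs (TwoSidedIdeal.asIdeal _).IsTwoSided

theorem mem_idealK (l : P) : Q.phi.dtmul (Q.K l) 1 - Q.phi.dtmul 1 (Q.K' l) ∈ Q.idealK :=
  TwoSidedIdeal.mem_asIdeal.2 (TwoSidedIdeal.subset_span ⟨l, rfl⟩)

theorem idealK_le_ker {R : Type*} [Ring R] (f : Q.Dbl →+* R)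
    (hf : ∀ l, f (Q.phi.dtmul (Q.K l) 1) = f (Q.phi.dtmul 1 (Q.K' l))) {x : Q.Dbl}
    (hx : x ∈ Q.idealK) : f x = 0 := by
  have h := TwoSidedIdeal.mem_span_iff.1 (TwoSidedIdeal.mem_asIdeal.1 hx) (TwoSidedIdeal.ker f)
    (by
      rintro _ ⟨l, rfl⟩
      rw [SetLike.mem_coe, TwoSidedIdeal.mem_ker, map_sub, hf, sub_self])
  exact (TwoSidedIdeal.mem_ker f).1 h

theorem comul_K (l : P) : comul (R := ℂ) (Q.K l) = Q.K l ⊗ₜ Q.K l := by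
  rw [K, Bialgebra.Quotient.comul_mk, BorelDatum.comul_K]
  rfl
theorem comul_K' (l : P) : comul (R := ℂ) (Q.K' l) = Q.K' l ⊗ₜ Q.K' l := by
  rw [K', Bialgebra.Quotient.comul_mk, BorelDatum.comul_K]
  rfl
theorem counit_K (l : P) : counit (R := ℂ) (Q.K l) = 1 := Q.plus.counit_K l
theorem counit_K' (l : P) : counit (R := ℂ) (Q.K' l) = 1 := Q.minus.counit_K l
theorem antipode_K (l : P) : antipode ℂ (Q.K l) = Q.K (-l) := by
  rw [K, HopfAlgebra.Quotient.antipode_mk, BorelDatum.antipode_K]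
  rfl
theorem antipode_K' (l : P) : antipode ℂ (Q.K' l) = Q.K' (-l) := by
  rw [K', HopfAlgebra.Quotient.antipode_mk, BorelDatum.antipode_K]
  rfl

theorem comul_dtmul_grouplike (a : Q.UPlus) (b : Q.UMinus) (ha : comul (R := ℂ) a = a ⊗ₜ a)
    (hb : comul (R := ℂ) b = b ⊗ₜ b) :
    comul (R := ℂ) (Q.phi.dtmul a b) = Q.phi.dtmul a b ⊗ₜ Q.phi.dtmul a b := by
  change comul (R := ℂ) (a ⊗ₜ[ℂ] b) = _
  rw [TensorProduct.comul_tmul, ha, hb]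
  rfl

/-- The algebra map `x ↦ ∑ [x₁] ⊗ [x₂]` -/
def mkComul : Q.Dbl →ₐ[ℂ] (Q.Dbl ⧸ Q.idealK) ⊗[ℂ] (Q.Dbl ⧸ Q.idealK) :=
  (Algebra.TensorProduct.map (Ideal.Quotient.mkₐ ℂ Q.idealK) (Ideal.Quotient.mkₐ ℂ Q.idealK)).comp
    (Bialgebra.comulAlgHom ℂ Q.Dbl)

/-- The anti-homomorphism `x ↦ [S(x)]` -/
def mkAntipode : Q.Dbl →+* (Q.Dbl ⧸ Q.idealK)ᵐᵒᵖ where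
  toFun x := .op (Ideal.Quotient.mk _ (antipode ℂ x))
  map_one' := by rw [antipode_one, map_one]; rfl
  map_mul' x y := by rw [antipode_mul_antidistrib, map_mul]; rfl
  map_zero' := by rw [map_zero, map_zero]; rfl
  map_add' x y := by rw [map_add, map_add]; rfl

theorem mk_K (l : P) : Ideal.Quotient.mk Q.idealK (Q.phi.dtmul (Q.K l) 1) =
    Ideal.Quotient.mk Q.idealK (Q.phi.dtmul 1 (Q.K' l)) :=
  Ideal.Quotient.eq.2 (Q.mem_idealK l)

instance : Q.idealK.IsHopfIdeal ℂ where
  counit_eq_zero x hx := Q.idealK_le_ker (Bialgebra.counitAlgHom ℂ Q.Dbl : Q.Dbl →+* ℂ)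
    (fun l => by
      simp [HopfPairing.counit_dtmul, counit_K, counit_K']) hx
  map_mkQ_comul_eq_zero x hx := by
    have h := Q.idealK_le_ker Q.mkComul.toRingHom (fun l => by
      have h1 := Q.comul_dtmul_grouplike (Q.K l) 1 (Q.comul_K l) Bialgebra.comul_one
      have h2 := Q.comul_dtmul_grouplike 1 (Q.K' l) Bialgebra.comul_one (Q.comul_K' l)
      have h3 := Q.mk_K l
      change Q.mkComul _ = Q.mkComul _
      simp only [mkComul, AlgHom.comp_apply, Bialgebra.comulAlgHom_apply,
        h1, h2, Algebra.TensorProduct.map_tmul, Ideal.Quotient.mkₐ_eq_mk, h3]) hx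
    exact h
  antipode_mem x hx := by
    have h := Q.idealK_le_ker Q.mkAntipode (fun l => by
      have h1 : antipode ℂ (Q.phi.dtmul (Q.K l) 1) = Q.phi.dtmul (Q.K (-l)) 1 := by
        refine (Q.phi.antipodeD_dtmul _ _).trans ?_
        rw [antipode_one, map_one, one_mul, antipode_K]
        rfl
      have h2 : antipode ℂ (Q.phi.dtmul 1 (Q.K' l)) = Q.phi.dtmul 1 (Q.K' (-l)) := by
        refine (Q.phi.antipodeD_dtmul _ _).trans ?_
        rw [antipode_one, map_one, mul_one, antipode_K']
        rfl
      change MulOpposite.op _ = MulOpposite.op _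
      rw [h1, h2, mk_K]) hx
    exact Ideal.Quotient.eq_zero_iff_mem.1 (congrArg MulOpposite.unop h)

/-- The quantum group `U_q = D_φ(U_q^+, U_q^-) / (K_λ - K'_λ)` -/
abbrev Uq : Type _ := Q.Dbl ⧸ Q.idealK

/-- The projection `D_φ(U_q^+, U_q^-) → U_q` -/
def toUq : Q.Dbl →ₐ[ℂ] Q.Uq := Ideal.Quotient.mkₐ ℂ Q.idealK

/-- Names of the generators of the `q`-boson algebra -/
inductive BGen (ι P : Type*)
  | e (i : ι)
  | f (i : ι)
  | t (l : P)

/-- `E_i ↦ e_i`, `K_λ ↦ t_λ` on free algebras -/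
def freePos : FreeAlgebra ℂ (ι ⊕ P) →ₐ[ℂ] FreeAlgebra ℂ (BGen ι P) :=
  FreeAlgebra.lift ℂ (Sum.elim (fun i => FreeAlgebra.ι ℂ (.e i)) fun l => FreeAlgebra.ι ℂ (.t l))

/-- `F_i ↦ f_i`, `K'_λ ↦ t_λ` on free algebras -/
def freeNeg : FreeAlgebra ℂ (ι ⊕ P) →ₐ[ℂ] FreeAlgebra ℂ (BGen ι P) :=
  FreeAlgebra.lift ℂ (Sum.elim (fun i => FreeAlgebra.ι ℂ (.f i)) fun l => FreeAlgebra.ι ℂ (.t l))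

/-- `e'_i = (q_i⁻¹ - q_i) t_{α_i} e_i` in the free algebra -/
def freeE' (i : ι) : FreeAlgebra ℂ (BGen ι P) :=
  ((Q.qi i)⁻¹ - Q.qi i) • (FreeAlgebra.ι ℂ (.t (Q.root i)) * FreeAlgebra.ι ℂ (.e i))

open scoped Classical in
/-- The relations of the `q`-boson algebra: those of `U_q^+` between the `e_i`, `t_λ`, those of
`U_q^-` between the `f_i`, `t_λ` (with `t_λ` in place of `K'_λ`), and
`e'_i f_j = q^(-(α_i, α_j)) f_j e'_i + δ_ij`. -/
inductive BRel : FreeAlgebra ℂ (BGen ι P) → FreeAlgebra ℂ (BGen ι P) → Prop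
  | pos (x : FreeAlgebra ℂ (ι ⊕ P)) :
      Ideal.Quotient.mk Q.pairing.radL (Q.plus.ofFree x) = 0 → BRel (freePos x) 0
  | neg (x : FreeAlgebra ℂ (ι ⊕ P)) :
      Ideal.Quotient.mk Q.pairing.radR (Q.minus.ofFree x) = 0 → BRel (freeNeg x) 0
  | cross (i j : ι) : BRel (Q.freeE' i * FreeAlgebra.ι ℂ (.f j))
      (Q.qpow (-Q.form (Q.root i) (Q.root j)) • (FreeAlgebra.ι ℂ (.f j) * Q.freeE' i) +
        if i = j then 1 else 0)

/-- The `q`-boson algebra `B_q` -/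
def Bq : Type _ := RingQuot Q.BRel

instance : Ring Q.Bq := inferInstanceAs (Ring (RingQuot Q.BRel))
instance : Algebra ℂ Q.Bq := inferInstanceAs (Algebra ℂ (RingQuot Q.BRel))

/-- The quotient map from the free algebra -/
def toBq : FreeAlgebra ℂ (BGen ι P) →ₐ[ℂ] Q.Bq := RingQuot.mkAlgHom ℂ Q.BRel

/-- `e'_i = (q_i⁻¹ - q_i) t_{α_i} e_i ∈ B_q` -/
def be' (i : ι) : Q.Bq := Q.toBq (Q.freeE' i)
/-- `f_i ∈ B_q` -/
def bf (i : ι) : Q.Bq := Q.toBq (FreeAlgebra.ι ℂ (.f i))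

/-- The quantized Weyl algebra `W_q`: the subalgebra of `B_q` generated by the `e'_i` and `f_i`. -/
def Wq : Subalgebra ℂ Q.Bq := Algebra.adjoin ℂ (Set.range Q.be' ∪ Set.range Q.bf)

/-- `e'_i ∈ W_q` -/
def we' (i : ι) : Q.Wq := ⟨Q.be' i, Algebra.subset_adjoin (Or.inl ⟨i, rfl⟩)⟩
/-- `f_i ∈ W_q` -/
def wf (i : ι) : Q.Wq := ⟨Q.bf i, Algebra.subset_adjoin (Or.inr ⟨i, rfl⟩)⟩

end QDatum

section Lie
open LieAlgebra.IsKilling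
variable {g : Type*} [LieRing g] [LieAlgebra ℂ g] [FiniteDimensional ℂ g]
  [LieAlgebra.IsSemisimple ℂ g] (H : LieSubalgebra ℂ g) [H.IsCartanSubalgebra]

/-- The weight lattice: the `λ ∈ 𝔥*` in the `ℚ`-span of the roots with `λ(α^∨) ∈ ℤ` for all
roots `α`. -/
def weightLattice : AddSubgroup (Module.Dual ℂ H) where
  carrier := {l | l ∈ Submodule.span ℚ (Set.range (rootSystem H).root) ∧
    ∀ a, ∃ n : ℤ, l ((rootSystem H).coroot a) = n}
  zero_mem' := ⟨zero_mem _, fun _ => ⟨0, by simp⟩⟩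
  add_mem' := by
    rintro l m ⟨hl, hl'⟩ ⟨hm, hm'⟩
    refine ⟨add_mem hl hm, fun a => ?_⟩
    obtain ⟨r, hr⟩ := hl' a
    obtain ⟨s, hs⟩ := hm' a
    exact ⟨r + s, by rw [LinearMap.add_apply, hr, hs]; simp⟩
  neg_mem' := by
    rintro l ⟨hl, hl'⟩
    refine ⟨neg_mem hl, fun a => ?_⟩
    obtain ⟨r, hr⟩ := hl' a
    exact ⟨-r, by rw [LinearMap.neg_apply, hr]; simp⟩

theorem root_mem_weightLattice (a) : (rootSystem H).root a ∈ weightLattice H :=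
  ⟨Submodule.subset_span ⟨a, rfl⟩, fun c => by
    obtain ⟨n, hn⟩ := (rootSystem H).exists_value (S := ℤ) a c
    exact ⟨n, hn.symm⟩⟩

/-- The weight lattice as a group -/
def Weights : Type _ := weightLattice H

instance : AddCommGroup (Weights H) := inferInstanceAs (AddCommGroup (weightLattice H))

variable {H}

/-- The index set of the simple roots -/
def SimpleRoots (b : (rootSystem H).Base) : Type _ := b.support

/-- The datum attached to a base of the root system, an invariant form on `𝔥*` and `ħ`. -/
def lieDatum (b : (rootSystem H).Base) (F : (rootSystem H).InvariantForm) (hbar : ℂ) :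
    QDatum (SimpleRoots b) (Weights H) where
  root i := ⟨(rootSystem H).root i.1, root_mem_weightLattice H i.1⟩
  form := AddMonoidHom.mk' (fun l => AddMonoidHom.mk' (fun m => F.form l.1 m.1)
      fun m n => map_add (F.form l.1) m.1 n.1)
    fun l m => AddMonoidHom.ext fun n => LinearMap.congr_fun (map_add F.form l.1 m.1) n.1
  symm l m := F.symm.eq l.1 m.1
  hbar := hbar

end Lie

end
end QuantumWeyl

/-! Commutation relations between two algebra maps `α : A → R` and `β : B → R` can be written in the
single convolution ring `Hom(A ⊗ B, R)`. Let `x` and `y` be `α` and `β` placed on their own tensor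
legs, and let `s` be the pairing `φ`, which is invertible with inverse `φ(a, S b)`. The Heisenberg
double is universal for `x y = s y x`, and the quantum double is universal for `s y x = x y s`. Most
of the Hopf-theoretic argument is then manipulation of words in a ring.

In an algebra receiving the Heisenberg double, left multiplications satisfy `x y = s y x`. Right
multiplications by antipodes satisfy the inverted relation, with `s` on the other side. Together the
adjoint actions of `A` and `B` satisfy the relation of the quantum double
(`IsHeisPair.isDoublePair_adHom`). By `heisAct_eq` the Schrödinger action on the Heisenberg double
is exactly this adjoint action, so it is an action by a module algebra structure. The coaction is an
algebra map (`isHeisPair_coact`), and the Yetter–Drinfeld condition is multiplicative in the acting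
element (`YDCompat.mul`). It therefore needs checking only on the two halves, where it is a
cancellation between conjugations (`yDCompat_adHom`).

The remaining work concerns the quantized Weyl algebra. The `q`-boson algebra has one torus `t_λ`,
and it maps to the Heisenberg double by `t_λ ↦ 1 ♯ K_λ`. The relations of `U_q^-` survive this
substitution because the right radical is homogeneous for the torus degree (`gradedMinus_eq_zero`).
That in turn follows from linear independence of the characters `q^(-(λ, μ))`. The map is injective
since every element of `B_q` is a combination of words in the `f_i` times elements from `U_q^+`
(`heiToBq_bosonToHei`).

The subalgebra generated by the `1 ♯ E'_i` and `F_i ♯ 1` is stable under the quantum double, and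
`K_λ ⊗ 1` and `1 ⊗ K'_λ` act on it by the same scalars on generators (`adHom_K_eq_adHom_K'`). Hence
the action factors through `U_q`. The coaction restricts because the second legs of `Δ(E'_i)` and
`Δ(F_i)` are `1` and the generator itself. All identities then descend along the surjection `π` and
the injection `j`.

The Lie algebra enters only through two facts: `q_i⁻¹ ≠ q_i`, and the characters `q^(-(λ, μ))`
separate the weights. Both follow from `q` not being a root of unity. -/

namespace QuantumWeyl
noncomputable section
open scoped TensorProduct
open Coalgebra HopfAlgebra WithConv
set_option linter.unusedSectionVars false
set_option linter.unusedSimpArgs false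
set_option linter.unusedVariables false

/-! ### Convolution algebras and adjoint actions -/

section Convolution
variable {k : Type*} [CommRing k]

section const
variable {C R : Type*} [AddCommGroup C] [Module k C] [Coalgebra k C] [Ring R] [Algebra k R]

/-- The constant `c ↦ ε(c) v` in the convolution algebra. -/
def const (k C : Type*) {R : Type*} [CommRing k] [AddCommGroup C] [Module k C] [Coalgebra k C]
    [Ring R] [Algebra k R] (v : R) : WithConv (C →ₗ[k] R) :=
  toConv (LinearMap.toSpanSingleton k R v ∘ₗ counit)

theorem const_apply (v : R) (c : C) : const k C v c = counit (R := k) c • v := rfl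

/-- Counitality absorbs the `ε` in the constant. This is what lets `∑ α(a₁) w α(S a₂)` be written as
a triple convolution product with `w` in the middle. -/
theorem mul_const_apply (f : WithConv (C →ₗ[k] R)) (v : R) (c : C) :
    (f * const k C v) c = f c * v := by
  rw [(ℛ k c).convMul_apply]
  conv_rhs => rw [← sum_smul_counit (ℛ k c)]
  simp [const_apply, Finset.sum_mul]

theorem const_mul (v w : R) : const k C (v * w) = const k C v * const k C w := by
  ext c
  change const k C (v * w) c = (const k C v * const k C w) c
  rw [mul_const_apply]
  simp [const_apply]

theorem scal_mul_apply (s : WithConv (C →ₗ[k] k)) (f : WithConv (C →ₗ[k] R)) {c : C} {ι : Type*}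
    (r : Repr k c ι) : (scal R s * f) c = ∑ i ∈ r.index, s (r.left i) • f (r.right i) := by
  rw [r.convMul_apply]
  simp [scal_apply, Algebra.smul_def]

theorem mul_scal_apply (s : WithConv (C →ₗ[k] k)) (f : WithConv (C →ₗ[k] R)) {c : C} {ι : Type*}
    (r : Repr k c ι) : (f * scal R s) c = ∑ i ∈ r.index, s (r.right i) • f (r.left i) := by
  rw [r.convMul_apply]
  simp [scal_apply, Algebra.smul_def, Algebra.commutes]

end const

section legs
variable {A B R : Type*} [Ring A] [Bialgebra k A] [Ring B] [Bialgebra k B] [Ring R] [Algebra k R]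

/-- `f ⊗ ε` -/
def onL (B : Type*) [Ring B] [Bialgebra k B] (f : WithConv (A →ₗ[k] R)) :
    WithConv (A ⊗[k] B →ₗ[k] R) :=
  toConv (f.ofConv ∘ₗ ((projL k A B : A ⊗[k] B →ₗc[k] A) : A ⊗[k] B →ₗ[k] A))

/-- `ε ⊗ g` -/
def onR (A : Type*) [Ring A] [Bialgebra k A] (g : WithConv (B →ₗ[k] R)) :
    WithConv (A ⊗[k] B →ₗ[k] R) :=
  toConv (g.ofConv ∘ₗ ((projR k A B : A ⊗[k] B →ₗc[k] B) : A ⊗[k] B →ₗ[k] B))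

theorem onL_tmul (f : WithConv (A →ₗ[k] R)) (a : A) (b : B) :
    onL B f (a ⊗ₜ b) = counit (R := k) b • f a :=
  (congrArg f.ofConv (projL_tmul k a b)).trans (map_smul _ _ _)

theorem onR_tmul (g : WithConv (B →ₗ[k] R)) (a : A) (b : B) :
    onR A g (a ⊗ₜ b) = counit (R := k) a • g b :=
  (congrArg g.ofConv (projR_tmul k a b)).trans (map_smul _ _ _)

theorem onL_mul (f g : WithConv (A →ₗ[k] R)) : onL B (f * g) = onL B f * onL B g :=
  comp_mul f g (projL k A B : A ⊗[k] B →ₗc[k] A)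

theorem onR_mul (f g : WithConv (B →ₗ[k] R)) : onR A (f * g) = onR A f * onR A g :=
  comp_mul f g (projR k A B : A ⊗[k] B →ₗc[k] B)

theorem conv_ext {f g : WithConv (A ⊗[k] B →ₗ[k] R)} (h : ∀ a b, f (a ⊗ₜ b) = g (a ⊗ₜ b)) :
    f = g :=
  congrArg toConv (TensorProduct.ext' h : f.ofConv = g.ofConv)

theorem onL_one : onL B (1 : WithConv (A →ₗ[k] R)) = 1 := by
  refine conv_ext fun a b => ?_
  rw [onL_tmul]
  simp [Algebra.algebraMap_eq_smul_one, smul_smul, mul_comm]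

theorem onR_one : onR A (1 : WithConv (B →ₗ[k] R)) = 1 := by
  refine conv_ext fun a b => ?_
  rw [onR_tmul]
  simp [Algebra.algebraMap_eq_smul_one, smul_smul, mul_comm]

/-- Each factor carries a counit on the leg it does not see, so no coproduct is left over. The order
of the convolution factors records the order of the values in `R`, and a commutation rule becomes an
identity between convolution products. -/
theorem onL_mul_onR (f : WithConv (A →ₗ[k] R)) (g : WithConv (B →ₗ[k] R)) (a : A) (b : B) :
    (onL B f * onR A g) (a ⊗ₜ b) = f a * g b := by
  refine (conv_tmul _ _ a b).trans ?_
  conv_rhs => rw [← sum_smul_counit (ℛ k a), ← sum_counit_smul (ℛ k b)]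
  simp [onL_tmul, onR_tmul, Finset.sum_mul_sum, smul_smul, mul_comm]

theorem onR_mul_onL (f : WithConv (A →ₗ[k] R)) (g : WithConv (B →ₗ[k] R)) (a : A) (b : B) :
    (onR A g * onL B f) (a ⊗ₜ b) = g b * f a := by
  refine (conv_tmul _ _ a b).trans ?_
  conv_rhs => rw [← sum_counit_smul (ℛ k a), ← sum_smul_counit (ℛ k b)]
  rw [map_sum, map_sum, Finset.sum_mul_sum, Finset.sum_comm]
  simp [onL_tmul, onR_tmul, smul_smul, mul_comm]

/-- Convolution elements commute as soon as all their values do, when one of them only sees the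
first and the other only the second tensor factor. -/
theorem onR_onL_comm (f : WithConv (A →ₗ[k] R)) (g : WithConv (B →ₗ[k] R))
    (h : ∀ a b, g b * f a = f a * g b) : onR A g * onL B f = onL B f * onR A g :=
  conv_ext fun a b => by rw [onR_mul_onL, onL_mul_onR, h]

end legs

section post
variable {C R R' : Type*} [AddCommGroup C] [Module k C] [Coalgebra k C] [Ring R] [Algebra k R]
  [Ring R'] [Algebra k R']

/-- Postcomposition with a linear map. -/
def post (m : R →ₗ[k] R') (f : WithConv (C →ₗ[k] R)) : WithConv (C →ₗ[k] R') :=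
  toConv (m ∘ₗ f.ofConv)

theorem post_apply (m : R →ₗ[k] R') (f : WithConv (C →ₗ[k] R)) (c : C) : post m f c = m (f c) := rfl

/-- Linearity of `m` is enough because the other factor has scalar values. The universal properties
below apply this to maps whose multiplicativity is still to be shown. -/
theorem post_scal_mul (m : R →ₗ[k] R') (s : WithConv (C →ₗ[k] k)) (f : WithConv (C →ₗ[k] R)) :
    post m (scal R s * f) = scal R' s * post m f := by
  ext c
  refine (congrArg m (scal_mul_apply s f (ℛ k c))).trans ?_
  refine Eq.trans ?_ (scal_mul_apply s _ (ℛ k c)).symm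
  simp [post_apply]

theorem post_mul_scal (m : R →ₗ[k] R') (s : WithConv (C →ₗ[k] k)) (f : WithConv (C →ₗ[k] R)) :
    post m (f * scal R s) = post m f * scal R' s := by
  ext c
  refine (congrArg m (mul_scal_apply s f (ℛ k c))).trans ?_
  refine Eq.trans ?_ (mul_scal_apply s _ (ℛ k c)).symm
  simp [post_apply]

end post

section antipode
variable {A R : Type*} [Ring A] [HopfAlgebra k A] [Ring R] [Algebra k R]

/-- An algebra homomorphism in the convolution algebra. -/
def conv (α : A →ₐ[k] R) : WithConv (A →ₗ[k] R) := toConv α.toLinearMap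

/-- Its convolution inverse `α ∘ S`. -/
def convInv (α : A →ₐ[k] R) : WithConv (A →ₗ[k] R) := toConv (α.toLinearMap ∘ₗ antipode k)

@[simp] theorem conv_apply (α : A →ₐ[k] R) (a : A) : conv α a = α a := rfl
@[simp] theorem convInv_apply (α : A →ₐ[k] R) (a : A) : convInv α a = α (antipode k a) := rfl

theorem conv_mul_convInv (α : A →ₐ[k] R) : conv α * convInv α = 1 := by
  refine (alg_comp_mul α (toConv LinearMap.id) (toConv (antipode k))).symm.trans ?_
  rw [LinearMap.id_mul_antipode]
  ext a
  simp

theorem convInv_mul_conv (α : A →ₐ[k] R) : convInv α * conv α = 1 := by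
  refine (alg_comp_mul α (toConv (antipode k)) (toConv LinearMap.id)).symm.trans ?_
  rw [LinearMap.antipode_mul_id]
  ext a
  simp

/-- The algebra map `a ↦ (w ↦ w α(S a))` -/
def rightAnti (α : A →ₐ[k] R) : A →ₐ[k] Module.End k R :=
  AlgHom.ofLinearMap ((LinearMap.mul k R).flip ∘ₗ α.toLinearMap ∘ₗ antipode k)
    (by ext; simp) (fun a b => by ext; simp [antipode_mul_antidistrib, mul_assoc])

theorem rightAnti_apply (α : A →ₐ[k] R) (a : A) (w : R) :
    rightAnti α a w = w * α (antipode k a) := rfl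

/-- The algebra map `a ⊗ a' ↦ (w ↦ α(a) w α(S a'))` -/
def adTensor (α : A →ₐ[k] R) : A ⊗[k] A →ₐ[k] Module.End k R :=
  Algebra.TensorProduct.lift ((Algebra.lmul k R).comp α) (rightAnti α) fun a b => by
    ext w; simp [rightAnti_apply, mul_assoc]

theorem adTensor_tmul (α : A →ₐ[k] R) (a b : A) (w : R) :
    adTensor α (a ⊗ₜ b) w = α a * w * α (antipode k b) := by
  refine (congrArg (fun f : Module.End k R => f w) (Algebra.TensorProduct.lift_tmul _ _ _ a b)).trans ?_
  exact (mul_assoc _ _ _).symm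

/-- The adjoint action `a ↦ (w ↦ ∑ α(a₁) w α(S a₂))` -/
def adHom (α : A →ₐ[k] R) : A →ₐ[k] Module.End k R :=
  (adTensor α).comp (Bialgebra.comulAlgHom k A)

theorem adHom_apply' (α : A →ₐ[k] R) {a : A} {ι : Type*} (r : Repr k a ι) (w : R) :
    adHom α a w = ∑ i ∈ r.index, α (r.left i) * w * α (antipode k (r.right i)) := by
  rw [adHom, AlgHom.comp_apply, Bialgebra.comulAlgHom_apply, ← r.eq]
  simp [adTensor_tmul]

/-- Separates conjugation into left multiplications and right multiplications by antipodes. The two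
kinds commute with each other and obey separate relations. -/
theorem conv_adHom (α : A →ₐ[k] R) :
    conv (adHom α) = conv ((Algebra.lmul k R).comp α) * conv (rightAnti α) := by
  refine congrArg toConv (LinearMap.ext fun a => LinearMap.ext fun w => ?_)
  refine (adHom_apply' α (ℛ k a) w).trans ?_
  refine Eq.trans ?_ (congrArg (fun f : Module.End k R => f w) ((ℛ k a).convMul_apply _ _)).symm
  simp [rightAnti_apply, mul_assoc]

theorem adHom_apply (α : A →ₐ[k] R) (a : A) (w : R) :
    adHom α a w = (conv α * const k A w * convInv α) a := by
  rw [adHom_apply' α (ℛ k a), (ℛ k a).convMul_apply]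
  exact Finset.sum_congr rfl fun i _ => congrArg (· * _) (mul_const_apply (conv α) w _).symm

/-- In convolution form the adjoint action is conjugation by `α`, and the sum over the coproduct is
one more convolution. The claim becomes `α v α⁻¹ α w α⁻¹ = α v w α⁻¹`. -/
theorem adHom_mul (α : A →ₐ[k] R) {a : A} {ι : Type*} (r : Repr k a ι) (v w : R) :
    adHom α a (v * w) = ∑ i ∈ r.index, adHom α (r.left i) v * adHom α (r.right i) w := by
  simp only [adHom_apply]
  rw [← r.convMul_apply, const_mul]
  congr 1
  simp only [mul_assoc]
  rw [← mul_assoc (convInv α), convInv_mul_conv, one_mul]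

theorem adHom_one (α : A →ₐ[k] R) (a : A) : adHom α a 1 = counit (R := k) a • (1 : R) := by
  have : const k A (1 : R) = 1 := by
    ext a
    simp [const_apply, Algebra.algebraMap_eq_smul_one, const]
  rw [adHom_apply, this, mul_one, conv_mul_convInv]
  simp [Algebra.algebraMap_eq_smul_one]

theorem adHom_grouplike (α : A →ₐ[k] R) {a : A} (ha : comul (R := k) a = a ⊗ₜ a) (w : R) :
    adHom α a w = α a * w * α (antipode k a) := by
  rw [adHom, AlgHom.comp_apply, Bialgebra.comulAlgHom_apply, ha]
  simp [adTensor_tmul]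

theorem adHom_skew (α : A →ₐ[k] R) {a g h : A} (ha : comul (R := k) a = a ⊗ₜ g + h ⊗ₜ a) (w : R) :
    adHom α a w = α a * w * α (antipode k g) + α h * w * α (antipode k a) := by
  rw [adHom, AlgHom.comp_apply, Bialgebra.comulAlgHom_apply, ha]
  simp [adTensor_tmul]

end antipode
end Convolution

/-! ### Universal properties of the Heisenberg double and the quantum double -/

namespace HopfPairing
variable {k A B R : Type*} [CommRing k] [Ring A] [Ring B] [HopfAlgebra k A] [HopfAlgebra k B]
  [Ring R] [Algebra k R] (φ : HopfPairing k A B)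

/-- The pairing in the convolution algebra. -/
def pairC : WithConv (A ⊗[k] B →ₗ[k] k) := toConv (TensorProduct.lift φ.toFun)

/-- The convolution inverse `(a, b) ↦ φ(a, S b)` of the pairing. -/
def pairInv : WithConv (A ⊗[k] B →ₗ[k] k) := toConv (TensorProduct.lift (φ.toFun.compl₂ (antipode k)))

@[simp] theorem pairC_tmul (a : A) (b : B) : φ.pairC (a ⊗ₜ b) = φ a b := TensorProduct.lift.tmul _ _
@[simp] theorem pairInv_tmul (a : A) (b : B) : φ.pairInv (a ⊗ₜ b) = φ a (antipode k b) :=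
  TensorProduct.lift.tmul _ _

/-- Multiplicativity of the pairing in its second argument collects the product into `φ(a, b₁
S(b₂))`. -/
theorem pairC_mul_pairInv : φ.pairC * φ.pairInv = 1 := by
  refine conv_ext fun a b => (conv_tmul _ _ a b).trans ?_
  have := congrArg (fun x => φ a x) (sum_mul_antipode_eq_smul (ℛ k b))
  simp only [map_sum, φ.mul_right] at this
  rw [Finset.sum_comm] at this
  simp only [pairC_tmul, pairInv_tmul]
  rw [this]
  simp [φ.one_right, mul_comm]

theorem pairInv_mul_pairC : φ.pairInv * φ.pairC = 1 := by
  refine conv_ext fun a b => (conv_tmul _ _ a b).trans ?_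
  have := congrArg (fun x => φ a x) (sum_antipode_mul_eq_smul (ℛ k b))
  simp only [map_sum, φ.mul_right] at this
  rw [Finset.sum_comm] at this
  simp only [pairC_tmul, pairInv_tmul]
  rw [this]
  simp [φ.one_right, mul_comm]

theorem scal_pairC_mul_pairInv : scal R φ.pairC * scal R φ.pairInv = 1 := by
  rw [← scal_mul, pairC_mul_pairInv, scal_one]

theorem scal_pairInv_mul_pairC : scal R φ.pairInv * scal R φ.pairC = 1 := by
  rw [← scal_mul, pairInv_mul_pairC, scal_one]

/-- `α(a) β(b) = ∑ φ(a₁, b₁) β(b₂) α(a₂)` -/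
def IsHeisPair (α : A →ₐ[k] R) (β : B →ₐ[k] R) : Prop :=
  onL B (conv α) * onR A (conv β) = scal R φ.pairC * (onR A (conv β) * onL B (conv α))

/-- `∑ φ(a₁, b₁) β(b₂) α(a₂) = ∑ φ(a₂, b₂) α(a₁) β(b₁)` -/
def IsDoublePair (α : A →ₐ[k] R) (β : B →ₐ[k] R) : Prop :=
  scal R φ.pairC * (onR A (conv β) * onL B (conv α)) =
    onL B (conv α) * onR A (conv β) * scal R φ.pairC

section Heis

theorem sharp_one_right_mul (b b' : B) (a : A) :
    φ.sharp b 1 * φ.sharp b' a = φ.sharp (b * b') a := by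
  refine (φ.heis_mul' _ _ _ _ (TwoCocycle.reprOne k A) (ℛ k b')).trans ?_
  change _ = (b * b') ⊗ₜ a
  conv_rhs => rw [← sum_counit_smul (ℛ k b')]
  simp [TwoCocycle.reprOne, φ.one_left, Finset.mul_sum, TensorProduct.sum_tmul,
    TensorProduct.smul_tmul']

theorem sharp_mul_one_left (a a' : A) (b : B) :
    φ.sharp b a * φ.sharp 1 a' = φ.sharp b (a * a') := by
  refine (φ.heis_mul' _ _ _ _ (ℛ k a) (TwoCocycle.reprOne k B)).trans ?_
  change _ = b ⊗ₜ (a * a')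
  conv_rhs => rw [← sum_counit_smul (ℛ k a)]
  simp [TwoCocycle.reprOne, φ.one_right, Finset.sum_mul, TensorProduct.tmul_sum]

/-- `a ↦ 1 ♯ a` -/
def sharpA : A →ₐ[k] φ.Heis := AlgHom.ofLinearMap (TensorProduct.mk k B A 1) rfl
  fun a a' => (φ.sharp_mul_one_left a a' 1).symm

/-- `b ↦ b ♯ 1` -/
def sharpB : B →ₐ[k] φ.Heis := AlgHom.ofLinearMap ((TensorProduct.mk k B A).flip 1) rfl
  fun b b' => (φ.sharp_one_right_mul b b' 1).symm

theorem sharpA_apply (a : A) : φ.sharpA a = φ.sharp 1 a := rfl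
theorem sharpB_apply (b : B) : φ.sharpB b = φ.sharp b 1 := rfl

theorem sharpB_mul_sharpA (a : A) (b : B) : φ.sharpB b * φ.sharpA a = φ.sharp b a := by
  rw [sharpA_apply, sharpB_apply, sharp_one_right_mul, mul_one]

/-- The product formula for `(1 ♯ a)(b ♯ 1)`. Together with the two subalgebras it determines the
whole multiplication. -/
theorem isHeisPair_sharp : φ.IsHeisPair φ.sharpA φ.sharpB := by
  refine conv_ext fun a b => ?_
  rw [onL_mul_onR]
  refine (φ.heis_mul a 1 1 b).trans ?_
  refine Eq.trans ?_ (scal_mul_apply _ _ ((ℛ k a).tmul (ℛ k b))).symm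
  simp only [Repr.tmul_index, Repr.tmul_left, Repr.tmul_right, Finset.sum_product, pairC_tmul,
    onR_mul_onL, conv_apply, sharpB_mul_sharpA, one_mul, mul_one]

theorem heis_induction {p : φ.Heis → Prop} (h0 : p 0) (hadd : ∀ x y, p x → p y → p (x + y))
    (h : ∀ b a, p (φ.sharp b a)) (x : φ.Heis) : p x := by
  induction x using (TensorProduct.induction_on (M := B) (N := A)) with
  | zero => exact h0
  | add x y hx hy => exact hadd x y hx hy
  | tmul b a => exact h b a

theorem heis_hom_ext {M : Type*} [AddCommGroup M] [Module k M] {f g : φ.Heis →ₗ[k] M}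
    (h : ∀ b a, f (φ.sharp b a) = g (φ.sharp b a)) : f = g :=
  TensorProduct.ext' (M := B) (N := A) h

/-- `b ♯ a ↦ β(b) α(a)` as a linear map -/
def heisLin (α : A →ₐ[k] R) (β : B →ₐ[k] R) : φ.Heis →ₗ[k] R :=
  TensorProduct.lift ((LinearMap.mul k R).compl₁₂ β.toLinearMap α.toLinearMap)

theorem heisLin_sharp (α : A →ₐ[k] R) (β : B →ₐ[k] R) (a : A) (b : B) :
    φ.heisLin α β (φ.sharp b a) = β b * α a := TensorProduct.lift.tmul _ _

variable {φ} in
/-- The universal property of the Heisenberg double. -/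
def IsHeisPair.lift {α : A →ₐ[k] R} {β : B →ₐ[k] R} (h : φ.IsHeisPair α β) : φ.Heis →ₐ[k] R :=
  AlgHom.ofLinearMap (φ.heisLin α β)
    ((φ.heisLin_sharp α β 1 1).trans (by simp)) fun x y => by
  -- Left multiplication by `B` and right multiplication by `A` preserve the normal order `b ♯ a`.
  -- Multiplicativity is then at stake only for a product in the wrong order, `(1 ♯ a)(b ♯ 1)`,
  -- which `hm` settles.
  have hl : ∀ (b : B) (x : φ.Heis), φ.heisLin α β (φ.sharpB b * x) = β b * φ.heisLin α β x := by
    intro b x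
    induction x using φ.heis_induction with
    | h0 => simp
    | hadd x y hx hy => simp only [mul_add, map_add, hx, hy]
    | h b' a => rw [sharpB_apply, sharp_one_right_mul, heisLin_sharp, heisLin_sharp, map_mul,
        mul_assoc]
  have hr : ∀ (a : A) (x : φ.Heis), φ.heisLin α β (x * φ.sharpA a) = φ.heisLin α β x * α a := by
    intro a x
    induction x using φ.heis_induction with
    | h0 => simp
    | hadd x y hx hy => simp only [add_mul, map_add, hx, hy]
    | h b' a' => rw [sharpA_apply, sharp_mul_one_left, heisLin_sharp, heisLin_sharp, map_mul,
        mul_assoc]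
  have hm : ∀ a b, φ.heisLin α β (φ.sharpA a * φ.sharpB b) = α a * β b := by
    intro a b
    have e1 : post (φ.heisLin α β) (onR A (conv φ.sharpB) * onL B (conv φ.sharpA)) =
        onR A (conv β) * onL B (conv α) := conv_ext fun a b => by
      rw [post_apply, onR_mul_onL, onR_mul_onL, conv_apply, conv_apply, sharpB_mul_sharpA,
        heisLin_sharp]
      rfl
    -- The linear map carries the Heisenberg relation to `s y x` for the pair `(α, β)`, which the
    -- hypothesis identifies with `x y`.
    have e2 := congrArg (post (φ.heisLin α β)) φ.isHeisPair_sharp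
    rw [post_scal_mul, e1, ← h] at e2
    have := congrArg (fun f => f (a ⊗ₜ b)) e2
    simpa only [post_apply, onL_mul_onR, conv_apply] using this
  induction x using φ.heis_induction with
  | h0 => simp
  | hadd x x' hx hx' => simp only [add_mul, map_add, hx, hx']
  | h b a =>
    induction y using φ.heis_induction with
    | h0 => simp
    | hadd y y' hy hy' => simp only [mul_add, map_add, hy, hy']
    | h b' a' =>
      rw [heisLin_sharp, heisLin_sharp, ← sharpB_mul_sharpA, ← sharpB_mul_sharpA, mul_assoc, hl,
        ← mul_assoc (φ.sharpA a), hr, hm]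
      simp only [mul_assoc]

variable {φ} in
theorem IsHeisPair.lift_sharp {α : A →ₐ[k] R} {β : B →ₐ[k] R} (h : φ.IsHeisPair α β) (a : A)
    (b : B) : h.lift (φ.sharp b a) = β b * α a := φ.heisLin_sharp α β a b

end Heis

section Double
variable [HasBijectiveAntipode k A]

theorem double_induction {p : φ.Double → Prop} (h0 : p 0) (hadd : ∀ x y, p x → p y → p (x + y))
    (h : ∀ a b, p (φ.dtmul a b)) (x : φ.Double) : p x := by
  induction x using (TensorProduct.induction_on (M := A) (N := B)) with
  | zero => exact h0
  | add x y hx hy => exact hadd x y hx hy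
  | tmul a b => exact h a b

/-- The product formula of the double says that `y x` is `x y` conjugated by the pairing. The factor
`φ(S⁻¹ a, b)` there equals `φ(a, S b)`, which is the convolution inverse of `φ`. -/
theorem inrD_mul_inlD (a : A) (b : B) : φ.inrD b * φ.inlD a =
    (scal φ.Double φ.pairInv * (onL B (conv φ.inlD) * onR A (conv φ.inrD)) *
      scal φ.Double φ.pairC) (a ⊗ₜ b) := by
  refine (φ.double_mul' 1 a b 1 (ℛ k b) (ℛ k a)).trans ?_
  rw [mul_scal_apply _ _ ((ℛ k a).tmul (ℛ k b))]
  simp only [Repr.tmul_index, Repr.tmul_left, Repr.tmul_right, Finset.sum_product, pairC_tmul]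
  rw [Finset.sum_comm]
  refine Finset.sum_congr rfl fun i _ => Finset.sum_congr rfl fun j _ => congrArg _ ?_
  rw [φ.inv.heis_mul' _ _ _ _ (ℛ k _) (ℛ k _), scal_mul_apply _ _ ((ℛ k _).tmul (ℛ k _))]
  simp only [Repr.tmul_index, Repr.tmul_left, Repr.tmul_right, Finset.sum_product, pairInv_tmul]
  rw [Finset.sum_comm]
  refine Finset.sum_congr rfl fun x _ => Finset.sum_congr rfl fun y _ => ?_
  rw [onL_mul_onR, one_mul, mul_one]
  refine congrArg₂ (· • ·) (φ.antipodeInv_left _ _) (φ.inlD_mul_inrD _ _).symm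

theorem isDoublePair_inlD : φ.IsDoublePair φ.inlD φ.inrD := by
  have h : onR A (conv φ.inrD) * onL B (conv φ.inlD) =
      scal φ.Double φ.pairInv * (onL B (conv φ.inlD) * onR A (conv φ.inrD)) *
        scal φ.Double φ.pairC :=
    conv_ext fun a b => by rw [onR_mul_onL]; exact φ.inrD_mul_inlD a b
  rw [IsDoublePair, h, ← mul_assoc, ← mul_assoc, scal_pairC_mul_pairInv, one_mul]

/-- `a ⊗ b ↦ α(a) β(b)` as a linear map -/
def doubleLin (α : A →ₐ[k] R) (β : B →ₐ[k] R) : φ.Double →ₗ[k] R :=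
  TensorProduct.lift ((LinearMap.mul k R).compl₁₂ α.toLinearMap β.toLinearMap)

theorem doubleLin_dtmul (α : A →ₐ[k] R) (β : B →ₐ[k] R) (a : A) (b : B) :
    φ.doubleLin α β (φ.dtmul a b) = α a * β b := TensorProduct.lift.tmul _ _

variable {φ} in
/-- The universal property of the quantum double. -/
def IsDoublePair.lift {α : A →ₐ[k] R} {β : B →ₐ[k] R} (h : φ.IsDoublePair α β) :
    φ.Double →ₐ[k] R :=
  AlgHom.ofLinearMap (φ.doubleLin α β)
    ((φ.doubleLin_dtmul α β 1 1).trans (by simp)) fun x y => by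
  -- Here the normal order is `a ⊗ b`, so the only product needing the relation is `(1 ⊗ b)(a ⊗ 1)`.
  have hl : ∀ (a : A) (x : φ.Double), φ.doubleLin α β (φ.inlD a * x) = α a * φ.doubleLin α β x := by
    intro a x
    induction x using φ.double_induction with
    | h0 => simp
    | hadd x y hx hy => simp only [mul_add, map_add, hx, hy]
    | h a' b => rw [← inlD_mul_inrD, ← mul_assoc, ← map_mul, inlD_mul_inrD, inlD_mul_inrD,
        doubleLin_dtmul, doubleLin_dtmul, map_mul, mul_assoc]
  have hr : ∀ (b : B) (x : φ.Double), φ.doubleLin α β (x * φ.inrD b) = φ.doubleLin α β x * β b := by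
    intro a x
    induction x using φ.double_induction with
    | h0 => simp
    | hadd x y hx hy => simp only [add_mul, map_add, hx, hy]
    | h a' b => rw [← inlD_mul_inrD, mul_assoc, ← map_mul, inlD_mul_inrD, inlD_mul_inrD,
        doubleLin_dtmul, doubleLin_dtmul, map_mul, mul_assoc]
  have hm : ∀ a b, φ.doubleLin α β (φ.inrD b * φ.inlD a) = β b * α a := by
    intro a b
    have e1 : post (φ.doubleLin α β) (onL B (conv φ.inlD) * onR A (conv φ.inrD)) =
        onL B (conv α) * onR A (conv β) := conv_ext fun a b => by
      rw [post_apply, onL_mul_onR, onL_mul_onR, conv_apply, conv_apply, inlD_mul_inrD,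
        doubleLin_dtmul]
      rfl
    have e2 := congrArg (post (φ.doubleLin α β)) φ.isDoublePair_inlD
    rw [post_scal_mul, post_mul_scal, e1, ← h] at e2
    -- The relation of the double gives the value only up to the factor `s` on the left, which is
    -- invertible.
    have e3 := congrArg (scal R φ.pairInv * ·) e2
    simp only [← mul_assoc, scal_pairInv_mul_pairC, one_mul] at e3
    have := congrArg (fun f => f (a ⊗ₜ b)) e3
    simpa only [post_apply, onR_mul_onL, conv_apply] using this
  induction x using φ.double_induction with
  | h0 => simp
  | hadd x x' hx hx' => simp only [add_mul, map_add, hx, hx']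
  | h a b =>
    induction y using φ.double_induction with
    | h0 => simp
    | hadd y y' hy hy' => simp only [mul_add, map_add, hy, hy']
    | h a' b' =>
      rw [doubleLin_dtmul, doubleLin_dtmul, ← inlD_mul_inrD, ← inlD_mul_inrD, mul_assoc, hl,
        ← mul_assoc (φ.inrD b), hr, hm]
      simp only [mul_assoc]

variable {φ} in
theorem IsDoublePair.lift_dtmul {α : A →ₐ[k] R} {β : B →ₐ[k] R} (h : φ.IsDoublePair α β) (a : A)
    (b : B) : h.lift (φ.dtmul a b) = α a * β b := φ.doubleLin_dtmul α β a b

end Double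
end HopfPairing

/-! ### The quantum double acts on the Heisenberg double by adjoint actions -/

section legs
variable {k A B R : Type*} [CommRing k] [Ring A] [Bialgebra k A] [Ring B] [Bialgebra k B] [Ring R]
  [Algebra k R]

theorem mul_onL_apply (F : WithConv (A ⊗[k] B →ₗ[k] R)) (f : WithConv (A →ₗ[k] R)) {a : A}
    {ι : Type*} (r : Repr k a ι) (b : B) :
    (F * onL B f) (a ⊗ₜ b) = ∑ i ∈ r.index, F (r.left i ⊗ₜ b) * f (r.right i) := by
  refine (conv_tmul' _ _ r (ℛ k b)).trans (Finset.sum_congr rfl fun i _ => ?_)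
  conv_rhs => rw [← sum_smul_counit (ℛ k b)]
  simp [onL_tmul, TensorProduct.tmul_sum, Finset.sum_mul]

theorem mul_onR_apply (F : WithConv (A ⊗[k] B →ₗ[k] R)) (g : WithConv (B →ₗ[k] R)) (a : A) {b : B}
    {ι : Type*} (r : Repr k b ι) :
    (F * onR A g) (a ⊗ₜ b) = ∑ i ∈ r.index, F (a ⊗ₜ r.left i) * g (r.right i) := by
  refine (conv_tmul' _ _ (ℛ k a) r).trans ?_
  rw [Finset.sum_comm]
  refine Finset.sum_congr rfl fun i _ => ?_
  conv_rhs => rw [← sum_smul_counit (ℛ k a)]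
  simp [onR_tmul, TensorProduct.sum_tmul, Finset.sum_mul, ← TensorProduct.smul_tmul']

end legs

namespace HopfPairing
variable {k A B R : Type*} [CommRing k] [Ring A] [Ring B] [HopfAlgebra k A] [HopfAlgebra k B]
  [Ring R] [Algebra k R] {φ : HopfPairing k A B}

section pair
variable {α : A →ₐ[k] R} {β : B →ₐ[k] R}

theorem IsHeisPair.comp (h : φ.IsHeisPair α β) {R' : Type*} [Ring R'] [Algebra k R'] (i : R →ₐ[k] R') :
    φ.IsHeisPair (i.comp α) (i.comp β) := by
  have e1 : onL B (conv (i.comp α)) * onR A (conv (i.comp β)) =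
      post i.toLinearMap (onL B (conv α) * onR A (conv β)) := conv_ext fun a b => by
    rw [onL_mul_onR, post_apply, onL_mul_onR]; exact (map_mul i _ _).symm
  have e2 : onR A (conv (i.comp β)) * onL B (conv (i.comp α)) =
      post i.toLinearMap (onR A (conv β) * onL B (conv α)) := conv_ext fun a b => by
    rw [onR_mul_onL, post_apply, onR_mul_onL]; exact (map_mul i _ _).symm
  rw [IsHeisPair, e1, e2, h, post_scal_mul]

theorem IsDoublePair.comp (h : φ.IsDoublePair α β) {R' : Type*} [Ring R'] [Algebra k R']
    (i : R →ₐ[k] R') : φ.IsDoublePair (i.comp α) (i.comp β) := by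
  have e1 : onL B (conv (i.comp α)) * onR A (conv (i.comp β)) =
      post i.toLinearMap (onL B (conv α) * onR A (conv β)) := conv_ext fun a b => by
    rw [onL_mul_onR, post_apply, onL_mul_onR]; exact (map_mul i _ _).symm
  have e2 : onR A (conv (i.comp β)) * onL B (conv (i.comp α)) =
      post i.toLinearMap (onR A (conv β) * onL B (conv α)) := conv_ext fun a b => by
    rw [onR_mul_onL, post_apply, onR_mul_onL]; exact (map_mul i _ _).symm
  rw [IsDoublePair, e1, e2, ← post_scal_mul, h, post_mul_scal]

/-- Inverting `x y = s y x` gives `y⁻¹ x⁻¹ = x⁻¹ y⁻¹ s⁻¹`. The pairing moves to the right-hand end,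
and this is the source of the second `s` in the relation of the quantum double. -/
theorem IsHeisPair.inv_mul_inv (h : φ.IsHeisPair α β) : onL B (convInv α) * onR A (convInv β) =
    onR A (convInv β) * onL B (convInv α) * scal R φ.pairC := by
  have ha : onL B (conv α) * onL B (convInv α) = 1 := by
    rw [← onL_mul, conv_mul_convInv, onL_one]
  have ha' : onL B (convInv α) * onL B (conv α) = 1 := by
    rw [← onL_mul, convInv_mul_conv, onL_one]
  have hb : onR A (conv β) * onR A (convInv β) = 1 := by
    rw [← onR_mul, conv_mul_convInv, onR_one]
  have hb' : onR A (convInv β) * onR A (conv β) = 1 := by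
    rw [← onR_mul, convInv_mul_conv, onR_one]
  unfold IsHeisPair at h
  generalize onL B (conv α) = x at *
  generalize onR A (conv β) = y at *
  generalize onL B (convInv α) = x' at *
  generalize onR A (convInv β) = y' at *
  calc x' * y' = y' * x' * (x * y) * (x' * y') := by
        rw [mul_assoc y', ← mul_assoc x', ha', one_mul, hb', one_mul]
    _ = y' * x' * scal R φ.pairC * (y * (x * x') * y') := by rw [h]; simp only [mul_assoc]
    _ = _ := by rw [ha, mul_one, hb, mul_one]

end pair

/-- The adjoint actions of `A` and `B` on an algebra over the Heisenberg double. -/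
theorem IsHeisPair.isDoublePair_adHom {α : A →ₐ[k] R} {β : B →ₐ[k] R} (h : φ.IsHeisPair α β) :
    φ.IsDoublePair (adHom α) (adHom β) := by
  rw [IsDoublePair, conv_adHom, conv_adHom, onL_mul, onR_mul]
  -- Left multiplications inherit the Heisenberg relation, with `s` on the left. Right
  -- multiplications by antipodes reverse products and inherit its inverse `h2`, with `s` on the
  -- right. As left and right multiplications commute (`c1`, `c2`), the two relations combine into
  -- one with `s` on both sides.
  have h1 : onL B (conv ((Algebra.lmul k R).comp α)) * onR A (conv ((Algebra.lmul k R).comp β)) =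
      scal (Module.End k R) φ.pairC * (onR A (conv ((Algebra.lmul k R).comp β)) *
        onL B (conv ((Algebra.lmul k R).comp α))) := h.comp _
  have h2 : onR A (conv (rightAnti β)) * onL B (conv (rightAnti α)) =
      onL B (conv (rightAnti α)) * onR A (conv (rightAnti β)) * scal (Module.End k R) φ.pairC := by
    have e1 : onR A (conv (rightAnti β)) * onL B (conv (rightAnti α)) =
        post (LinearMap.mul k R).flip (onL B (convInv α) * onR A (convInv β)) :=
      conv_ext fun a b => by
        rw [onR_mul_onL, post_apply, onL_mul_onR]
        exact LinearMap.ext fun w => mul_assoc _ _ _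
    have e2 : onL B (conv (rightAnti α)) * onR A (conv (rightAnti β)) =
        post (LinearMap.mul k R).flip (onR A (convInv β) * onL B (convInv α)) :=
      conv_ext fun a b => by
        rw [onL_mul_onR, post_apply, onR_mul_onL]
        exact LinearMap.ext fun w => mul_assoc _ _ _
    rw [e1, e2, h.inv_mul_inv, post_mul_scal]
  have c1 : onR A (conv (rightAnti β)) * onL B (conv ((Algebra.lmul k R).comp α)) =
      onL B (conv ((Algebra.lmul k R).comp α)) * onR A (conv (rightAnti β)) :=
    onR_onL_comm _ _ fun a b => LinearMap.ext fun w => mul_assoc _ _ _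
  have c2 : onR A (conv ((Algebra.lmul k R).comp β)) * onL B (conv (rightAnti α)) =
      onL B (conv (rightAnti α)) * onR A (conv ((Algebra.lmul k R).comp β)) :=
    onR_onL_comm _ _ fun a b => LinearMap.ext fun w => (mul_assoc _ _ _).symm
  generalize onL B (conv ((Algebra.lmul k R).comp α)) = la at *
  generalize onR A (conv ((Algebra.lmul k R).comp β)) = lb at *
  generalize onL B (conv (rightAnti α)) = ra at *
  generalize onR A (conv (rightAnti β)) = rb at *
  calc scal (Module.End k R) φ.pairC * (lb * rb * (la * ra)) = scal (Module.End k R) φ.pairC * (lb * (rb * la) * ra) := by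
        simp only [mul_assoc]
    _ = scal (Module.End k R) φ.pairC * (lb * la) * (rb * ra) := by rw [c1]; simp only [mul_assoc]
    _ = la * (lb * ra) * rb * scal (Module.End k R) φ.pairC := by rw [← h1, h2]; simp only [mul_assoc]
    _ = _ := by rw [c2]; simp only [mul_assoc]

theorem adHom_sharpA_sharpA (a x : A) : adHom φ.sharpA a (φ.sharpA x) = φ.sharpA (adj k A a x) := by
  rw [adHom_apply' _ (ℛ k a), adj_apply, map_sum]
  simp only [map_mul, mul_assoc]

theorem adHom_sharpB_sharpB (b y : B) : adHom φ.sharpB b (φ.sharpB y) = φ.sharpB (adj k B b y) := by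
  rw [adHom_apply' _ (ℛ k b), adj_apply, map_sum]
  simp only [map_mul, mul_assoc]

section Double
variable [HasBijectiveAntipode k A]

/-- Multiplying the Heisenberg relation on the right by `x⁻¹` gives `x y x⁻¹ = s y`. The left side
is the adjoint action and the right side is the coadjoint one. -/
theorem adHom_sharpA_sharpB (a : A) (y : B) :
    adHom φ.sharpA a (φ.sharpB y) = φ.sharpB (φ.coadjB a y) := by
  have h := congrArg (· * onL B (convInv φ.sharpA)) φ.isHeisPair_sharp
  simp only [mul_assoc, ← onL_mul, conv_mul_convInv, onL_one, mul_one] at h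
  have := congrArg (fun f => f (a ⊗ₜ y)) h
  simp only [← mul_assoc] at this
  rw [mul_onL_apply _ _ (ℛ k a), mul_onR_apply _ _ _ (ℛ k y)] at this
  rw [adHom_apply' _ (ℛ k a), coadjB_apply]
  simpa only [map_sum, map_smul, onL_mul_onR, scal_apply, conv_apply, convInv_apply, pairC_tmul, ← Algebra.smul_def] using this

theorem coadjA_apply (b : B) (x : A) : φ.coadjA b x =
    ∑ j ∈ (ℛ k x).index, φ ((ℛ k x).left j) (antipode k b) • (ℛ k x).right j := by
  rw [coadjA, LinearMap.mk₂_apply, ← (ℛ k x).eq]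
  simp

/-- Solving the Heisenberg relation for the other conjugation gives `y x y⁻¹ = s⁻¹ x`. The inverse
pairing explains the antipode `S(b)` in the Schrödinger representation on `A`. -/
theorem adHom_sharpB_sharpA (b : B) (x : A) :
    adHom φ.sharpB b (φ.sharpA x) = φ.sharpA (φ.coadjA b x) := by
  have h := congrArg (scal φ.Heis φ.pairInv * · * onR A (convInv φ.sharpB)) φ.isHeisPair_sharp
  simp only [← mul_assoc, scal_pairInv_mul_pairC, one_mul] at h
  rw [mul_assoc (_ * _) (onR A _), ← onR_mul, conv_mul_convInv, onR_one, mul_one] at h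
  have := congrArg (fun f => f (x ⊗ₜ b)) h
  rw [mul_onL_apply _ _ (ℛ k x), mul_onR_apply _ _ _ (ℛ k b)] at this
  rw [adHom_apply' _ (ℛ k b), coadjA_apply]
  simpa only [map_sum, map_smul, onR_mul_onL, scal_apply, conv_apply, convInv_apply, pairInv_tmul, ← Algebra.smul_def] using this.symm

variable (φ) in
/-- The action of the double on the Heisenberg double, as an algebra homomorphism. -/
def heisActHom : φ.Double →ₐ[k] Module.End k φ.Heis := φ.isHeisPair_sharp.isDoublePair_adHom.lift

theorem heisActHom_dtmul (a : A) (b : B) :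
    φ.heisActHom (φ.dtmul a b) = adHom φ.sharpA a * adHom φ.sharpB b :=
  φ.isHeisPair_sharp.isDoublePair_adHom.lift_dtmul a b

theorem heisActHom_inlD (a : A) : φ.heisActHom (φ.inlD a) = adHom φ.sharpA a := by
  refine (heisActHom_dtmul a 1).trans ?_
  rw [map_one, mul_one]

theorem heisActHom_inrD (b : B) : φ.heisActHom (φ.inrD b) = adHom φ.sharpB b := by
  refine (heisActHom_dtmul 1 b).trans ?_
  rw [map_one, one_mul]

/-- The Schrödinger action is inner. On the subalgebras `B ♯ 1` and `1 ♯ A` it agrees with the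
adjoint action. On a product `(y ♯ 1)(1 ♯ x)` the adjoint action distributes over the coproduct
exactly as the diagonal action does. -/
theorem heisAct_eq (d : φ.Double) : φ.heisAct d = φ.heisActHom d := by
  induction d using φ.double_induction with
  | h0 => rw [map_zero, map_zero]
  | hadd x y hx hy => rw [map_add, map_add, hx, hy]
  | h a b =>
    refine φ.heis_hom_ext fun y x => ?_
    have e : φ.heisAct (φ.dtmul a b) (φ.sharp y x) = ∑ i ∈ (ℛ k a).index, ∑ j ∈ (ℛ k b).index,
        φ.sharp (φ.coadjB ((ℛ k a).left i) (adj k B ((ℛ k b).left j) y))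
          (adj k A ((ℛ k a).right i) (φ.coadjA ((ℛ k b).right j) x)) := by
      change (TensorProduct.homTensorHomMap (RingHom.id k) B A B A
        (TensorProduct.map φ.schrB φ.schrA (comul (φ.dtmul a b)))) (y ⊗ₜ x) = _
      rw [φ.comul_dtmul a b (ℛ k a) (ℛ k b)]
      simp only [map_sum, TensorProduct.map_tmul, LinearMap.sum_apply,
        TensorProduct.homTensorHomMap_apply]
      rfl
    rw [e, heisActHom_dtmul, Module.End.mul_apply, ← sharpB_mul_sharpA, adHom_mul _ (ℛ k b), map_sum,
      Finset.sum_comm]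
    refine Finset.sum_congr rfl fun j _ => ?_
    rw [adHom_mul _ (ℛ k a)]
    refine Finset.sum_congr rfl fun i _ => ?_
    rw [adHom_sharpB_sharpB, adHom_sharpB_sharpA, adHom_sharpA_sharpB, adHom_sharpA_sharpA,
      sharpB_mul_sharpA]

end Double
end HopfPairing

/-! ### The Yetter–Drinfeld condition, reduced to generators -/

section YetterDrinfeld
variable {k H V : Type*} [CommRing k] [Ring H] [Bialgebra k H] [AddCommGroup V] [Module k V]
  (act : H →ₗ[k] V →ₗ[k] V) (coact : V →ₗ[k] H ⊗[k] V)

/-- `x ⊗ y ↦ (h ⊗ v ↦ x h ⊗ y.v)` -/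
def diagAct : H ⊗[k] H →ₗ[k] Module.End k (H ⊗[k] V) :=
  TensorProduct.homTensorHomMap (RingHom.id k) H V H V ∘ₗ TensorProduct.map (LinearMap.mul k H) act

theorem diagAct_tmul (x y : H) : diagAct act (x ⊗ₜ y) =
    TensorProduct.map (LinearMap.mulLeft k x) (act y) := rfl

/-- `x ⊗ y ↦ (v ↦ (x.v)₋₁ y ⊗ (x.v)₀)` -/
def actCoact : H ⊗[k] H →ₗ[k] V →ₗ[k] H ⊗[k] V :=
  TensorProduct.lift (LinearMap.mk₂ k
    (fun x y => (LinearMap.mulRight k y).rTensor V ∘ₗ coact ∘ₗ act x)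
    (by intros; ext; simp) (by intros; ext; simp)
    (by
      intro m n n'
      have : LinearMap.mulRight k (n + n') = LinearMap.mulRight k n + LinearMap.mulRight k n' := by
        ext; simp [mul_add]
      rw [this, LinearMap.rTensor_add, LinearMap.add_comp])
    (by
      intro c m n
      have : LinearMap.mulRight k (c • n) = c • LinearMap.mulRight k n := by ext; simp
      rw [this, LinearMap.rTensor_smul, LinearMap.smul_comp]))

theorem actCoact_tmul (x y : H) : actCoact act coact (x ⊗ₜ y) =
    (LinearMap.mulRight k y).rTensor V ∘ₗ coact ∘ₗ act x := TensorProduct.lift.tmul _ _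

/-- The Yetter–Drinfeld condition for a given `h ∈ H`. -/
def YDCompat (h : H) : Prop := diagAct act (comul h) ∘ₗ coact = actCoact act coact (comul h)

variable {act coact}

theorem yDCompat_iff {h : H} {ι : Type*} (r : Repr k h ι) : YDCompat act coact h ↔ ∀ v,
    ∑ i ∈ r.index, TensorProduct.map (LinearMap.mulLeft k (r.left i)) (act (r.right i)) (coact v) =
    ∑ i ∈ r.index, (LinearMap.mulRight k (r.right i)).rTensor V (coact (act (r.left i) v)) := by
  rw [YDCompat, ← r.eq, LinearMap.ext_iff]
  simp only [map_sum, LinearMap.comp_apply, LinearMap.sum_apply, diagAct_tmul, actCoact_tmul]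

theorem YDCompat.add {h g : H} (hh : YDCompat act coact h) (hg : YDCompat act coact g) :
    YDCompat act coact (h + g) := by
  rw [YDCompat, map_add, map_add, map_add, LinearMap.add_comp, hh, hg]

theorem YDCompat.zero : YDCompat act coact 0 := by
  rw [YDCompat, map_zero, map_zero, map_zero, LinearMap.zero_comp]

theorem diagAct_mul (hact : ∀ g h, act (g * h) = act g ∘ₗ act h) (s t : H ⊗[k] H) :
    diagAct act (s * t) = diagAct act s ∘ₗ diagAct act t := by
  induction s using TensorProduct.induction_on with
  | zero => simp
  | add s s' h h' => simp only [add_mul, map_add, h, h', LinearMap.add_comp]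
  | tmul x y =>
    induction t using TensorProduct.induction_on with
    | zero => simp
    | add s s' h h' => simp only [mul_add, map_add, h, h', LinearMap.comp_add]
    | tmul x' y' =>
      simp only [Algebra.TensorProduct.tmul_mul_tmul, diagAct_tmul, ← TensorProduct.map_comp, hact,
        LinearMap.mulLeft_mul]

theorem diagAct_rTensor_mulRight (s : H ⊗[k] H) (y : H) :
    diagAct act s ∘ₗ (LinearMap.mulRight k y).rTensor V =
      (LinearMap.mulRight k y).rTensor V ∘ₗ diagAct act s := by
  induction s using TensorProduct.induction_on with
  | zero => simp
  | add s s' h h' => simp only [map_add, h, h', LinearMap.add_comp, LinearMap.comp_add]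
  | tmul x y => ext; simp [diagAct_tmul, mul_assoc]

/-- As `Δ(h g) = Δ(h) Δ(g)`, the condition for `g` first exchanges action and coaction. The right
multiplication this produces commutes with the diagonal action, so the condition for `h` applies
next. -/
theorem YDCompat.mul (hact : ∀ g h, act (g * h) = act g ∘ₗ act h) {h g : H}
    (hh : YDCompat act coact h) (hg : YDCompat act coact g) : YDCompat act coact (h * g) := by
  have key : ∀ t : H ⊗[k] H, diagAct act (comul h) ∘ₗ actCoact act coact t =
      actCoact act coact (comul h * t) := by
    intro t
    induction t using TensorProduct.induction_on with
    | zero => simp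
    | add s s' h h' => simp only [mul_add, map_add, h, h', LinearMap.comp_add]
    | tmul x y =>
      have e : ∀ s : H ⊗[k] H, actCoact act coact (s * x ⊗ₜ y) =
          (LinearMap.mulRight k y).rTensor V ∘ₗ actCoact act coact s ∘ₗ act x := by
        intro s
        induction s using TensorProduct.induction_on with
        | zero => simp
        | add s s' h h' => simp only [add_mul, map_add, h, h', LinearMap.comp_add, LinearMap.add_comp]
        | tmul x' y' =>
          rw [Algebra.TensorProduct.tmul_mul_tmul, actCoact_tmul, actCoact_tmul, hact,
            LinearMap.mulRight_mul, LinearMap.rTensor_comp]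
          simp only [LinearMap.comp_assoc]
      rw [e, ← hh, actCoact_tmul, ← LinearMap.comp_assoc, diagAct_rTensor_mulRight]
      simp only [LinearMap.comp_assoc]
  rw [YDCompat, Bialgebra.comul_mul, diagAct_mul hact, LinearMap.comp_assoc, hg, key]

/-- The Yetter–Drinfeld condition for the adjoint action along `ι : C → V` and elements coming from
a coalgebra map `i : C → H`, when the coaction restricts to `(i ⊗ ι) Δ`. -/
theorem yDCompat_adHom {C V : Type*} [Ring C] [HopfAlgebra k C] [Ring V] [Algebra k V]
    {act : H →ₗ[k] V →ₗ[k] V} (δ : V →ₐ[k] H ⊗[k] V) (i : C →ₐ[k] H) (ι : C →ₐ[k] V)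
    (hi : ∀ c, comul (R := k) (i c) = TensorProduct.map i.toLinearMap i.toLinearMap (comul c))
    (hact : ∀ c, act (i c) = adHom ι c)
    (hδ : δ.comp ι = (Algebra.TensorProduct.map i ι).comp (Bialgebra.comulAlgHom k C)) (c : C) :
    YDCompat act δ.toLinearMap (i c) := by
  let P : C →ₐ[k] H ⊗[k] V := Algebra.TensorProduct.includeLeft.comp i
  let Q : C →ₐ[k] H ⊗[k] V := Algebra.TensorProduct.includeRight.comp ι
  have hPQ : conv (δ.comp ι) = conv P * conv Q := by
    refine congrArg toConv (LinearMap.ext fun c => ?_)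
    refine Eq.trans ?_ ((ℛ k c).convMul_apply _ _).symm
    rw [hδ]
    change Algebra.TensorProduct.map i ι (comul (R := k) c) = _
    rw [← (ℛ k c).eq]
    simp [P, Q]
  -- Since `δ ι = P Q`, the element `(δ ι)⁻¹ P` is a left inverse of `Q`.
  have hinv : convInv (δ.comp ι) * conv P = convInv Q := by
    have h := convInv_mul_conv (δ.comp ι)
    rw [hPQ, ← mul_assoc] at h
    exact left_inv_eq_right_inv h (conv_mul_convInv Q)
  have h1 : ∀ c (t : H ⊗[k] V), (adHom ι c).lTensor H t = adHom Q c t := by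
    intro c t
    induction t using TensorProduct.induction_on with
    | zero => simp
    | add s s' h h' => simp only [map_add, h, h']
    | tmul x v =>
      rw [LinearMap.lTensor_tmul, adHom_apply' _ (ℛ k c), adHom_apply' _ (ℛ k c),
        TensorProduct.tmul_sum]
      simp [Q]
  -- Taking the coproduct of `i c` from that of `c` makes both sides sums over the same index set,
  -- that is, convolution products on `C`.
  let r : Repr k (i c) _ := 
    { index := (ℛ k c).index
      left := fun x => i ((ℛ k c).left x)
      right := fun x => i ((ℛ k c).right x)
      eq := by rw [hi]; conv_rhs => rw [← (ℛ k c).eq]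
               simp }
  rw [yDCompat_iff r]
  intro v
  -- With `hL` and `hR`, and with `t` the coaction of `v`, the condition reads `P (Q t Q⁻¹) = (P Q t
  -- (P Q)⁻¹) P`, which `hinv` makes a tautology.
  have hL : ∀ x y (t : H ⊗[k] V), TensorProduct.map (LinearMap.mulLeft k (i x)) (act (i y)) t =
      conv P x * (conv Q * const k C t * convInv Q) y := by
    intro x y t
    rw [← adHom_apply, ← h1, hact]
    induction t using TensorProduct.induction_on with
    | zero => simp
    | add s s' h h' => simp only [map_add, mul_add, h, h']
    | tmul u v => simp [P]
  have hR : ∀ x y, (LinearMap.mulRight k (i y)).rTensor V (δ (act (i x) v)) =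
      (conv (δ.comp ι) * const k C (δ v) * convInv (δ.comp ι)) x * conv P y := by
    intro x y
    have e : δ (adHom ι x v) = adHom (δ.comp ι) x (δ v) := by
      rw [adHom_apply' _ (ℛ k x), adHom_apply' _ (ℛ k x)]
      simp
    rw [← adHom_apply, ← e, hact]
    generalize δ (adHom ι x v) = t
    induction t using TensorProduct.induction_on with
    | zero => simp
    | add s s' h h' => simp only [map_add, add_mul, h, h']
    | tmul u v => simp [P]
  simp only [r, AlgHom.toLinearMap_apply, hL, hR]
  rw [← (ℛ k c).convMul_apply, ← (ℛ k c).convMul_apply, mul_assoc _ _ (conv P), hinv, hPQ]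
  simp only [mul_assoc]

end YetterDrinfeld

/-! ### The Heisenberg double as a Yetter–Drinfeld module over the quantum double -/

namespace HopfPairing
variable {k A B : Type*} [CommRing k] [Ring A] [Ring B] [HopfAlgebra k A] [HopfAlgebra k B]
  [HasBijectiveAntipode k A] (φ : HopfPairing k A B)

theorem isModuleAlgebra_heisAct : IsModuleAlgebra φ.heisAct where
  module :=
    { one_act := fun v => by rw [heisAct_eq, map_one, Module.End.one_apply]
      mul_act := fun g h v => by
        rw [heisAct_eq, heisAct_eq, heisAct_eq, map_mul, Module.End.mul_apply] }
  act_mul d v w := by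
    let f : φ.Double →ₗ[k] φ.Double →ₗ[k] φ.Heis :=
      (LinearMap.mul k φ.Heis).compl₁₂ (φ.heisAct.flip v) (φ.heisAct.flip w)
    refine Eq.trans ?_ (repr_sum (ℛ k d) f).symm
    induction d using φ.double_induction with
    | h0 => simp
    | hadd x y hx hy => simp only [map_add, LinearMap.add_apply, hx, hy]
    | h a b =>
      rw [φ.comul_dtmul a b (ℛ k a) (ℛ k b)]
      simp only [map_sum, TensorProduct.lift.tmul, f, LinearMap.compl₁₂_apply, LinearMap.flip_apply,
        LinearMap.mul_apply', heisAct_eq, heisActHom_dtmul, Module.End.mul_apply]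
      rw [adHom_mul _ (ℛ k b), map_sum, Finset.sum_comm]
      exact Finset.sum_congr rfl fun j _ => adHom_mul _ (ℛ k a) _ _
  act_one d := by
    induction d using φ.double_induction with
    | h0 => simp
    | hadd x y hx hy => simp only [map_add, LinearMap.add_apply, hx, hy, add_smul]
    | h a b =>
      rw [heisAct_eq, heisActHom_dtmul, Module.End.mul_apply, adHom_one, map_smul, adHom_one,
        smul_smul, counit_dtmul, mul_comm]

/-- `a ↦ ∑ (a₁ ⊗ 1) ⊗ (1 ♯ a₂)` -/
def coactA : A →ₐ[k] φ.Double ⊗[k] φ.Heis :=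
  (Algebra.TensorProduct.map φ.inlD φ.sharpA).comp (Bialgebra.comulAlgHom k A)

/-- `b ↦ ∑ (1 ⊗ b₁) ⊗ (b₂ ♯ 1)` -/
def coactB : B →ₐ[k] φ.Double ⊗[k] φ.Heis :=
  (Algebra.TensorProduct.map φ.inrD φ.sharpB).comp (Bialgebra.comulAlgHom k B)

theorem coactA_apply {a : A} {ι : Type*} (r : Repr k a ι) :
    φ.coactA a = ∑ i ∈ r.index, φ.inlD (r.left i) ⊗ₜ φ.sharpA (r.right i) := by
  rw [coactA, AlgHom.comp_apply, Bialgebra.comulAlgHom_apply, ← r.eq]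
  simp

theorem coactB_apply {b : B} {ι : Type*} (r : Repr k b ι) :
    φ.coactB b = ∑ i ∈ r.index, φ.inrD (r.left i) ⊗ₜ φ.sharpB (r.right i) := by
  rw [coactB, AlgHom.comp_apply, Bialgebra.comulAlgHom_apply, ← r.eq]
  simp

theorem conv_coactA : conv φ.coactA =
    conv ((Algebra.TensorProduct.includeLeft (R := k) (B := φ.Heis)).comp φ.inlD) *
      conv ((Algebra.TensorProduct.includeRight (A := φ.Double)).comp φ.sharpA) := by
  refine congrArg toConv (LinearMap.ext fun a => ?_)
  refine (φ.coactA_apply (ℛ k a)).trans (Eq.trans ?_ ((ℛ k a).convMul_apply _ _).symm)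
  simp

theorem conv_coactB : conv φ.coactB =
    conv ((Algebra.TensorProduct.includeLeft (R := k) (B := φ.Heis)).comp φ.inrD) *
      conv ((Algebra.TensorProduct.includeRight (A := φ.Double)).comp φ.sharpB) := by
  refine congrArg toConv (LinearMap.ext fun a => ?_)
  refine (φ.coactB_apply (ℛ k a)).trans (Eq.trans ?_ ((ℛ k a).convMul_apply _ _).symm)
  simp

/-- Each coaction is a convolution product of a part `p` in the quantum double and a part `q` in the
Heisenberg double, and the two kinds of parts commute. The relation for the `q` produces `s`, and
the relation for the `p` carries it to the far left while exchanging `pa` and `pb`. This is what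
makes the coaction multiplicative. -/
theorem isHeisPair_coact : φ.IsHeisPair φ.coactA φ.coactB := by
  rw [IsHeisPair, conv_coactA, conv_coactB, onL_mul, onR_mul]
  have d := φ.isDoublePair_inlD.comp (Algebra.TensorProduct.includeLeft (R := k) (B := φ.Heis))
  have h := φ.isHeisPair_sharp.comp (Algebra.TensorProduct.includeRight (R := k) (A := φ.Double))
  have c1 : onR A (conv ((Algebra.TensorProduct.includeLeft (R := k) (B := φ.Heis)).comp φ.inrD)) *
      onL B (conv ((Algebra.TensorProduct.includeRight (A := φ.Double)).comp φ.sharpA)) =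
      onL B (conv ((Algebra.TensorProduct.includeRight (A := φ.Double)).comp φ.sharpA)) *
      onR A (conv ((Algebra.TensorProduct.includeLeft (R := k) (B := φ.Heis)).comp φ.inrD)) :=
    onR_onL_comm _ _ fun a b => by simp
  have c2 : onR A (conv ((Algebra.TensorProduct.includeRight (A := φ.Double)).comp φ.sharpB)) *
      onL B (conv ((Algebra.TensorProduct.includeLeft (R := k) (B := φ.Heis)).comp φ.inlD)) =
      onL B (conv ((Algebra.TensorProduct.includeLeft (R := k) (B := φ.Heis)).comp φ.inlD)) *
      onR A (conv ((Algebra.TensorProduct.includeRight (A := φ.Double)).comp φ.sharpB)) :=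
    onR_onL_comm _ _ fun a b => by simp
  unfold IsDoublePair at d
  unfold IsHeisPair at h
  generalize onL B (conv ((Algebra.TensorProduct.includeLeft (R := k) (B := φ.Heis)).comp φ.inlD)) =
    pa at *
  generalize onR A (conv ((Algebra.TensorProduct.includeLeft (R := k) (B := φ.Heis)).comp φ.inrD)) =
    pb at *
  generalize onL B (conv ((Algebra.TensorProduct.includeRight (A := φ.Double)).comp φ.sharpA)) =
    qa at *
  generalize onR A (conv ((Algebra.TensorProduct.includeRight (A := φ.Double)).comp φ.sharpB)) =
    qb at *
  generalize scal (φ.Double ⊗[k] φ.Heis) φ.pairC = s at *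
  calc pa * qa * (pb * qb) = pa * (qa * pb) * qb := by simp only [mul_assoc]
    _ = pa * pb * (qa * qb) := by rw [← c1]; simp only [mul_assoc]
    _ = (pa * pb * s) * (qb * qa) := by rw [h]; simp only [mul_assoc]
    _ = s * (pb * (pa * qb) * qa) := by rw [← d]; simp only [mul_assoc]
    _ = _ := by rw [← c2]; simp only [mul_assoc]

/-- The coaction on the Heisenberg double as an algebra homomorphism. -/
def heisCoactHom : φ.Heis →ₐ[k] φ.Double ⊗[k] φ.Heis := φ.isHeisPair_coact.lift

theorem heisCoactHom_sharp (a : A) (b : B) :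
    φ.heisCoactHom (φ.sharp b a) = φ.coactB b * φ.coactA a := φ.isHeisPair_coact.lift_sharp a b

theorem heisCoactHom_sharpA (a : A) : φ.heisCoactHom (φ.sharpA a) = φ.coactA a := by
  refine (φ.heisCoactHom_sharp a 1).trans ?_
  rw [map_one, one_mul]

theorem heisCoactHom_sharpB (b : B) : φ.heisCoactHom (φ.sharpB b) = φ.coactB b := by
  refine (φ.heisCoactHom_sharp 1 b).trans ?_
  rw [map_one, mul_one]

theorem heisCoact_eq : φ.heisCoact = φ.heisCoactHom.toLinearMap := by
  refine φ.heis_hom_ext fun b a => ?_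
  rw [heisCoact_sharp, AlgHom.toLinearMap_apply, heisCoactHom_sharp, φ.coactA_apply (ℛ k a),
    φ.coactB_apply (ℛ k b), Finset.sum_mul_sum]
  refine Finset.sum_congr rfl fun i _ => Finset.sum_congr rfl fun j _ => ?_
  rw [Algebra.TensorProduct.tmul_mul_tmul, sharpB_mul_sharpA]
  rfl

theorem heis_algHom_ext {R : Type*} [Ring R] [Algebra k R] {f g : φ.Heis →ₐ[k] R}
    (hA : f.comp φ.sharpA = g.comp φ.sharpA) (hB : f.comp φ.sharpB = g.comp φ.sharpB) : f = g := by
  apply AlgHom.toLinearMap_injective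
  refine φ.heis_hom_ext fun b a => ?_
  rw [← sharpB_mul_sharpA, AlgHom.toLinearMap_apply, AlgHom.toLinearMap_apply, map_mul, map_mul]
  exact congrArg₂ (· * ·) (DFunLike.congr_fun hB b) (DFunLike.congr_fun hA a)

theorem comul_inlD (a : A) : comul (R := k) (φ.inlD a) =
    TensorProduct.map φ.inlD.toLinearMap φ.inlD.toLinearMap (comul a) := by
  refine (φ.comul_dtmul a 1 (ℛ k a) (TwoCocycle.reprOne k B)).trans ?_
  conv_rhs => rw [← (ℛ k a).eq]
  rw [map_sum]
  simp only [TwoCocycle.reprOne, Finset.sum_singleton]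
  rfl

theorem comul_inrD (b : B) : comul (R := k) (φ.inrD b) =
    TensorProduct.map φ.inrD.toLinearMap φ.inrD.toLinearMap (comul b) := by
  refine (φ.comul_dtmul 1 b (TwoCocycle.reprOne k A) (ℛ k b)).trans ?_
  conv_rhs => rw [← (ℛ k b).eq]
  rw [map_sum]
  simp only [TwoCocycle.reprOne, Finset.sum_singleton]
  rfl

/-- Coassociativity of `(i ⊗ ι) Δ` for a coalgebra map `i`. -/
theorem coassoc_map {C D V : Type*} [AddCommGroup C] [Module k C] [Coalgebra k C] [AddCommGroup D]
    [Module k D] [Coalgebra k D] [AddCommGroup V] [Module k V] (i : C →ₗ[k] D) (ι : C →ₗ[k] V)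
    (hi : ∀ c, comul (R := k) (i c) = TensorProduct.map i i (comul c)) (c : C) :
    TensorProduct.assoc k D D V (comul.rTensor V (TensorProduct.map i ι (comul c))) =
      TensorProduct.map i (TensorProduct.map i ι) (comul.lTensor C (comul c)) := by
  rw [← Coalgebra.coassoc_apply]
  generalize comul (R := k) c = t
  induction t using TensorProduct.induction_on with
  | zero => simp
  | add s t h h' => simp only [map_add, h, h']
  | tmul x y =>
    simp only [TensorProduct.map_tmul, LinearMap.rTensor_tmul, hi]
    generalize comul (R := k) x = t
    induction t using TensorProduct.induction_on with
    | zero => simp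
    | add s t h h' => simp only [map_add, TensorProduct.add_tmul, h, h']
    | tmul x y => simp

/-- In each axiom both sides are algebra homomorphisms out of the Heisenberg double, so they need
comparing only on `1 ♯ A` and `B ♯ 1`. There the coaction is the coproduct, and the axioms are those
of the coalgebras `A` and `B`. -/
theorem isComoduleCoaction_heisCoact : IsComoduleCoaction φ.heisCoact where
  coassoc := by
    let f : φ.Heis →ₐ[k] φ.Double ⊗[k] (φ.Double ⊗[k] φ.Heis) :=
      ((Algebra.TensorProduct.assoc k k k φ.Double φ.Double φ.Heis).toAlgHom.comp
        (Algebra.TensorProduct.map (Bialgebra.comulAlgHom k φ.Double) (AlgHom.id k φ.Heis))).comp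
        φ.heisCoactHom
    let g : φ.Heis →ₐ[k] φ.Double ⊗[k] (φ.Double ⊗[k] φ.Heis) :=
      (Algebra.TensorProduct.map (AlgHom.id k φ.Double) φ.heisCoactHom).comp φ.heisCoactHom
    have h : f = g := by
      refine φ.heis_algHom_ext (AlgHom.ext fun a => ?_) (AlgHom.ext fun b => ?_)
      · refine Eq.trans ?_ ((coassoc_map φ.inlD.toLinearMap φ.sharpA.toLinearMap φ.comul_inlD
          a).trans ?_)
        · exact congrArg (fun t => (TensorProduct.assoc k _ _ _) (comul.rTensor _ t))
            (φ.heisCoactHom_sharpA a)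
        · refine Eq.trans ?_ (congrArg (φ.heisCoactHom.toLinearMap.lTensor _)
            (φ.heisCoactHom_sharpA a)).symm
          rw [φ.coactA_apply (ℛ k a)]
          conv_lhs => rw [← (ℛ k a).eq]
          simp only [map_sum, LinearMap.lTensor_tmul, TensorProduct.map_tmul,
            AlgHom.toLinearMap_apply, heisCoactHom_sharpA]
          rfl
      · refine Eq.trans ?_ ((coassoc_map φ.inrD.toLinearMap φ.sharpB.toLinearMap φ.comul_inrD
          b).trans ?_)
        · exact congrArg (fun t => (TensorProduct.assoc k _ _ _) (comul.rTensor _ t))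
            (φ.heisCoactHom_sharpB b)
        · refine Eq.trans ?_ (congrArg (φ.heisCoactHom.toLinearMap.lTensor _)
            (φ.heisCoactHom_sharpB b)).symm
          rw [φ.coactB_apply (ℛ k b)]
          conv_lhs => rw [← (ℛ k b).eq]
          simp only [map_sum, LinearMap.lTensor_tmul, TensorProduct.map_tmul,
            AlgHom.toLinearMap_apply, heisCoactHom_sharpB]
          rfl
    rw [heisCoact_eq]
    exact congrArg AlgHom.toLinearMap h
  counit := by
    let f : φ.Heis →ₐ[k] k ⊗[k] φ.Heis :=
      (Algebra.TensorProduct.map (Bialgebra.counitAlgHom k φ.Double) (AlgHom.id k φ.Heis)).comp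
        φ.heisCoactHom
    have h : f = Algebra.TensorProduct.includeRight := by
      refine φ.heis_algHom_ext (AlgHom.ext fun a => ?_) (AlgHom.ext fun b => ?_)
      · refine (congrArg ((counit (R := k) (A := φ.Double)).rTensor φ.Heis)
          (φ.heisCoactHom_sharpA a)).trans ?_
        rw [φ.coactA_apply (ℛ k a)]
        have e : ∀ a, counit (R := k) (φ.inlD a) = counit (R := k) a := fun a =>
          (φ.counit_dtmul a 1).trans (by simp)
        simp [e]
      · refine (congrArg ((counit (R := k) (A := φ.Double)).rTensor φ.Heis)
          (φ.heisCoactHom_sharpB b)).trans ?_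
        rw [φ.coactB_apply (ℛ k b)]
        have e : ∀ b, counit (R := k) (φ.inrD b) = counit (R := k) b := fun b =>
          (φ.counit_dtmul 1 b).trans (by simp)
        simp [e]
    rw [heisCoact_eq]
    exact congrArg AlgHom.toLinearMap h

/-- The quantum double is spanned by products `(a ⊗ 1)(1 ⊗ b)`, and either factor acts by an adjoint
action along a map on which the coaction is the coproduct. -/
theorem yDCompat_heis (d : φ.Double) : YDCompat φ.heisAct φ.heisCoact d := by
  rw [heisCoact_eq]
  induction d using φ.double_induction with
  | h0 => exact .zero
  | hadd x y hx hy => exact hx.add hy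
  | h a b =>
    rw [← inlD_mul_inrD]
    refine YDCompat.mul (fun g h => LinearMap.ext (φ.isModuleAlgebra_heisAct.module.mul_act g h))
      ?_ ?_
    · exact yDCompat_adHom φ.heisCoactHom φ.inlD φ.sharpA φ.comul_inlD
        (fun c => by rw [heisAct_eq, heisActHom_inlD]) (AlgHom.ext φ.heisCoactHom_sharpA) a
    · exact yDCompat_adHom φ.heisCoactHom φ.inrD φ.sharpB φ.comul_inrD
        (fun c => by rw [heisAct_eq, heisActHom_inrD]) (AlgHom.ext φ.heisCoactHom_sharpB) b

/-- The Heisenberg double is a Yetter–Drinfeld module over the quantum double. -/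
theorem isYetterDrinfeld_heis : IsYetterDrinfeld φ.heisAct φ.heisCoact where
  module := φ.isModuleAlgebra_heisAct.module
  comodule := φ.isComoduleCoaction_heisCoact
  compat h v := (yDCompat_iff (ℛ k h)).1 (φ.yDCompat_heis h) v

end HopfPairing

/-! ### Descent along a surjection of bialgebras and an injection of algebras -/

section Descent
variable {k D U V W : Type*} [Field k] [Ring D] [Bialgebra k D] [Ring U] [Bialgebra k U]
  [Ring V] [Algebra k V] [Ring W] [Algebra k W] {π : D →ₐc[k] U} {j : W →ₐ[k] V}
  {act : D →ₗ[k] V →ₗ[k] V} {coact : V →ₗ[k] D ⊗[k] V}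
  {act' : U →ₗ[k] W →ₗ[k] W} {coact' : W →ₗ[k] U ⊗[k] W}

/-- Elements of `U` lift along `π`, and identities in `W` may be tested after the injection `j`. -/
theorem IsModuleAlgebra.descend (h : IsModuleAlgebra act) (hπ : Function.Surjective π)
    (hj : Function.Injective j) (hact : ∀ d w, j (act' (π d) w) = act d (j w)) :
    IsModuleAlgebra act' where
  module :=
    { one_act := fun v => hj (by rw [← map_one π, hact, h.module.one_act])
      mul_act := fun x y v => by
        obtain ⟨x, rfl⟩ := hπ x
        obtain ⟨y, rfl⟩ := hπ y
        exact hj (by rw [← map_mul, hact, hact, hact, h.module.mul_act]) }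
  act_mul x v w := by
    obtain ⟨d, rfl⟩ := hπ x
    have e := (repr_sum (ℛ k (π d)) ((LinearMap.mul k W).compl₁₂ (act'.flip v) (act'.flip w))).trans
      (repr_sum ((ℛ k d).induced π) ((LinearMap.mul k W).compl₁₂ (act'.flip v) (act'.flip w))).symm
    refine Eq.trans (hj ?_) e.symm
    rw [hact, map_mul, h.act_mul, map_sum]
    exact Finset.sum_congr rfl fun i _ => by
      rw [← hact, ← hact, ← map_mul]
      rfl
  act_one x := by
    obtain ⟨d, rfl⟩ := hπ x
    refine hj ?_
    rw [hact, map_one, h.act_one, map_smul, map_one]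
    congr 1
    exact (DFunLike.congr_fun (CoalgHomClass.counit_comp π) d).symm

theorem lTensor_algHom_injective (U : Type*) [AddCommGroup U] [Module k U]
    (hj : Function.Injective j) : Function.Injective (j.toLinearMap.lTensor U) :=
  Module.Flat.lTensor_preserves_injective_linearMap (M := U) j.toLinearMap hj

/-- Over a field, `U ⊗ j` and `U ⊗ (U ⊗ j)` stay injective. The axioms can therefore be tested with
`V` as last factor, where they are images under `π` of those for `coact`. -/
theorem isComoduleCoaction_descend (h : IsComoduleCoaction coact)
    (hj : Function.Injective j)
    (hcoact : ∀ w, j.toLinearMap.lTensor U (coact' w) = (π : D →ₗ[k] U).rTensor V (coact (j w))) :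
    IsComoduleCoaction coact' where
  coassoc := by
    refine LinearMap.ext fun w => ?_
    refine Module.Flat.lTensor_preserves_injective_linearMap (M := U) _
      (lTensor_algHom_injective U hj) ?_
    have e1 : ∀ t : U ⊗[k] W, (j.toLinearMap.lTensor U).lTensor U
        (TensorProduct.assoc k U U W (comul.rTensor W t)) =
        TensorProduct.assoc k U U V (comul.rTensor V (j.toLinearMap.lTensor U t)) := by
      intro t
      induction t using TensorProduct.induction_on with
      | zero => simp
      | add s t h h' => simp only [map_add, h, h']
      | tmul x y =>
        simp only [LinearMap.rTensor_tmul, LinearMap.lTensor_tmul]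
        generalize comul (R := k) x = t
        induction t using TensorProduct.induction_on with
        | zero => simp
        | add s t h h' => simp only [map_add, TensorProduct.add_tmul, h, h']
        | tmul x y => simp
    have e2 : ∀ s : D ⊗[k] V, TensorProduct.assoc k U U V
        (comul.rTensor V ((π : D →ₗ[k] U).rTensor V s)) =
        TensorProduct.map (π : D →ₗ[k] U) ((π : D →ₗ[k] U).rTensor V)
          (TensorProduct.assoc k D D V (comul.rTensor V s)) := by
      intro t
      induction t using TensorProduct.induction_on with
      | zero => simp
      | add s t h h' => simp only [map_add, h, h']
      | tmul x y =>
        have := DFunLike.congr_fun (CoalgHomClass.map_comp_comul π) x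
        simp only [LinearMap.rTensor_tmul]
        simp only [LinearMap.comp_apply] at this
        refine (congrArg (fun t => TensorProduct.assoc k U U V (t ⊗ₜ y)) this.symm).trans ?_
        generalize comul (R := k) x = t
        induction t using TensorProduct.induction_on with
        | zero => simp
        | add s t h h' => simp only [map_add, TensorProduct.add_tmul, h, h']
        | tmul x y => simp
    have e3 : ∀ t : U ⊗[k] W, (j.toLinearMap.lTensor U).lTensor U (coact'.lTensor U t) =
        ((π : D →ₗ[k] U).rTensor V ∘ₗ coact).lTensor U (j.toLinearMap.lTensor U t) := by
      intro t
      induction t using TensorProduct.induction_on with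
      | zero => simp
      | add s t h h' => simp only [map_add, h, h']
      | tmul x y => simp [hcoact]
    have e4 : ∀ s : D ⊗[k] V, ((π : D →ₗ[k] U).rTensor V ∘ₗ coact).lTensor U
        ((π : D →ₗ[k] U).rTensor V s) =
        TensorProduct.map (π : D →ₗ[k] U) ((π : D →ₗ[k] U).rTensor V) (coact.lTensor D s) := by
      intro t
      induction t using TensorProduct.induction_on with
      | zero => simp
      | add s t h h' => simp only [map_add, h, h']
      | tmul x y => simp
    have := DFunLike.congr_fun h.coassoc (j w)
    simp only [LinearMap.comp_apply, LinearEquiv.coe_coe] at this ⊢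
    rw [e1, hcoact, e2, this, e3, hcoact, e4]
  counit := by
    refine LinearMap.ext fun w => lTensor_algHom_injective k hj ?_
    have e1 : ∀ t : U ⊗[k] W, j.toLinearMap.lTensor k (counit.rTensor W t) =
        counit.rTensor V (j.toLinearMap.lTensor U t) := fun t => by
      induction t using TensorProduct.induction_on with
      | zero => simp
      | add s t h h' => simp only [map_add, h, h']
      | tmul x y => simp
    have e2 : ∀ t : D ⊗[k] V, (counit (R := k) (A := U)).rTensor V ((π : D →ₗ[k] U).rTensor V t) =
        (counit (R := k) (A := D)).rTensor V t := fun t => by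
      induction t using TensorProduct.induction_on with
      | zero => simp
      | add s t h h' => simp only [map_add, h, h']
      | tmul x y => simp
    have := DFunLike.congr_fun h.counit (j w)
    simp only [LinearMap.comp_apply] at this ⊢
    rw [e1, hcoact, e2, this]
    simp

theorem IsYetterDrinfeld.descend (h : IsYetterDrinfeld act coact) (h' : IsModuleAlgebra act')
    (hπ : Function.Surjective π) (hj : Function.Injective j)
    (hact : ∀ d w, j (act' (π d) w) = act d (j w))
    (hcoact : ∀ w, j.toLinearMap.lTensor U (coact' w) = (π : D →ₗ[k] U).rTensor V (coact (j w))) :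
    IsYetterDrinfeld act' coact' where
  module := h'.module
  comodule := isComoduleCoaction_descend h.comodule hj hcoact
  compat x w := by
    obtain ⟨d, rfl⟩ := hπ x
    revert w
    -- The condition does not depend on how `Δ(π d)` is written as a sum. The expression coming from
    -- `Δ(d)` allows a comparison term by term with the condition for `d`.
    rw [← yDCompat_iff, yDCompat_iff ((ℛ k d).induced π)]
    intro w
    apply lTensor_algHom_injective U hj
    have e1 : ∀ x y (t : U ⊗[k] W) (s : D ⊗[k] V),
        j.toLinearMap.lTensor U t = (π : D →ₗ[k] U).rTensor V s →
        j.toLinearMap.lTensor U (TensorProduct.map (LinearMap.mulLeft k (π x)) (act' (π y)) t) =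
        (π : D →ₗ[k] U).rTensor V (TensorProduct.map (LinearMap.mulLeft k x) (act y) s) := by
      intro x y t s hts
      have a1 : j.toLinearMap.lTensor U (TensorProduct.map (LinearMap.mulLeft k (π x)) (act' (π y)) t)
          = TensorProduct.map (LinearMap.mulLeft k (π x)) (act y) (j.toLinearMap.lTensor U t) := by
        clear hts
        induction t using TensorProduct.induction_on with
        | zero => simp
        | add s t h h' => simp only [map_add, h, h']
        | tmul x y => simp [hact]
      rw [a1, hts]
      clear hts
      induction s using TensorProduct.induction_on with
      | zero => simp
      | add s t h h' => simp only [map_add, h, h']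
      | tmul x y => simp
    have e2 : ∀ x (t : U ⊗[k] W) (s : D ⊗[k] V),
        j.toLinearMap.lTensor U t = (π : D →ₗ[k] U).rTensor V s →
        j.toLinearMap.lTensor U ((LinearMap.mulRight k (π x)).rTensor W t) =
        (π : D →ₗ[k] U).rTensor V ((LinearMap.mulRight k x).rTensor V s) := by
      intro x t s hts
      have a1 : j.toLinearMap.lTensor U ((LinearMap.mulRight k (π x)).rTensor W t)
          = (LinearMap.mulRight k (π x)).rTensor V (j.toLinearMap.lTensor U t) := by
        clear hts
        induction t using TensorProduct.induction_on with
        | zero => simp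
        | add s t h h' => simp only [map_add, h, h']
        | tmul x y => simp
      rw [a1, hts]
      clear hts
      induction s using TensorProduct.induction_on with
      | zero => simp
      | add s t h h' => simp only [map_add, h, h']
      | tmul x y => simp
    have := congrArg ((π : D →ₗ[k] U).rTensor V) (h.compat d (j w))
    rw [map_sum, map_sum] at this ⊢
    refine Eq.trans (Finset.sum_congr rfl fun i _ => ?_) (this.trans
      (Finset.sum_congr rfl fun i _ => ?_))
    · exact e1 _ _ _ _ (hcoact w)
    · refine (e2 _ _ _ ?_).symm
      exact (hcoact _).trans (congrArg (fun v => (π : D →ₗ[k] U).rTensor V (coact v)) (hact _ _))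

/-- A homomorphism into `U ⊗ V` with values in `U ⊗ j(W)` lifts to `U ⊗ W`. -/
theorem exists_lift_lTensor (hj : Function.Injective j) (f : W →ₐ[k] U ⊗[k] V) {s : Set W}
    (hs : Algebra.adjoin k s = ⊤) (hf : ∀ w ∈ s, ∃ t, j.toLinearMap.lTensor U t = f w) :
    ∃ c : W →ₗ[k] U ⊗[k] W, ∀ w, j.toLinearMap.lTensor U (c w) = f w := by
  let J : U ⊗[k] W →ₐ[k] U ⊗[k] V := Algebra.TensorProduct.map (AlgHom.id k U) j
  have hJ : Function.Injective J := lTensor_algHom_injective U hj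
  have hr : ∀ w, f w ∈ J.range := by
    intro w
    -- `J` is an algebra homomorphism, so its range is a subalgebra and only the generators have to
    -- be checked.
    have : (⊤ : Subalgebra k W) ≤ J.range.comap f := by
      rw [← hs, Algebra.adjoin_le_iff]
      intro w hw
      exact hf w hw
    exact this trivial
  refine ⟨((AlgEquiv.ofInjective J hJ).symm.toAlgHom.comp (f.codRestrict J.range hr)).toLinearMap,
    fun w => ?_⟩
  exact congrArg Subtype.val ((AlgEquiv.ofInjective J hJ).apply_symm_apply ⟨f w, hr w⟩)

end Descent

/-! ### Spanning the Borel algebras by words times torus elements -/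

namespace BorelDatum
variable {ι P : Type*} [AddCommGroup P] (D : BorelDatum ι P)

theorem K_mul_adjoin (l : P) {n : D.Alg} (hn : n ∈ Algebra.adjoin ℂ (Set.range D.X)) :
    ∃ n' ∈ Algebra.adjoin ℂ (Set.range D.X), D.K l * n = n' * D.K l := by
  induction hn using Algebra.adjoin_induction with
  | mem x hx =>
    obtain ⟨i, rfl⟩ := hx
    exact ⟨D.wt i l • D.X i, Subalgebra.smul_mem _ (Algebra.subset_adjoin (Set.mem_range_self i)) _, by
      rw [K_X, smul_mul_assoc]⟩
  | algebraMap r => exact ⟨_, Subalgebra.algebraMap_mem _ r, (Algebra.commutes r _).symm⟩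
  | add x y _ _ hx hy =>
    obtain ⟨x', hx', ex⟩ := hx
    obtain ⟨y', hy', ey⟩ := hy
    exact ⟨x' + y', add_mem hx' hy', by rw [mul_add, ex, ey, add_mul]⟩
  | mul x y _ _ hx hy =>
    obtain ⟨x', hx', ex⟩ := hx
    obtain ⟨y', hy', ey⟩ := hy
    exact ⟨x' * y', mul_mem hx' hy', by rw [← mul_assoc, ex, mul_assoc, ey, mul_assoc]⟩

/-- The algebra is spanned by the products of words in the `X_i` with the `K_λ`. -/
theorem triangular_induction {p : D.Alg → Prop} (h0 : p 0) (hadd : ∀ x y, p x → p y → p (x + y))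
    (h : ∀ n ∈ Algebra.adjoin ℂ (Set.range D.X), ∀ l, p (n * D.K l)) (x : D.Alg) : p x := by
  let S : Submodule ℂ D.Alg := Submodule.span ℂ
    {y | ∃ n ∈ Algebra.adjoin ℂ (Set.range D.X), ∃ l, y = n * D.K l}
  -- The span is stable under left multiplication by generators, hence by everything. As it contains
  -- `1`, it is the whole algebra.
  have key : ∀ x, ∀ s ∈ S, x * s ∈ S := by
    have red : ∀ x, (∀ n ∈ Algebra.adjoin ℂ (Set.range D.X), ∀ l, x * (n * D.K l) ∈ S) →
        ∀ s ∈ S, x * s ∈ S := by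
      intro x hx s hs
      induction hs using Submodule.span_induction with
      | mem s hs =>
        obtain ⟨n, hn, l, rfl⟩ := hs
        exact hx n hn l
      | zero => simp
      | add s t _ _ hs ht => rw [mul_add]; exact add_mem hs ht
      | smul r s _ hs => rw [mul_smul_comm]; exact S.smul_mem r hs
    intro x
    induction x using D.induction with
    | hK m =>
      refine red _ fun n hn l => ?_
      obtain ⟨n', hn', e⟩ := D.K_mul_adjoin m hn
      exact Submodule.subset_span ⟨n', hn', m + l, by rw [← mul_assoc, e, K_add, mul_assoc]⟩
    | hX i =>
      refine red _ fun n hn l => Submodule.subset_span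
        ⟨D.X i * n, mul_mem (Algebra.subset_adjoin ⟨i, rfl⟩) hn, l, by rw [mul_assoc]⟩
    | hc z =>
      intro s hs
      rw [← Algebra.smul_def]
      exact S.smul_mem z hs
    | hadd a b ha hb => intro s hs; rw [add_mul]; exact add_mem (ha s hs) (hb s hs)
    | hmul a b ha hb => intro s hs; rw [mul_assoc]; exact ha _ (hb s hs)
  have hx : x ∈ S := by
    have h1 : (1 : D.Alg) ∈ S :=
      Submodule.subset_span ⟨1, one_mem _, 0, by rw [K_zero, one_mul]⟩
    simpa using key x 1 h1
  -- Stability of `p` under scalars is not assumed. It is carried along the induction and absorbed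
  -- into the word `n`.
  suffices ∀ r : ℂ, p (r • x) by simpa using this 1
  induction hx using Submodule.span_induction with
  | mem s hs =>
    obtain ⟨n, hn, l, rfl⟩ := hs
    intro r
    rw [← smul_mul_assoc]
    exact h _ (Subalgebra.smul_mem _ hn r) l
  | zero => simpa using h0
  | add s t _ _ hs ht => intro r; rw [smul_add]; exact hadd _ _ (hs r) (ht r)
  | smul r s _ hs => intro r'; rw [smul_smul]; exact hs _

end BorelDatum

/-! ### Relations of generators, and torus homogeneity of the right radical -/

namespace QDatum
variable {ι P : Type*} [AddCommGroup P] (Q : QDatum ι P)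

theorem K_zero : Q.K 0 = 1 := congrArg _ Q.plus.K_zero
theorem K'_zero : Q.K' 0 = 1 := congrArg _ Q.minus.K_zero
theorem K_add (l m : P) : Q.K (l + m) = Q.K l * Q.K m := congrArg _ (Q.plus.K_add l m)
theorem K'_add (l m : P) : Q.K' (l + m) = Q.K' l * Q.K' m := congrArg _ (Q.minus.K_add l m)
theorem K_mul_neg (l : P) : Q.K l * Q.K (-l) = 1 := by rw [← K_add, add_neg_cancel, K_zero]
theorem K_neg_mul (l : P) : Q.K (-l) * Q.K l = 1 := by rw [← K_add, neg_add_cancel, K_zero]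
theorem K'_mul_neg (l : P) : Q.K' l * Q.K' (-l) = 1 := by rw [← K'_add, add_neg_cancel, K'_zero]
theorem K_mul_E (l : P) (i : ι) :
    Q.K l * Q.E i = Q.qpow (Q.form (Q.root i) l) • (Q.E i * Q.K l) :=
  congrArg (Ideal.Quotient.mkₐ ℂ Q.pairing.radL) (Q.plus.K_X l i)
theorem K'_mul_F (l : P) (i : ι) :
    Q.K' l * Q.F i = Q.qpow (-Q.form (Q.root i) l) • (Q.F i * Q.K' l) :=
  congrArg (Ideal.Quotient.mkₐ ℂ Q.pairing.radR) (Q.minus.K_X l i)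

theorem phi_K_K' (l m : P) : Q.phi (Q.K l) (Q.K' m) = Q.qpow (-Q.form l m) := Q.pairing_K_K l m
theorem phi_K_F (l : P) (i : ι) : Q.phi (Q.K l) (Q.F i) = 0 := Q.pairing_K_X l i
theorem phi_E_K' (i : ι) (l : P) : Q.phi (Q.E i) (Q.K' l) = 0 := Q.pairing_X_K i l
theorem phi_E_F (i j : ι) : Q.phi (Q.E i) (Q.F j) = Q.pairEF i j := Q.pairing_X_X i j

theorem comul_E' (i : ι) : comul (R := ℂ) (Q.E i) = Q.E i ⊗ₜ Q.K (-Q.root i) + 1 ⊗ₜ Q.E i := by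
  rw [E, Bialgebra.Quotient.comul_mk, QDatum.comul_E]
  rfl

theorem comul_F (i : ι) : comul (R := ℂ) (Q.F i) = Q.F i ⊗ₜ 1 + Q.K' (Q.root i) ⊗ₜ Q.F i := by
  rw [F, Bialgebra.Quotient.comul_mk, BorelDatum.comul_X, map_add]
  refine congrArg₂ (· + ·) ?_ rfl
  refine Eq.trans ?_ (congrArg (fun z => Q.F i ⊗ₜ[ℂ] z) Q.K'_zero)
  rfl

theorem antipode_E (i : ι) : antipode ℂ (Q.E i) = -(Q.E i * Q.K (Q.root i)) := by
  rw [E, HopfAlgebra.Quotient.antipode_mk, BorelDatum.antipode_X]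
  change -(Q.K (-0) * Q.E i * Q.K (- -Q.root i)) = _
  rw [neg_zero, neg_neg, K_zero, one_mul]
  rfl

theorem antipode_F (i : ι) : antipode ℂ (Q.F i) = -(Q.K' (-Q.root i) * Q.F i) := by
  rw [F, HopfAlgebra.Quotient.antipode_mk, BorelDatum.antipode_X]
  change -(Q.K' (-Q.root i) * Q.F i * Q.K' (-0)) = _
  rw [neg_zero, K'_zero, mul_one]
  rfl

/-- The characters `φ(K_λ, ·)` separate the group-likes `K'_μ`. -/
def IsSeparating : Prop := ∀ m, (∀ l, Q.qpow (-Q.form l m) = 1) → m = 0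

/-- `μ ↦ q^(-(λ, μ))` on the group algebra of `P` -/
def evK (l : P) : AddMonoidAlgebra ℂ P →ₐ[ℂ] ℂ := AddMonoidAlgebra.lift ℂ ℂ P
  { toFun := fun m => Q.qpow (-Q.form l m.toAdd)
    map_one' := by simp [qpow_zero]
    map_mul' := fun m n => by simp [← qpow_add, add_comm] }

theorem evK_single (l m : P) (z : ℂ) :
    Q.evK l (AddMonoidAlgebra.single m z) = z * Q.qpow (-Q.form l m) :=
  AddMonoidAlgebra.lift_single _ _ _

/-- Separation makes `λ ↦ q^(-(λ, μ))` distinct characters of `P` for distinct `μ`, and distinct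
characters are linearly independent. -/
theorem eq_zero_of_evK (hQ : Q.IsSeparating) (x : AddMonoidAlgebra ℂ P)
    (h : ∀ l, Q.evK l x = 0) : x = 0 := by
  let χ : P → (Multiplicative P →* ℂ) := fun m =>
    { toFun := fun l => Q.qpow (-Q.form l.toAdd m)
      map_one' := by simp [qpow_zero]
      map_mul' := fun l n => by simp [← qpow_add, add_comm] }
  have hχ : Function.Injective χ := by
    intro m n hmn
    rw [← sub_eq_zero]
    refine hQ _ fun l => ?_
    have := DFunLike.congr_fun hmn (Multiplicative.ofAdd l)
    change Q.qpow (-Q.form l m) = Q.qpow (-Q.form l n) at this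
    rw [map_sub, neg_sub, sub_eq_add_neg, qpow_add, this, ← qpow_add, add_neg_cancel, qpow_zero]
  have hlin := (linearIndependent_monoidHom (Multiplicative P) ℂ).comp χ hχ
  rw [linearIndependent_iff] at hlin
  apply AddMonoidAlgebra.coeff_injective
  refine hlin x.coeff (funext fun l => ?_)
  refine Eq.trans ?_ (h l.toAdd)
  rw [evK, AddMonoidAlgebra.lift_apply', Finsupp.linearCombination_apply, Finsupp.sum,
    Finset.sum_apply]
  rfl

/-- `F_i ↦ F_i ⊗ 1`, `K'_λ ↦ K'_λ ⊗ [λ]` -/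
def gradedMinus : Q.UTildeMinus →ₐ[ℂ] Q.UMinus ⊗[ℂ] AddMonoidAlgebra ℂ P :=
  Q.minus.lift (fun i => Q.F i ⊗ₜ 1) (fun l => Q.K' l ⊗ₜ AddMonoidAlgebra.single l 1)
    (by rw [K'_zero]; rfl)
    (fun l m => by
      rw [Algebra.TensorProduct.tmul_mul_tmul, K'_add, AddMonoidAlgebra.single_mul_single, one_mul])
    (fun l i => by
      rw [Algebra.TensorProduct.tmul_mul_tmul, Algebra.TensorProduct.tmul_mul_tmul, mul_one,
        one_mul, K'_mul_F, ← TensorProduct.smul_tmul']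
      rfl)

theorem gradedMinus_K (l : P) : Q.gradedMinus (Q.minus.K l) =
    Q.K' l ⊗ₜ AddMonoidAlgebra.single l 1 := Q.minus.lift_K _ _ _ _ _ l
theorem gradedMinus_X (i : ι) : Q.gradedMinus (Q.minus.X i) = Q.F i ⊗ₜ 1 :=
  Q.minus.lift_X _ _ _ _ _ i

/-- The projection onto `U_q^-`, as an algebra homomorphism. -/
def mkMinus : Q.UTildeMinus →ₐ[ℂ] Q.UMinus := Ideal.Quotient.mkₐ ℂ Q.pairing.radR

/-- Specializing the degree variable by `[μ] ↦ q^(-(λ, μ))` amounts to applying the character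
`φ(K_λ, ·)` to the second leg of the coproduct. Both sides are algebra homomorphisms. On `F_i` they
agree because the right-hand group-like in `Δ(F_i)` is `1`, which matches degree zero. -/
theorem evK_gradedMinus (l : P) (y : Q.UTildeMinus) :
    (Algebra.TensorProduct.rid ℂ ℂ Q.UMinus).toAlgHom
      (Algebra.TensorProduct.map (AlgHom.id ℂ Q.UMinus) (Q.evK l) (Q.gradedMinus y)) =
    twR Q.mkMinus (Q.chi l) y := by
  have : ((Algebra.TensorProduct.rid ℂ ℂ Q.UMinus).toAlgHom.comp
      (Algebra.TensorProduct.map (AlgHom.id ℂ Q.UMinus) (Q.evK l))).comp Q.gradedMinus =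
      twR Q.mkMinus (Q.chi l) := by
    refine Q.minus.hom_ext (fun m => ?_) fun i => ?_
    · rw [twR_grouplike _ _ (BorelDatum.comul_K _ m), chi_K]
      simp only [AlgHom.comp_apply, gradedMinus_K, Algebra.TensorProduct.map_tmul, evK_single]
      simp
      rfl
    · rw [twR_skew _ _ (BorelDatum.comul_X _ i), chi_X, chi_K]
      simp only [AlgHom.comp_apply, gradedMinus_X, Algebra.TensorProduct.map_tmul]
      simp [minus, qpow_zero]
      rfl
  exact DFunLike.congr_fun this y

/-- An element of `U_q^- ⊗ ℂ[P]` vanishes if all its pairings with some `a` on the left and a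
specialization `λ` on the right do. For the graded image of `y` this number is `∑ φ(K_λ, y₂) φ(a,
y₁) = φ(K_λ a, y)`, which is zero for `y` in the radical. -/
theorem gradedMinus_eq_zero (hQ : Q.IsSeparating) {y : Q.UTildeMinus} (hy : y ∈ Q.pairing.radR) :
    Q.gradedMinus y = 0 := by
  let g : AddMonoidAlgebra ℂ P →ₗ[ℂ] (P →₀ ℂ) →ₗ[ℂ] ℂ :=
    (Finsupp.linearCombination ℂ (fun l => (Q.evK l).toLinearMap)).flip
  have hg : ∀ x l, g x (Finsupp.single l 1) = Q.evK l x := fun x l => by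
    simp [g]
  have hginj : Function.Injective g := by
    rw [injective_iff_map_eq_zero]
    intro x hx
    refine Q.eq_zero_of_evK hQ x fun l => ?_
    rw [← hg, hx]
    rfl
  refine HopfPairing.eq_zero_of_forall Q.pairing.quotR g Q.pairing.quotR_injective hginj _
    fun a c => ?_
  have key : ∀ l (t : Q.UMinus ⊗[ℂ] AddMonoidAlgebra ℂ P), LinearMap.mul' ℂ ℂ
      (TensorProduct.map (Q.pairing.quotR.flip a) (g.flip (Finsupp.single l 1)) t) =
      Q.pairing.quotR ((Algebra.TensorProduct.rid ℂ ℂ Q.UMinus).toAlgHom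
        (Algebra.TensorProduct.map (AlgHom.id ℂ Q.UMinus) (Q.evK l) t)) a := by
    intro l t
    induction t using TensorProduct.induction_on with
    | zero => simp
    | add s t h h' => simp only [map_add, LinearMap.add_apply, h, h']
    | tmul x y => simp [hg, mul_comm]
  induction c using Finsupp.induction_linear with
  | zero => simp
  | add c d hc hd => simp only [map_add, TensorProduct.map_add_right, LinearMap.add_apply, hc, hd, add_zero]
  | single l z =>
    -- The functionals on the group algebra are combinations of specializations, so a single
    -- specialization suffices.
    have e : Finsupp.single l z = z • Finsupp.single l (1 : ℂ) := by simp
    rw [e, map_smul, TensorProduct.map_smul_right, LinearMap.smul_apply, map_smul, key,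
      evK_gradedMinus]
    have h1 := twR_apply Q.mkMinus (Q.chi l) (Q.pairing.quotR.flip a) y
    have h2 : Q.pairing (Q.plus.K l * a) y = 0 := Q.pairing.mem_radR.1 hy _
    rw [Q.pairing.mul_left' (ℛ ℂ y)] at h2
    rw [(ℛ ℂ y).convMul_apply] at h1
    have h3 : Q.pairing.quotR (twR Q.mkMinus (Q.chi l) y) a = 0 := by
      refine h1.trans (Eq.trans (Finset.sum_congr rfl fun i _ => ?_) h2)
      rw [mul_comm]
      exact congrArg (· * _) (Q.pairMap_K l _).symm
    rw [h3, smul_zero]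

end QDatum

/-! ### The homomorphism from the `q`-boson algebra to the Heisenberg double -/

namespace HopfPairing
variable {k A B : Type*} [CommRing k] [Ring A] [Ring B] [HopfAlgebra k A] [HopfAlgebra k B]
  (φ : HopfPairing k A B)

/-- `a₁ ⊗ a₂ ⊗ b₁ ⊗ b₂ ↦ φ(a₁, b₁) b₂ ♯ a₂` -/
def cross : A ⊗[k] A →ₗ[k] B ⊗[k] B →ₗ[k] φ.Heis :=
  TensorProduct.curry (LinearMap.mul' k φ.Heis ∘ₗ
    TensorProduct.map (scal φ.Heis φ.pairC).ofConv
      (onR A (conv φ.sharpB) * onL B (conv φ.sharpA)).ofConv ∘ₗ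
    (TensorProduct.tensorTensorTensorComm k A A B B).toLinearMap)

theorem cross_tmul (a a' : A) (b b' : B) : φ.cross (a ⊗ₜ a') (b ⊗ₜ b') =
    φ a b • (φ.sharpB b' * φ.sharpA a') := by
  refine Eq.trans (b := scal φ.Heis φ.pairC (a ⊗ₜ b) *
    (onR A (conv φ.sharpB) * onL B (conv φ.sharpA)) (a' ⊗ₜ b')) rfl ?_
  rw [onR_mul_onL, scal_apply, pairC_tmul, ← Algebra.smul_def]
  rfl

/-- The Heisenberg relation as a bilinear expression in `Δ(a)` and `Δ(b)`, into which the explicit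
coproducts of generators can be substituted. -/
theorem sharpA_mul_sharpB (a : A) (b : B) :
    φ.sharpA a * φ.sharpB b = φ.cross (comul a) (comul b) := by
  refine (φ.heis_mul a 1 1 b).trans ?_
  conv_rhs => rw [← (ℛ k a).eq, ← (ℛ k b).eq]
  simp only [map_sum, LinearMap.sum_apply, cross_tmul, sharpB_mul_sharpA, one_mul, mul_one]
  exact Finset.sum_comm

theorem mul_left_comul (a a' : A) (b : B) : φ (a * a') b =
    TensorProduct.lift ((LinearMap.mul k k).compl₁₂ (φ.toFun a') (φ.toFun a)) (comul b) := by
  rw [φ.mul_left, ← repr_sum (ℛ k b)]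
  exact Finset.sum_congr rfl fun i _ => mul_comm _ _

end HopfPairing

namespace QDatum
variable {ι P : Type*} [AddCommGroup P] (Q : QDatum ι P)

/-- The factor `K_{α_i}` cancels the `K_{-α_i}` in the second leg of `Δ(E_i)`. The second legs are
now `1` and `E'_i`, so the coaction can stay inside the Weyl algebra. -/
theorem comul_qE (i : ι) : comul (R := ℂ) (Q.E' i) = Q.E' i ⊗ₜ 1 + Q.K (Q.root i) ⊗ₜ Q.E' i := by
  rw [E', map_smul, Bialgebra.comul_mul, comul_E', comul_K, mul_add,
    Algebra.TensorProduct.tmul_mul_tmul, Algebra.TensorProduct.tmul_mul_tmul, K_mul_neg, mul_one,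
    smul_add, ← TensorProduct.smul_tmul', TensorProduct.tmul_smul]

theorem K_mul_E' (l : P) (i : ι) :
    Q.K l * Q.E' i = Q.qpow (Q.form (Q.root i) l) • (Q.E' i * Q.K l) := by
  have h : Q.K l * Q.K (Q.root i) = Q.K (Q.root i) * Q.K l := by rw [← K_add, add_comm, K_add]
  rw [E', mul_smul_comm, ← mul_assoc, h, mul_assoc, K_mul_E, mul_smul_comm, smul_mul_assoc,
    mul_assoc, smul_comm]

theorem sharpA_K_mul_sharpB_F (l : P) (i : ι) : Q.phi.sharpA (Q.K l) * Q.phi.sharpB (Q.F i) =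
    Q.qpow (-Q.form (Q.root i) l) • (Q.phi.sharpB (Q.F i) * Q.phi.sharpA (Q.K l)) := by
  rw [HopfPairing.sharpA_mul_sharpB, comul_K, comul_F, map_add, HopfPairing.cross_tmul,
    HopfPairing.cross_tmul, phi_K_F, phi_K_K', zero_smul, zero_add, Q.symm]

theorem sharpA_K_mul_sharpB_K' (l m : P) : Q.phi.sharpA (Q.K l) * Q.phi.sharpB (Q.K' m) =
    Q.qpow (-Q.form l m) • (Q.phi.sharpB (Q.K' m) * Q.phi.sharpA (Q.K l)) := by
  rw [HopfPairing.sharpA_mul_sharpB, comul_K, comul_K', HopfPairing.cross_tmul, phi_K_K']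

theorem sharpA_E_mul_sharpB_K' (i : ι) (m : P) : Q.phi.sharpA (Q.E i) * Q.phi.sharpB (Q.K' m) =
    Q.phi.sharpB (Q.K' m) * Q.phi.sharpA (Q.E i) := by
  rw [HopfPairing.sharpA_mul_sharpB, comul_E', comul_K', map_add, LinearMap.add_apply,
    HopfPairing.cross_tmul, HopfPairing.cross_tmul, phi_E_K', zero_smul, zero_add,
    HopfPairing.one_left, counit_K', one_smul]

/-- All the `q_i⁻¹ - q_i` are nonzero. -/
def IsGeneric : Prop := ∀ i, (Q.qi i)⁻¹ - Q.qi i ≠ 0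

/-- The scalar `q_i⁻¹ - q_i` in `E'_i` is chosen to cancel the denominator of `φ(E_i, F_i)`. -/
theorem phi_qE_F (hc : Q.IsGeneric) (i j : ι) [Decidable (i = j)] :
    Q.phi (Q.E' i) (Q.F j) = if i = j then 1 else 0 := by
  rw [E', map_smul, LinearMap.smul_apply, HopfPairing.mul_left_comul, comul_F, map_add,
    TensorProduct.lift.tmul, TensorProduct.lift.tmul]
  simp only [LinearMap.compl₁₂_apply, LinearMap.mul_apply', phi_E_F, phi_E_K', zero_mul, add_zero,
    HopfPairing.one_right, counit_K, mul_one, pairEF]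
  have := hc i
  split_ifs
  · rw [smul_eq_mul, mul_one_div_cancel this]
  · simp

theorem phi_qE_K' (i : ι) (m : P) : Q.phi (Q.E' i) (Q.K' m) = 0 := by
  rw [E', map_smul, LinearMap.smul_apply, HopfPairing.mul_left_comul, comul_K',
    TensorProduct.lift.tmul]
  simp [phi_E_K']

/-- Of the four terms obtained from the two coproducts, those with `φ(E'_i, K'_{α_j})` and
`φ(K_{α_i}, F_j)` vanish. The other two are the right-hand side. -/
theorem sharpA_qE_mul_sharpB_F (hc : Q.IsGeneric) (i j : ι) [Decidable (i = j)] :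
    Q.phi.sharpA (Q.E' i) * Q.phi.sharpB (Q.F j) =
    Q.qpow (-Q.form (Q.root i) (Q.root j)) • (Q.phi.sharpB (Q.F j) * Q.phi.sharpA (Q.E' i)) +
      if i = j then 1 else 0 := by
  rw [HopfPairing.sharpA_mul_sharpB, comul_qE, comul_F]
  simp only [map_add, LinearMap.add_apply, HopfPairing.cross_tmul]
  rw [phi_K_F, phi_K_K', phi_qE_K', Q.phi_qE_F hc, zero_smul, zero_smul, map_one, map_one, mul_one]
  split_ifs <;> simp [add_comm]

/-- `F_i ↦ F_i ♯ 1`, `K'_λ ↦ 1 ♯ K_λ` -/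
def minusToHei : Q.UTildeMinus →ₐ[ℂ] Q.Hei :=
  Q.minus.lift (fun i => Q.phi.sharpB (Q.F i)) (fun l => Q.phi.sharpA (Q.K l))
    (by rw [K_zero, map_one]) (fun l m => by rw [K_add, map_mul])
    (fun l i => Q.sharpA_K_mul_sharpB_F l i)

theorem minusToHei_K (l : P) : Q.minusToHei (Q.minus.K l) = Q.phi.sharpA (Q.K l) :=
  Q.minus.lift_K _ _ _ _ _ l
theorem minusToHei_X (i : ι) : Q.minusToHei (Q.minus.X i) = Q.phi.sharpB (Q.F i) :=
  Q.minus.lift_X _ _ _ _ _ i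

/-- `y ⊗ [λ] ↦ y K'_{-λ} ♯ K_λ` -/
def untwist : Q.UMinus ⊗[ℂ] AddMonoidAlgebra ℂ P →ₗ[ℂ] Q.Hei :=
  TensorProduct.lift (Finsupp.linearCombination ℂ (fun l =>
    LinearMap.mulRight ℂ (Q.phi.sharpA (Q.K l)) ∘ₗ Q.phi.sharpB.toLinearMap ∘ₗ
      LinearMap.mulRight ℂ (Q.K' (-l))) ∘ₗ
    (AddMonoidAlgebra.coeffLinearEquiv ℂ).toLinearMap).flip

theorem untwist_single (y : Q.UMinus) (l : P) :
    Q.untwist (y ⊗ₜ AddMonoidAlgebra.single l 1) =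
      Q.phi.sharpB (y * Q.K' (-l)) * Q.phi.sharpA (Q.K l) := by
  simp [untwist]

theorem adjoin_X_eq {R : Type*} [Ring R] [Algebra ℂ R] {D : BorelDatum ι P} (f g : D.Alg →ₐ[ℂ] R)
    (h : ∀ i, f (D.X i) = g (D.X i)) {n : D.Alg} (hn : n ∈ Algebra.adjoin ℂ (Set.range D.X)) :
    f n = g n := by
  have : Algebra.adjoin ℂ (Set.range D.X) ≤ AlgHom.equalizer f g :=
    Algebra.adjoin_le (by rintro _ ⟨i, rfl⟩; exact h i)
  exact this hn

theorem minusToHei_adjoin {n : Q.UTildeMinus} (hn : n ∈ Algebra.adjoin ℂ (Set.range Q.minus.X)) :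
    Q.minusToHei n = Q.phi.sharpB (Q.mkMinus n) :=
  adjoin_X_eq Q.minusToHei (Q.phi.sharpB.comp Q.mkMinus) (fun i => Q.minusToHei_X i) hn

/-- On `n K'_λ`, with `n` in the subalgebra of the `F_i`, the degree `[λ]` remembers which `K'_{-λ}`
removes the old torus part and which `K_λ` replaces it. -/
theorem minusToHei_eq (y : Q.UTildeMinus) : Q.minusToHei y = Q.untwist (Q.gradedMinus y) := by
  induction y using Q.minus.triangular_induction with
  | h0 => simp
  | hadd x y hx hy => simp only [map_add, hx, hy]
  | h n hn l =>
    have h : Q.gradedMinus n = Q.mkMinus n ⊗ₜ 1 :=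
      adjoin_X_eq Q.gradedMinus (Algebra.TensorProduct.includeLeft.comp Q.mkMinus)
        (fun i => Q.gradedMinus_X i) hn
    rw [map_mul, map_mul, minusToHei_adjoin Q hn, h, minusToHei_K, gradedMinus_K,
      Algebra.TensorProduct.tmul_mul_tmul, one_mul, untwist_single, mul_assoc (Q.mkMinus n),
      K'_mul_neg, mul_one]

/-- The relations of `U_q^-` survive when `K'_λ` is replaced by `1 ♯ K_λ`. This is the point that is
not formal, since the embedding `b ↦ b ♯ 1` sends `K'_λ` elsewhere. -/
theorem minusToHei_eq_zero (hQ : Q.IsSeparating) {y : Q.UTildeMinus} (hy : y ∈ Q.pairing.radR) :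
    Q.minusToHei y = 0 := by
  rw [minusToHei_eq, Q.gradedMinus_eq_zero hQ hy, map_zero]

/-- `e_i ↦ 1 ♯ E_i`, `f_i ↦ F_i ♯ 1`, `t_λ ↦ 1 ♯ K_λ` on the free algebra -/
def freeToHei : FreeAlgebra ℂ (BGen ι P) →ₐ[ℂ] Q.Hei :=
  FreeAlgebra.lift ℂ fun x => match x with
    | .e i => Q.phi.sharpA (Q.E i)
    | .f i => Q.phi.sharpB (Q.F i)
    | .t l => Q.phi.sharpA (Q.K l)

theorem freeToHei_e (i : ι) : Q.freeToHei (FreeAlgebra.ι ℂ (.e i)) = Q.phi.sharpA (Q.E i) :=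
  FreeAlgebra.lift_ι_apply _ _
theorem freeToHei_f (i : ι) : Q.freeToHei (FreeAlgebra.ι ℂ (.f i)) = Q.phi.sharpB (Q.F i) :=
  FreeAlgebra.lift_ι_apply _ _
theorem freeToHei_t (l : P) : Q.freeToHei (FreeAlgebra.ι ℂ (.t l)) = Q.phi.sharpA (Q.K l) :=
  FreeAlgebra.lift_ι_apply _ _

theorem freeToHei_freeE' (i : ι) : Q.freeToHei (Q.freeE' i) = Q.phi.sharpA (Q.E' i) := by
  rw [freeE', E', map_smul, map_mul, freeToHei_e, freeToHei_t, map_smul, map_mul]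

/-- The projection onto `U_q^+`, as an algebra homomorphism. -/
def mkPlus : Q.UTildePlus →ₐ[ℂ] Q.UPlus := Ideal.Quotient.mkₐ ℂ Q.pairing.radL

open scoped Classical in
/-- The algebra homomorphism `B_q → H` with `e_i ↦ 1 ♯ E_i`, `f_i ↦ F_i ♯ 1`, `t_λ ↦ 1 ♯ K_λ`. -/
def bosonToHei (hQ : Q.IsSeparating) (hc : Q.IsGeneric) : Q.Bq →ₐ[ℂ] Q.Hei :=
  RingQuot.liftAlgHom ℂ ⟨Q.freeToHei, by
    intro x y h
    induction h with
    | pos x hx =>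
      have e : Q.freeToHei.comp freePos = (Q.phi.sharpA.comp Q.mkPlus).comp Q.plus.ofFree := by
        ext (i | l)
        · exact (congrArg Q.freeToHei (FreeAlgebra.lift_ι_apply _ _)).trans (Q.freeToHei_e i)
        · exact (congrArg Q.freeToHei (FreeAlgebra.lift_ι_apply _ _)).trans (Q.freeToHei_t l)
      rw [map_zero]
      exact (DFunLike.congr_fun e x).trans ((congrArg Q.phi.sharpA hx).trans (map_zero _))
    | neg x hx =>
      have e : Q.freeToHei.comp freeNeg = Q.minusToHei.comp Q.minus.ofFree := by
        ext (i | l)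
        · exact (congrArg Q.freeToHei (FreeAlgebra.lift_ι_apply _ _)).trans
            ((Q.freeToHei_f i).trans (Q.minusToHei_X i).symm)
        · exact (congrArg Q.freeToHei (FreeAlgebra.lift_ι_apply _ _)).trans
            ((Q.freeToHei_t l).trans (Q.minusToHei_K l).symm)
      rw [map_zero]
      exact (DFunLike.congr_fun e x).trans
        (Q.minusToHei_eq_zero hQ (Ideal.Quotient.eq_zero_iff_mem.1 hx))
    | cross i j =>
      rw [map_mul, map_add, map_smul, map_mul, freeToHei_freeE', freeToHei_f,
        Q.sharpA_qE_mul_sharpB_F hc]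
      congr 1
      split_ifs <;> simp⟩

theorem bosonToHei_toBq (hQ : Q.IsSeparating) (hc : Q.IsGeneric) (x : FreeAlgebra ℂ (BGen ι P)) :
    Q.bosonToHei hQ hc (Q.toBq x) = Q.freeToHei x :=
  RingQuot.liftAlgHom_mkAlgHom_apply ℂ _ _ _

end QDatum

theorem BorelDatum.ofFree_surjective {ι P : Type*} [AddCommGroup P] (D : BorelDatum ι P) :
    Function.Surjective D.ofFree := RingQuot.mkAlgHom_surjective ℂ _

/-! ### Normal forms in the `q`-boson algebra and injectivity -/

namespace QDatum
variable {ι P : Type*} [AddCommGroup P] (Q : QDatum ι P)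

theorem toBq_surjective : Function.Surjective Q.toBq := RingQuot.mkAlgHom_surjective ℂ _

/-- `e_i ∈ B_q` -/
def be (i : ι) : Q.Bq := Q.toBq (FreeAlgebra.ι ℂ (.e i))
/-- `t_λ ∈ B_q` -/
def bt (l : P) : Q.Bq := Q.toBq (FreeAlgebra.ι ℂ (.t l))

theorem toBq_freePos_inl (i : ι) : Q.toBq (freePos (FreeAlgebra.ι ℂ (.inl i))) = Q.be i :=
  congrArg Q.toBq (FreeAlgebra.lift_ι_apply _ _)
theorem toBq_freePos_inr (l : P) : Q.toBq (freePos (FreeAlgebra.ι ℂ (.inr l))) = Q.bt l :=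
  congrArg Q.toBq (FreeAlgebra.lift_ι_apply _ _)
theorem toBq_freeNeg_inl (i : ι) : Q.toBq (freeNeg (FreeAlgebra.ι ℂ (.inl i))) = Q.bf i :=
  congrArg Q.toBq (FreeAlgebra.lift_ι_apply _ _)
theorem toBq_freeNeg_inr (l : P) : Q.toBq (freeNeg (FreeAlgebra.ι ℂ (.inr l))) = Q.bt l :=
  congrArg Q.toBq (FreeAlgebra.lift_ι_apply _ _)

theorem toBq_freePos_eq_zero {x : FreeAlgebra ℂ (ι ⊕ P)} (h : Q.plus.ofFree x ∈ Q.pairing.radL) :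
    Q.toBq (freePos x) = 0 :=
  (RingQuot.mkAlgHom_rel ℂ (BRel.pos x (Ideal.Quotient.eq_zero_iff_mem.2 h))).trans (map_zero _)

theorem toBq_freeNeg_eq_zero {x : FreeAlgebra ℂ (ι ⊕ P)} (h : Q.minus.ofFree x ∈ Q.pairing.radR) :
    Q.toBq (freeNeg x) = 0 :=
  (RingQuot.mkAlgHom_rel ℂ (BRel.neg x (Ideal.Quotient.eq_zero_iff_mem.2 h))).trans (map_zero _)

theorem toBq_freePos_eq {x y : FreeAlgebra ℂ (ι ⊕ P)} (h : Q.plus.ofFree x = Q.plus.ofFree y) :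
    Q.toBq (freePos x) = Q.toBq (freePos y) := by
  rw [← sub_eq_zero, ← map_sub, ← map_sub]
  exact Q.toBq_freePos_eq_zero (by rw [map_sub, h, sub_self]; exact zero_mem _)

theorem toBq_freeNeg_eq {x y : FreeAlgebra ℂ (ι ⊕ P)} (h : Q.minus.ofFree x = Q.minus.ofFree y) :
    Q.toBq (freeNeg x) = Q.toBq (freeNeg y) := by
  rw [← sub_eq_zero, ← map_sub, ← map_sub]
  exact Q.toBq_freeNeg_eq_zero (by rw [map_sub, h, sub_self]; exact zero_mem _)

theorem bt_zero : Q.bt 0 = 1 := by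
  rw [← toBq_freePos_inr, ← map_one (Q.toBq.comp freePos)]
  exact Q.toBq_freePos_eq (Q.plus.K_zero.trans (map_one _).symm)

theorem bt_add (l m : P) : Q.bt (l + m) = Q.bt l * Q.bt m := by
  simp only [← toBq_freePos_inr]
  rw [← map_mul, ← map_mul]
  exact Q.toBq_freePos_eq ((Q.plus.K_add l m).trans (map_mul _ _ _).symm)

theorem bt_be (l : P) (i : ι) : Q.bt l * Q.be i = Q.plus.wt i l • (Q.be i * Q.bt l) := by
  simp only [← toBq_freePos_inr, ← toBq_freePos_inl]
  rw [← map_mul, ← map_mul, ← map_mul, ← map_mul, ← map_smul, ← map_smul]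
  exact Q.toBq_freePos_eq (by rw [map_smul, map_mul, map_mul]; exact Q.plus.K_X l i)

theorem bt_bf (l : P) (i : ι) : Q.bt l * Q.bf i = Q.minus.wt i l • (Q.bf i * Q.bt l) := by
  simp only [← toBq_freeNeg_inr, ← toBq_freeNeg_inl]
  rw [← map_mul, ← map_mul, ← map_mul, ← map_mul, ← map_smul, ← map_smul]
  exact Q.toBq_freeNeg_eq (by rw [map_smul, map_mul, map_mul]; exact Q.minus.K_X l i)

/-- `E_i ↦ e_i`, `K_λ ↦ t_λ` -/
def tildePlusToBq : Q.UTildePlus →ₐ[ℂ] Q.Bq :=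
  Q.plus.lift Q.be Q.bt Q.bt_zero Q.bt_add Q.bt_be
/-- `F_i ↦ f_i`, `K'_λ ↦ t_λ` -/
def tildeMinusToBq : Q.UTildeMinus →ₐ[ℂ] Q.Bq :=
  Q.minus.lift Q.bf Q.bt Q.bt_zero Q.bt_add Q.bt_bf

theorem tildePlusToBq_X (i : ι) : Q.tildePlusToBq (Q.plus.X i) = Q.be i :=
  Q.plus.lift_X _ _ _ _ _ i
theorem tildePlusToBq_K (l : P) : Q.tildePlusToBq (Q.plus.K l) = Q.bt l :=
  Q.plus.lift_K _ _ _ _ _ l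
theorem tildeMinusToBq_X (i : ι) : Q.tildeMinusToBq (Q.minus.X i) = Q.bf i :=
  Q.minus.lift_X _ _ _ _ _ i
theorem tildeMinusToBq_K (l : P) : Q.tildeMinusToBq (Q.minus.K l) = Q.bt l :=
  Q.minus.lift_K _ _ _ _ _ l

theorem tildePlusToBq_ofFree (x : FreeAlgebra ℂ (ι ⊕ P)) :
    Q.tildePlusToBq (Q.plus.ofFree x) = Q.toBq (freePos x) := by
  suffices Q.tildePlusToBq.comp Q.plus.ofFree = Q.toBq.comp freePos from DFunLike.congr_fun this x
  ext (i | l)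
  · exact (Q.tildePlusToBq_X i).trans (Q.toBq_freePos_inl i).symm
  · exact (Q.tildePlusToBq_K l).trans (Q.toBq_freePos_inr l).symm

theorem tildeMinusToBq_ofFree (x : FreeAlgebra ℂ (ι ⊕ P)) :
    Q.tildeMinusToBq (Q.minus.ofFree x) = Q.toBq (freeNeg x) := by
  suffices Q.tildeMinusToBq.comp Q.minus.ofFree = Q.toBq.comp freeNeg from DFunLike.congr_fun this x
  ext (i | l)
  · exact (Q.tildeMinusToBq_X i).trans (Q.toBq_freeNeg_inl i).symm
  · exact (Q.tildeMinusToBq_K l).trans (Q.toBq_freeNeg_inr l).symm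

/-- The map `U_q^+ → B_q` -/
def plusToBq : Q.UPlus →ₐ[ℂ] Q.Bq :=
  Ideal.Quotient.liftₐ Q.pairing.radL Q.tildePlusToBq fun x hx => by
    obtain ⟨y, rfl⟩ := Q.plus.ofFree_surjective x
    rw [tildePlusToBq_ofFree, Q.toBq_freePos_eq_zero hx]

/-- The map `U_q^- → B_q` -/
def minusToBq : Q.UMinus →ₐ[ℂ] Q.Bq :=
  Ideal.Quotient.liftₐ Q.pairing.radR Q.tildeMinusToBq fun x hx => by
    obtain ⟨y, rfl⟩ := Q.minus.ofFree_surjective x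
    rw [tildeMinusToBq_ofFree, Q.toBq_freeNeg_eq_zero hx]

theorem be'_eq (i : ι) : Q.be' i = ((Q.qi i)⁻¹ - Q.qi i) • (Q.bt (Q.root i) * Q.be i) := by
  rw [be', freeE', map_smul, map_mul]
  rfl

theorem be'_eq_tildePlusToBq (i : ι) : Q.be' i =
    Q.tildePlusToBq (((Q.qi i)⁻¹ - Q.qi i) • (Q.plus.K (Q.root i) * Q.plus.X i)) := by
  rw [be'_eq, map_smul, map_mul, tildePlusToBq_K, tildePlusToBq_X]

theorem be_eq (hc : Q.IsGeneric) (i : ι) :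
    Q.be i = ((Q.qi i)⁻¹ - Q.qi i)⁻¹ • (Q.bt (-Q.root i) * Q.be' i) := by
  rw [be'_eq, mul_smul_comm, smul_smul, inv_mul_cancel₀ (hc i), one_smul, ← mul_assoc, ← bt_add,
    neg_add_cancel, bt_zero, one_mul]

open scoped Classical in
theorem be'_mul_bf (i j : ι) : Q.be' i * Q.bf j =
    Q.qpow (-Q.form (Q.root i) (Q.root j)) • (Q.bf j * Q.be' i) + if i = j then 1 else 0 := by
  have h := RingQuot.mkAlgHom_rel ℂ (BRel.cross (Q := Q) i j)
  change Q.toBq _ = Q.toBq _ at h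
  rw [map_mul, map_add, map_smul, map_mul] at h
  refine h.trans (congrArg _ ?_)
  split_ifs
  · exact map_one _
  · exact map_zero _

/-- `e'_i` acts on words in the `f_j` as a skew derivation: moving it to the right twists the word
and leaves a remainder, and both are again free of the torus. -/
theorem be'_mul_adjoin (i : ι) {n : Q.UTildeMinus}
    (hn : n ∈ Algebra.adjoin ℂ (Set.range Q.minus.X)) :
    ∃ n' ∈ Algebra.adjoin ℂ (Set.range Q.minus.X), ∃ m ∈ Algebra.adjoin ℂ (Set.range Q.minus.X),
      Q.be' i * Q.tildeMinusToBq n = Q.tildeMinusToBq m + Q.tildeMinusToBq n' * Q.be' i := by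
  induction hn using Algebra.adjoin_induction with
  | mem x hx =>
    obtain ⟨j, rfl⟩ := hx
    classical
    refine ⟨Q.qpow (-Q.form (Q.root i) (Q.root j)) • Q.minus.X j,
      Subalgebra.smul_mem _ (Algebra.subset_adjoin (Set.mem_range_self j)) _, if i = j then 1 else 0, ?_, ?_⟩
    · split_ifs
      · exact one_mem _
      · exact zero_mem _
    · rw [tildeMinusToBq_X, be'_mul_bf, map_smul, tildeMinusToBq_X, smul_mul_assoc, add_comm]
      congr 1
      split_ifs
      · exact (map_one _).symm
      · exact (map_zero _).symm
  | algebraMap r =>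
    exact ⟨_, Subalgebra.algebraMap_mem _ r, 0, zero_mem _, by
      rw [map_zero, zero_add, AlgHom.commutes]; exact (Algebra.commutes r _).symm⟩
  | add x y _ _ hx hy =>
    obtain ⟨x', hx', x'', hx'', ex⟩ := hx
    obtain ⟨y', hy', y'', hy'', ey⟩ := hy
    refine ⟨x' + y', add_mem hx' hy', x'' + y'', add_mem hx'' hy'', ?_⟩
    simp only [map_add, mul_add, add_mul, ex, ey]
    abel
  | mul x y hxm hym hx hy =>
    obtain ⟨x', hx', x'', hx'', ex⟩ := hx
    obtain ⟨y', hy', y'', hy'', ey⟩ := hy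
    -- The skew Leibniz rule: the remainder of `x y` is the remainder of `x` times `y`, plus the
    -- twisted `x` times the remainder of `y`.
    refine ⟨x' * y', mul_mem hx' hy', x'' * y + x' * y'',
      add_mem (mul_mem hx'' hym) (mul_mem hx' hy''), ?_⟩
    rw [map_mul, ← mul_assoc, ex, add_mul, mul_assoc _ (Q.be' i), ey, mul_add, map_add, map_mul,
      map_mul, map_mul, add_assoc, mul_assoc _ _ (Q.be' i)]

/-- The span of the products of words in the `f_i` with elements of the image of `U_q^+`. -/
def normalForms : Submodule ℂ Q.Bq := Submodule.span ℂ
  {w | ∃ n ∈ Algebra.adjoin ℂ (Set.range Q.minus.X), ∃ a,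
    w = Q.tildeMinusToBq n * Q.tildePlusToBq a}

theorem mul_mem_normalForms (x : Q.Bq)
    (hx : ∀ n ∈ Algebra.adjoin ℂ (Set.range Q.minus.X), ∀ a,
      x * (Q.tildeMinusToBq n * Q.tildePlusToBq a) ∈ Q.normalForms) :
    ∀ s ∈ Q.normalForms, x * s ∈ Q.normalForms := by
  intro s hs
  induction hs using Submodule.span_induction with
  | mem s hs =>
    obtain ⟨n, hn, a, rfl⟩ := hs
    exact hx n hn a
  | zero => simp
  | add s t _ _ hs ht => rw [mul_add]; exact add_mem hs ht
  | smul r s _ hs => rw [mul_smul_comm]; exact Submodule.smul_mem _ r hs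

theorem bt_mul_mem_normalForms (l : P) : ∀ s ∈ Q.normalForms, Q.bt l * s ∈ Q.normalForms := by
  refine Q.mul_mem_normalForms _ fun n hn a => ?_
  obtain ⟨n', hn', e⟩ := Q.minus.K_mul_adjoin l hn
  refine Submodule.subset_span ⟨n', hn', Q.plus.K l * a, ?_⟩
  rw [← mul_assoc, ← tildeMinusToBq_K, ← map_mul, e, map_mul, map_mul, tildeMinusToBq_K,
    tildePlusToBq_K, mul_assoc]

theorem be'_mul_mem_normalForms (i : ι) :
    ∀ s ∈ Q.normalForms, Q.be' i * s ∈ Q.normalForms := by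
  refine Q.mul_mem_normalForms _ fun n hn a => ?_
  obtain ⟨n', hn', m, hm, e⟩ := Q.be'_mul_adjoin i hn
  rw [← mul_assoc, e, add_mul, mul_assoc]
  refine add_mem (Submodule.subset_span ⟨m, hm, a, rfl⟩)
    (Submodule.subset_span ⟨n', hn',
      ((Q.qi i)⁻¹ - Q.qi i) • (Q.plus.K (Q.root i) * Q.plus.X i) * a, ?_⟩)
  rw [be'_eq_tildePlusToBq, map_mul]

/-- The span contains `1` and is stable under left multiplication by generators. The generator `e_i`
is treated as a multiple of `t_{-α_i} e'_i`, because the defining cross relation moves `e'_i`, not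
`e_i`, past the `f_j`. -/
theorem mem_normalForms (hc : Q.IsGeneric) (w : Q.Bq) : w ∈ Q.normalForms := by
  suffices ∀ x, ∀ s ∈ Q.normalForms, Q.toBq x * s ∈ Q.normalForms by
    obtain ⟨x, rfl⟩ := Q.toBq_surjective w
    have h1 : (1 : Q.Bq) ∈ Q.normalForms :=
      Submodule.subset_span ⟨1, one_mem _, 1, by rw [map_one, map_one, mul_one]⟩
    simpa using this x 1 h1
  intro x
  induction x using FreeAlgebra.induction with
  | grade0 r =>
    intro s hs
    rw [AlgHom.commutes, ← Algebra.smul_def]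
    exact Submodule.smul_mem _ r hs
  | grade1 x =>
    cases x with
    | e i =>
      intro s hs
      change Q.be i * s ∈ _
      rw [Q.be_eq hc, smul_mul_assoc, mul_assoc]
      exact Submodule.smul_mem _ _
        (Q.bt_mul_mem_normalForms _ _ (Q.be'_mul_mem_normalForms i s hs))
    | f i =>
      refine Q.mul_mem_normalForms _ fun n hn a => Submodule.subset_span
        ⟨Q.minus.X i * n, mul_mem (Algebra.subset_adjoin ⟨i, rfl⟩) hn, a, ?_⟩
      rw [map_mul, tildeMinusToBq_X, mul_assoc]
      rfl
    | t l => exact Q.bt_mul_mem_normalForms l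
  | mul x y hx hy => intro s hs; rw [map_mul, mul_assoc]; exact hx _ (hy s hs)
  | add x y hx hy => intro s hs; rw [map_add, add_mul]; exact add_mem (hx s hs) (hy s hs)

/-- `b ♯ a ↦ b a` -/
def heiToBq : Q.Hei →ₗ[ℂ] Q.Bq :=
  TensorProduct.lift ((LinearMap.mul ℂ Q.Bq).compl₁₂ Q.minusToBq.toLinearMap Q.plusToBq.toLinearMap)

theorem heiToBq_sharp (b : Q.UMinus) (a : Q.UPlus) :
    Q.heiToBq (Q.phi.sharp b a) = Q.minusToBq b * Q.plusToBq a := TensorProduct.lift.tmul _ _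

theorem bosonToHei_tildePlus (hQ : Q.IsSeparating) (hc : Q.IsGeneric) (x : Q.UTildePlus) :
    Q.bosonToHei hQ hc (Q.tildePlusToBq x) = Q.phi.sharpA (Q.mkPlus x) := by
  suffices (Q.bosonToHei hQ hc).comp Q.tildePlusToBq = Q.phi.sharpA.comp Q.mkPlus from
    DFunLike.congr_fun this x
  refine Q.plus.hom_ext (fun l => ?_) (fun i => ?_)
  · exact (congrArg _ (Q.tildePlusToBq_K l)).trans
      ((Q.bosonToHei_toBq hQ hc _).trans (Q.freeToHei_t l))
  · exact (congrArg _ (Q.tildePlusToBq_X i)).trans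
      ((Q.bosonToHei_toBq hQ hc _).trans (Q.freeToHei_e i))

/-- The restriction to words in the `F_i` is essential. On `K'_λ` the left side is `1 ♯ K_λ`, while
the right side is `K'_λ ♯ 1`. -/
theorem bosonToHei_tildeMinus (hQ : Q.IsSeparating) (hc : Q.IsGeneric) {n : Q.UTildeMinus}
    (hn : n ∈ Algebra.adjoin ℂ (Set.range Q.minus.X)) :
    Q.bosonToHei hQ hc (Q.tildeMinusToBq n) = Q.phi.sharpB (Q.mkMinus n) :=
  adjoin_X_eq ((Q.bosonToHei hQ hc).comp Q.tildeMinusToBq) (Q.phi.sharpB.comp Q.mkMinus)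
    (fun i => (congrArg _ (Q.tildeMinusToBq_X i)).trans
      ((Q.bosonToHei_toBq hQ hc _).trans (Q.freeToHei_f i))) hn

/-- A normal form, a word `n` times `a`, goes to `n ♯ a`, and multiplying out in `B_q` recovers it.
A linear left inverse is all that injectivity requires. -/
theorem heiToBq_bosonToHei (hQ : Q.IsSeparating) (hc : Q.IsGeneric) (w : Q.Bq) :
    Q.heiToBq (Q.bosonToHei hQ hc w) = w := by
  have hw := Q.mem_normalForms hc w
  induction hw using Submodule.span_induction with
  | mem s hs =>
    obtain ⟨n, hn, a, rfl⟩ := hs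
    rw [map_mul, Q.bosonToHei_tildeMinus hQ hc hn, bosonToHei_tildePlus,
      HopfPairing.sharpB_mul_sharpA, heiToBq_sharp]
    rfl
  | zero => simp
  | add s t _ _ hs ht => rw [map_add, map_add, hs, ht]
  | smul r s _ hs => rw [map_smul, map_smul, hs]

theorem bosonToHei_injective (hQ : Q.IsSeparating) (hc : Q.IsGeneric) :
    Function.Injective (Q.bosonToHei hQ hc) :=
  Function.LeftInverse.injective (Q.heiToBq_bosonToHei hQ hc)

/-- The embedding of the quantized Weyl algebra into the Heisenberg double. -/
def weylToHei (hQ : Q.IsSeparating) (hc : Q.IsGeneric) : Q.Wq →ₐ[ℂ] Q.Hei :=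
  (Q.bosonToHei hQ hc).comp Q.Wq.val

theorem weylToHei_injective (hQ : Q.IsSeparating) (hc : Q.IsGeneric) :
    Function.Injective (Q.weylToHei hQ hc) :=
  (Q.bosonToHei_injective hQ hc).comp Subtype.val_injective

theorem weylToHei_we' (hQ : Q.IsSeparating) (hc : Q.IsGeneric) (i : ι) :
    Q.weylToHei hQ hc (Q.we' i) = Q.phi.sharpA (Q.E' i) :=
  (Q.bosonToHei_toBq hQ hc _).trans (Q.freeToHei_freeE' i)

theorem weylToHei_wf (hQ : Q.IsSeparating) (hc : Q.IsGeneric) (i : ι) :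
    Q.weylToHei hQ hc (Q.wf i) = Q.phi.sharpB (Q.F i) :=
  (Q.bosonToHei_toBq hQ hc _).trans (Q.freeToHei_f i)

end QDatum

/-! ### Restricting the action and the coaction to the Weyl algebra -/

section
variable {k A R : Type*} [CommRing k] [Ring A] [HopfAlgebra k A] [Ring R] [Algebra k R]

theorem adHom_grouplike_mul (α : A →ₐ[k] R) {a : A} (ha : comul (R := k) a = a ⊗ₜ a) (v w : R) :
    adHom α a (v * w) = adHom α a v * adHom α a w := by
  let r : Repr k a Unit := { index := {()}, left := fun _ => a, right := fun _ => a, eq := by simp [ha] }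
  exact (adHom_mul α r v w).trans (Finset.sum_singleton _ _)

theorem adHom_algebraMap (α : A →ₐ[k] R) (a : A) (z : k) :
    adHom α a (algebraMap k R z) = z • counit (R := k) a • (1 : R) := by
  rw [Algebra.algebraMap_eq_smul_one, map_smul, adHom_one]

/-- An action on `V` that preserves the image of `W` restricts to `W`. -/
theorem exists_restrict_end {V W : Type*} [AddCommGroup V] [Module k V] [AddCommGroup W]
    [Module k W] {j : W →ₗ[k] V} (hj : Function.Injective j) (f : A →ₐ[k] Module.End k V)
    (hf : ∀ a w, ∃ w', j w' = f a (j w)) :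
    ∃ g : A →ₐ[k] Module.End k W, ∀ a w, j (g a w) = f a (j w) := by
  choose g hg using hf
  let g' : A → Module.End k W := fun a =>
    { toFun := g a
      map_add' := fun v w => hj (by simp only [hg, map_add])
      map_smul' := fun r w => hj (by simp only [hg, map_smul, RingHom.id_apply]) }
  have hg' : ∀ a w, j (g' a w) = f a (j w) := hg
  refine ⟨AlgHom.ofLinearMap
    { toFun := g'
      map_add' := fun a b => LinearMap.ext fun w => hj ?_
      map_smul' := fun r a => LinearMap.ext fun w => hj ?_ }
    (LinearMap.ext fun w => hj ?_) (fun a b => LinearMap.ext fun w => hj ?_), hg⟩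
  · simp only [hg', map_add, LinearMap.add_apply]
  · simp only [hg', map_smul, LinearMap.smul_apply, RingHom.id_apply]
  · exact (hg' _ _).trans (by rw [map_one]; rfl)
  · refine (hg' _ _).trans ?_
    rw [map_mul, Module.End.mul_apply, ← hg', ← hg']
    rfl

end

namespace HopfPairing
variable {k A B : Type*} [CommRing k] [Ring A] [Ring B] [HopfAlgebra k A] [HopfAlgebra k B]
  [HasBijectiveAntipode k A] (φ : HopfPairing k A B)

theorem heisCoact_sharpA_skew {a h : A} (ha : comul (R := k) a = a ⊗ₜ 1 + h ⊗ₜ a) :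
    φ.heisCoact (φ.sharpA a) = φ.inlD a ⊗ₜ 1 + φ.inlD h ⊗ₜ φ.sharpA a := by
  rw [heisCoact_eq, AlgHom.toLinearMap_apply, heisCoactHom_sharpA, coactA, AlgHom.comp_apply,
    Bialgebra.comulAlgHom_apply, ha, map_add, Algebra.TensorProduct.map_tmul,
    Algebra.TensorProduct.map_tmul, map_one]

theorem heisCoact_sharpB_skew {b h : B} (hb : comul (R := k) b = b ⊗ₜ 1 + h ⊗ₜ b) :
    φ.heisCoact (φ.sharpB b) = φ.inrD b ⊗ₜ 1 + φ.inrD h ⊗ₜ φ.sharpB b := by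
  rw [heisCoact_eq, AlgHom.toLinearMap_apply, heisCoactHom_sharpB, coactB, AlgHom.comp_apply,
    Bialgebra.comulAlgHom_apply, hb, map_add, Algebra.TensorProduct.map_tmul,
    Algebra.TensorProduct.map_tmul, map_one]

variable {U W : Type*} [Ring U] [Algebra k U] [Ring W] [Algebra k W]

/-- The second legs of `Δ(a)` are `1` and `a`, both in the image of `j`, so the coaction has an
evident preimage. This is the form of the coproduct of `E'_i`. -/
theorem exists_lTensor_eq_sharpA (π : φ.Double →ₐ[k] U) {j : W →ₐ[k] φ.Heis} {w : W} {a h : A}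
    (hw : j w = φ.sharpA a) (ha : comul (R := k) a = a ⊗ₜ 1 + h ⊗ₜ a) :
    ∃ t, j.toLinearMap.lTensor U t = π.toLinearMap.rTensor φ.Heis (φ.heisCoact (j w)) := by
  refine ⟨π (φ.inlD a) ⊗ₜ 1 + π (φ.inlD h) ⊗ₜ w, ?_⟩
  rw [map_add, LinearMap.lTensor_tmul, LinearMap.lTensor_tmul, AlgHom.toLinearMap_apply,
    AlgHom.toLinearMap_apply, map_one, hw, heisCoact_sharpA_skew φ ha, map_add]
  rfl

theorem exists_lTensor_eq_sharpB (π : φ.Double →ₐ[k] U) {j : W →ₐ[k] φ.Heis} {w : W} {b h : B}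
    (hw : j w = φ.sharpB b) (hb : comul (R := k) b = b ⊗ₜ 1 + h ⊗ₜ b) :
    ∃ t, j.toLinearMap.lTensor U t = π.toLinearMap.rTensor φ.Heis (φ.heisCoact (j w)) := by
  refine ⟨π (φ.inrD b) ⊗ₜ 1 + π (φ.inrD h) ⊗ₜ w, ?_⟩
  rw [map_add, LinearMap.lTensor_tmul, LinearMap.lTensor_tmul, AlgHom.toLinearMap_apply,
    AlgHom.toLinearMap_apply, map_one, hw, heisCoact_sharpB_skew φ hb, map_add]
  rfl

end HopfPairing

namespace QDatum
variable {ι P : Type*} [AddCommGroup P] (Q : QDatum ι P)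

/-- The subalgebra of the Heisenberg double generated by the `1 ♯ E'_i` and the `F_i ♯ 1`. -/
def weylSub : Subalgebra ℂ Q.Hei := Algebra.adjoin ℂ
  (Set.range (fun i => Q.phi.sharpA (Q.E' i)) ∪ Set.range (fun i => Q.phi.sharpB (Q.F i)))

theorem sharpA_qE_mem (i : ι) : Q.phi.sharpA (Q.E' i) ∈ Q.weylSub :=
  Algebra.subset_adjoin (Or.inl ⟨i, rfl⟩)
theorem sharpB_F_mem (i : ι) : Q.phi.sharpB (Q.F i) ∈ Q.weylSub :=
  Algebra.subset_adjoin (Or.inr ⟨i, rfl⟩)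

theorem adHom_K (l : P) (w : Q.Hei) :
    adHom Q.phi.sharpA (Q.K l) w = Q.phi.sharpA (Q.K l) * w * Q.phi.sharpA (Q.K (-l)) := by
  rw [adHom_grouplike _ (Q.comul_K l), antipode_K]

theorem adHom_K' (l : P) (w : Q.Hei) :
    adHom Q.phi.sharpB (Q.K' l) w = Q.phi.sharpB (Q.K' l) * w * Q.phi.sharpB (Q.K' (-l)) := by
  rw [adHom_grouplike _ (Q.comul_K' l), antipode_K']

theorem adHom_K_sharpA_qE (l : P) (i : ι) : adHom Q.phi.sharpA (Q.K l) (Q.phi.sharpA (Q.E' i)) =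
    Q.qpow (Q.form (Q.root i) l) • Q.phi.sharpA (Q.E' i) := by
  rw [adHom_K, ← map_mul, ← map_mul, K_mul_E', smul_mul_assoc, mul_assoc, K_mul_neg, mul_one,
    map_smul]

theorem adHom_K_sharpB_F (l : P) (i : ι) : adHom Q.phi.sharpA (Q.K l) (Q.phi.sharpB (Q.F i)) =
    Q.qpow (-Q.form (Q.root i) l) • Q.phi.sharpB (Q.F i) := by
  rw [adHom_K, sharpA_K_mul_sharpB_F, smul_mul_assoc, mul_assoc, ← map_mul, K_mul_neg, map_one,
    mul_one]

theorem sharpA_qE_mul_sharpB_K' (i : ι) (m : P) : Q.phi.sharpA (Q.E' i) * Q.phi.sharpB (Q.K' m) =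
    Q.qpow (-Q.form (Q.root i) m) • (Q.phi.sharpB (Q.K' m) * Q.phi.sharpA (Q.E' i)) := by
  rw [E', map_smul, map_mul, smul_mul_assoc, mul_assoc, sharpA_E_mul_sharpB_K', ← mul_assoc,
    sharpA_K_mul_sharpB_K', smul_mul_assoc, mul_assoc, mul_smul_comm, smul_comm]

/-- The same eigenvalue as for `K_λ`, but from another source. Moving `E'_i` past `K'_{-λ}` costs
`φ(K_{α_i}, K'_{-λ})`, whereas for `K_λ` the scalar comes from the relation in `U_q^+`. -/
theorem adHom_K'_sharpA_qE (l : P) (i : ι) :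
    adHom Q.phi.sharpB (Q.K' l) (Q.phi.sharpA (Q.E' i)) =
      Q.qpow (Q.form (Q.root i) l) • Q.phi.sharpA (Q.E' i) := by
  rw [adHom_K', mul_assoc, sharpA_qE_mul_sharpB_K', mul_smul_comm, ← mul_assoc, ← map_mul,
    K'_mul_neg, map_one, one_mul, map_neg, neg_neg]

theorem adHom_K'_sharpB_F (l : P) (i : ι) : adHom Q.phi.sharpB (Q.K' l) (Q.phi.sharpB (Q.F i)) =
    Q.qpow (-Q.form (Q.root i) l) • Q.phi.sharpB (Q.F i) := by
  rw [adHom_K', ← map_mul, ← map_mul, K'_mul_F, smul_mul_assoc, mul_assoc, K'_mul_neg, mul_one,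
    map_smul]

theorem adHom_K_mem (l : P) {s : Q.Hei} (hs : s ∈ Q.weylSub) :
    adHom Q.phi.sharpA (Q.K l) s ∈ Q.weylSub := by
  induction hs using Algebra.adjoin_induction with
  | mem x hx =>
    obtain ⟨i, rfl⟩ | ⟨i, rfl⟩ := hx
    · exact (Q.adHom_K_sharpA_qE l i).symm ▸ Subalgebra.smul_mem _ (Q.sharpA_qE_mem i) _
    · exact (Q.adHom_K_sharpB_F l i).symm ▸ Subalgebra.smul_mem _ (Q.sharpB_F_mem i) _
  | algebraMap r =>
    rw [adHom_algebraMap]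
    exact Subalgebra.smul_mem _ (Subalgebra.smul_mem _ (one_mem _) _) _
  | add x y _ _ hx hy => rw [map_add]; exact add_mem hx hy
  | mul x y _ _ hx hy => rw [adHom_grouplike_mul _ (Q.comul_K l)]; exact mul_mem hx hy

/-- Group-likes act multiplicatively, so agreement on the generators suffices. On the whole
Heisenberg double the two actions differ in general: on `K'_μ ♯ 1` one is `q^(-(λ, μ))` and the
other is trivial. The passage to `U_q` therefore uses the Weyl subalgebra. -/
theorem adHom_K_eq_adHom_K' (l : P) {s : Q.Hei} (hs : s ∈ Q.weylSub) :
    adHom Q.phi.sharpA (Q.K l) s = adHom Q.phi.sharpB (Q.K' l) s := by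
  induction hs using Algebra.adjoin_induction with
  | mem x hx =>
    obtain ⟨i, rfl⟩ | ⟨i, rfl⟩ := hx
    · exact (Q.adHom_K_sharpA_qE l i).trans (Q.adHom_K'_sharpA_qE l i).symm
    · exact (Q.adHom_K_sharpB_F l i).trans (Q.adHom_K'_sharpB_F l i).symm
  | algebraMap r => rw [adHom_algebraMap, adHom_algebraMap, counit_K, counit_K']
  | add x y _ _ hx hy => rw [map_add, map_add, hx, hy]
  | mul x y _ _ hx hy =>
    rw [adHom_grouplike_mul _ (Q.comul_K l), adHom_grouplike_mul _ (Q.comul_K' l), hx, hy]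

theorem sharpA_E_mul (hc : Q.IsGeneric) (i : ι) (w : Q.Hei) :
    Q.phi.sharpA (Q.E i) * w * Q.phi.sharpA (Q.K (Q.root i)) = ((Q.qi i)⁻¹ - Q.qi i)⁻¹ •
      adHom Q.phi.sharpA (Q.K (-Q.root i)) (Q.phi.sharpA (Q.E' i) * w) := by
  rw [adHom_K, neg_neg, ← mul_assoc, ← map_mul, E', mul_smul_comm, ← mul_assoc, K_neg_mul, one_mul,
    map_smul, smul_mul_assoc, smul_mul_assoc, smul_smul, inv_mul_cancel₀ (hc i), one_smul]

/-- Expresses the action of `E_i` by products with `1 ♯ E'_i` and the torus action. Both preserve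
`weylSub`, with no need for `1 ♯ E_i` or `1 ♯ K_λ` to lie in it. -/
theorem adHom_E (hc : Q.IsGeneric) (i : ι) (w : Q.Hei) : adHom Q.phi.sharpA (Q.E i) w =
    ((Q.qi i)⁻¹ - Q.qi i)⁻¹ • (adHom Q.phi.sharpA (Q.K (-Q.root i)) (Q.phi.sharpA (Q.E' i) * w) -
      w * adHom Q.phi.sharpA (Q.K (-Q.root i)) (Q.phi.sharpA (Q.E' i))) := by
  have h := Q.sharpA_E_mul hc i 1
  rw [mul_one, mul_one] at h
  rw [adHom_skew _ (Q.comul_E' i), antipode_K, neg_neg, antipode_E, map_neg, map_one, one_mul,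
    map_mul, mul_neg, smul_sub, ← mul_smul_comm, ← h, ← Q.sharpA_E_mul hc, sub_eq_add_neg]

theorem adHom_F (i : ι) (w : Q.Hei) : adHom Q.phi.sharpB (Q.F i) w =
    Q.phi.sharpB (Q.F i) * w - adHom Q.phi.sharpB (Q.K' (Q.root i)) w * Q.phi.sharpB (Q.F i) := by
  rw [adHom_skew _ (Q.comul_F i), antipode_one, map_one, mul_one, antipode_F, map_neg, map_mul,
    mul_neg, adHom_K', sub_eq_add_neg, mul_assoc _ (Q.phi.sharpB (Q.K' _))]

theorem adHom_sharpA_mem (hc : Q.IsGeneric) (a : Q.UPlus) {s : Q.Hei} (hs : s ∈ Q.weylSub) :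
    adHom Q.phi.sharpA a s ∈ Q.weylSub := by
  obtain ⟨x, rfl⟩ := Ideal.Quotient.mk_surjective a
  change adHom Q.phi.sharpA (Q.mkPlus x) s ∈ _
  induction x using Q.plus.induction generalizing s with
  | hK l => exact Q.adHom_K_mem l hs
  | hX i =>
    refine (Q.adHom_E hc i s).symm ▸ Subalgebra.smul_mem _ (sub_mem ?_ (mul_mem hs ?_)) _
    · exact Q.adHom_K_mem _ (mul_mem (Q.sharpA_qE_mem i) hs)
    · exact Q.adHom_K_mem _ (Q.sharpA_qE_mem i)
  | hc z => rw [AlgHom.commutes, AlgHom.commutes]; exact Subalgebra.smul_mem _ hs z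
  | hadd a b ha hb => rw [map_add, map_add]; exact add_mem (ha hs) (hb hs)
  | hmul a b ha hb => rw [map_mul, map_mul]; exact ha (hb hs)

theorem adHom_sharpB_mem (b : Q.UMinus) {s : Q.Hei} (hs : s ∈ Q.weylSub) :
    adHom Q.phi.sharpB b s ∈ Q.weylSub := by
  obtain ⟨x, rfl⟩ := Ideal.Quotient.mk_surjective b
  change adHom Q.phi.sharpB (Q.mkMinus x) s ∈ _
  -- On `weylSub` the actions of `K'_λ` and `K_λ` coincide, so stability carries over.
  have hK : ∀ l, ∀ s ∈ Q.weylSub, adHom Q.phi.sharpB (Q.K' l) s ∈ Q.weylSub := fun l s hs =>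
    Q.adHom_K_eq_adHom_K' l hs ▸ Q.adHom_K_mem l hs
  induction x using Q.minus.induction generalizing s with
  | hK l => exact hK l s hs
  | hX i =>
    exact (Q.adHom_F i s).symm ▸ sub_mem (mul_mem (Q.sharpB_F_mem i) hs)
      (mul_mem (hK _ s hs) (Q.sharpB_F_mem i))
  | hc z => rw [AlgHom.commutes, AlgHom.commutes]; exact Subalgebra.smul_mem _ hs z
  | hadd a b ha hb => rw [map_add, map_add]; exact add_mem (ha hs) (hb hs)
  | hmul a b ha hb => rw [map_mul, map_mul]; exact ha (hb hs)

theorem heisActHom_mem (hc : Q.IsGeneric) (d : Q.Dbl) {s : Q.Hei} (hs : s ∈ Q.weylSub) :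
    Q.phi.heisActHom d s ∈ Q.weylSub := by
  induction d using Q.phi.double_induction with
  | h0 => rw [map_zero]; exact zero_mem _
  | hadd x y hx hy => rw [map_add]; exact add_mem hx hy
  | h a b =>
    rw [HopfPairing.heisActHom_dtmul]
    exact Q.adHom_sharpA_mem hc a (Q.adHom_sharpB_mem b hs)

theorem adjoin_we'_wf : Algebra.adjoin ℂ (Set.range Q.we' ∪ Set.range Q.wf) = ⊤ := by
  have h := Algebra.adjoin_adjoin_coe_preimage (R := ℂ) (s := Set.range Q.be' ∪ Set.range Q.bf)
  refine Eq.trans (congrArg _ ?_) h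
  ext w
  constructor
  · rintro (⟨i, rfl⟩ | ⟨i, rfl⟩)
    · exact Or.inl ⟨i, rfl⟩
    · exact Or.inr ⟨i, rfl⟩
  · rintro (⟨i, hi⟩ | ⟨i, hi⟩)
    · exact Or.inl ⟨i, Subtype.ext hi⟩
    · exact Or.inr ⟨i, Subtype.ext hi⟩

theorem range_weylToHei (hQ : Q.IsSeparating) (hc : Q.IsGeneric) :
    (Q.weylToHei hQ hc).range = Q.weylSub := by
  rw [← Algebra.map_top, ← adjoin_we'_wf, AlgHom.map_adjoin, Set.image_union, ← Set.range_comp,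
    ← Set.range_comp, weylSub]
  congr 3 <;> funext i
  · exact Q.weylToHei_we' hQ hc i
  · exact Q.weylToHei_wf hQ hc i

theorem weylToHei_mem (hQ : Q.IsSeparating) (hc : Q.IsGeneric) (w : Q.Wq) :
    Q.weylToHei hQ hc w ∈ Q.weylSub := Q.range_weylToHei hQ hc ▸ ⟨w, rfl⟩

theorem exists_weylAct (hQ : Q.IsSeparating) (hc : Q.IsGeneric) :
    ∃ act : Q.Uq →ₐ[ℂ] Module.End ℂ Q.Wq, ∀ (d : Q.Dbl) (w : Q.Wq),
      Q.weylToHei hQ hc (act (Q.toUq d) w) = Q.phi.heisAct d (Q.weylToHei hQ hc w) := by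
  obtain ⟨g, hg⟩ := exists_restrict_end (j := (Q.weylToHei hQ hc).toLinearMap)
    (Q.weylToHei_injective hQ hc) Q.phi.heisActHom (fun d w => by
      have h := Q.heisActHom_mem hc d (Q.weylToHei_mem hQ hc w)
      rw [← Q.range_weylToHei hQ hc] at h
      exact h)
  -- The kernel of the restricted action is a two-sided ideal. It contains `idealK` as soon as `K_λ
  -- ⊗ 1` and `1 ⊗ K'_λ` act equally.
  refine ⟨Ideal.Quotient.liftₐ Q.idealK g fun x hx => Q.idealK_le_ker g.toRingHom (fun l => ?_) hx,
    fun d w => ?_⟩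
  · refine LinearMap.ext fun w => Q.weylToHei_injective hQ hc ?_
    refine (hg _ w).trans (Eq.trans ?_ (hg _ w).symm)
    have h1 := Q.phi.heisActHom_inlD (Q.K l)
    have h2 := Q.phi.heisActHom_inrD (Q.K' l)
    refine (DFunLike.congr_fun h1 _).trans (Eq.trans ?_ (DFunLike.congr_fun h2 _).symm)
    exact Q.adHom_K_eq_adHom_K' l (Q.weylToHei_mem hQ hc w)
  · rw [HopfPairing.heisAct_eq]
    exact hg d w

/-- The coaction `(π ⊗ id) δ j`, as an algebra homomorphism. -/
def weylCoactHom (hQ : Q.IsSeparating) (hc : Q.IsGeneric) : Q.Wq →ₐ[ℂ] Q.Uq ⊗[ℂ] Q.Hei :=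
  ((Algebra.TensorProduct.map Q.toUq (AlgHom.id ℂ Q.Hei)).comp Q.phi.heisCoactHom).comp
    (Q.weylToHei hQ hc)

theorem weylCoactHom_apply (hQ : Q.IsSeparating) (hc : Q.IsGeneric) (w : Q.Wq) :
    Q.weylCoactHom hQ hc w =
      Q.toUq.toLinearMap.rTensor Q.Hei (Q.phi.heisCoact (Q.weylToHei hQ hc w)) := by
  rw [HopfPairing.heisCoact_eq]
  rfl

/-- The composite `(π ⊗ id) δ j` is an algebra homomorphism, so it takes values in `U_q ⊗ j(W_q)`
once it does so on the `e'_i` and `f_i`. -/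
theorem exists_weylCoact (hQ : Q.IsSeparating) (hc : Q.IsGeneric) :
    ∃ coact : Q.Wq →ₗ[ℂ] Q.Uq ⊗[ℂ] Q.Wq, ∀ w : Q.Wq,
      (Q.weylToHei hQ hc).toLinearMap.lTensor Q.Uq (coact w) =
        Q.toUq.toLinearMap.rTensor Q.Hei (Q.phi.heisCoact (Q.weylToHei hQ hc w)) := by
  obtain ⟨c, h⟩ := exists_lift_lTensor (Q.weylToHei_injective hQ hc) (Q.weylCoactHom hQ hc)
    Q.adjoin_we'_wf (by
      rintro _ (⟨i, rfl⟩ | ⟨i, rfl⟩) <;> rw [weylCoactHom_apply]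
      · exact Q.phi.exists_lTensor_eq_sharpA Q.toUq (Q.weylToHei_we' hQ hc i) (Q.comul_qE i)
      · exact Q.phi.exists_lTensor_eq_sharpB Q.toUq (Q.weylToHei_wf hQ hc i) (Q.comul_F i))
  exact ⟨c, fun w => (h w).trans (Q.weylCoactHom_apply hQ hc w)⟩

/-- The quantized Weyl algebra is a Yetter-Drinfeld module algebra over `U_q`, by restriction of
the structure on the Heisenberg double. -/
theorem exists_weyl_yetterDrinfeld (hQ : Q.IsSeparating) (hc : Q.IsGeneric) :
    ∃ j : Q.Wq →ₐ[ℂ] Q.Hei,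
      (∀ i, j (Q.we' i) = Q.phi.sharp 1 (Q.E' i)) ∧
      (∀ i, j (Q.wf i) = Q.phi.sharp (Q.F i) 1) ∧
      Function.Injective j ∧
      ∃ (act : Q.Uq →ₗ[ℂ] Q.Wq →ₗ[ℂ] Q.Wq) (coact : Q.Wq →ₗ[ℂ] TensorProduct ℂ Q.Uq Q.Wq),
        IsModuleAlgebra act ∧
        IsYetterDrinfeld act coact ∧
        (∀ (d : Q.Dbl) (w : Q.Wq), j (act (Q.toUq d) w) = Q.phi.heisAct d (j w)) ∧
        (∀ w : Q.Wq, j.toLinearMap.lTensor Q.Uq (coact w) =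
          Q.toUq.toLinearMap.rTensor Q.Hei (Q.phi.heisCoact (j w))) := by
  obtain ⟨act, hact⟩ := Q.exists_weylAct hQ hc
  obtain ⟨coact, hcoact⟩ := Q.exists_weylCoact hQ hc
  have hj := Q.weylToHei_injective hQ hc
  have hπ : Function.Surjective (Bialgebra.Quotient.mkBialgHom (R := ℂ) Q.idealK) :=
    Ideal.Quotient.mk_surjective
  have hm : IsModuleAlgebra act.toLinearMap := IsModuleAlgebra.descend
    (π := Bialgebra.Quotient.mkBialgHom (R := ℂ) Q.idealK) Q.phi.isModuleAlgebra_heisAct hπ hj hact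
  exact ⟨Q.weylToHei hQ hc, Q.weylToHei_we' hQ hc, Q.weylToHei_wf hQ hc, hj, act.toLinearMap, coact,
    hm, IsYetterDrinfeld.descend (π := Bialgebra.Quotient.mkBialgHom (R := ℂ) Q.idealK)
      Q.phi.isYetterDrinfeld_heis hm hπ hj hact hcoact, hact, hcoact⟩

end QDatum

/-! ### Arithmetic of `q` and of the weight lattice -/

theorem eq_zero_of_exp_mul_eq_one {h : ℂ} (hq : ∀ m : ℕ, 0 < m → Complex.exp h ^ m ≠ 1) {r : ℚ}
    (hr : Complex.exp (h * r) = 1) : r = 0 := by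
  -- Raising to the power of the denominator leaves an integral exponent. If it is nonzero, it is
  -- positive up to inversion.
  have h1 : Complex.exp (h * r.num) = 1 := by
    have : h * r.num = r.den * (h * r) := by
      have e : (r : ℂ) * r.den = r.num := by exact_mod_cast Rat.mul_den_eq_num r
      rw [← e]; ring
    rw [this, Complex.exp_nat_mul, hr, one_pow]
  by_contra hne
  have hn : 0 < r.num.natAbs := Int.natAbs_pos.2 (Rat.num_ne_zero.2 hne)
  apply hq _ hn
  rw [← Complex.exp_nat_mul, mul_comm]
  rcases Int.natAbs_eq r.num with e | e
  · rw [e] at h1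
    simpa using h1
  · rw [e] at h1
    have : h * ((-(r.num.natAbs : ℤ) : ℤ) : ℂ) = -(h * r.num.natAbs) := by
      rw [Int.cast_neg, Int.cast_natCast, mul_neg]
    rw [this, Complex.exp_neg, inv_eq_one] at h1
    exact h1

/-- Invariance under the reflection in `α` gives `(x, α) = (x - x(α^∨) α, -α) = -(x, α) + x(α^∨) (α,
α)`. -/
theorem two_mul_invariantForm_root {ι R M N : Type*} [CommRing R] [AddCommGroup M] [Module R M]
    [AddCommGroup N] [Module R N] {P : RootPairing ι R M N} (B : P.InvariantForm) (x : M) (i : ι) :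
    2 * B.form x (P.root i) = P.toLinearMap x (P.coroot i) * B.form (P.root i) (P.root i) := by
  rw [two_mul, ← eq_sub_iff_add_eq]
  nth_rw 1 [← B.isOrthogonal_reflection i]
  rw [RootPairing.reflection_apply, RootPairing.reflection_apply_self, LinearMap.map_sub₂,
    LinearMap.map_smul₂, smul_eq_mul, map_neg, map_neg, mul_neg, neg_sub_neg]
  rfl

open LieAlgebra.IsKilling
variable {g : Type*} [LieRing g] [LieAlgebra ℂ g] [FiniteDimensional ℂ g]
  [LieAlgebra.IsSemisimple ℂ g] {H : LieSubalgebra ℂ g} [H.IsCartanSubalgebra]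
  (b : (rootSystem H).Base) (F : (rootSystem H).InvariantForm)

/-- If `q_i⁻¹ = q_i`, then `q` to the positive rational power `(α_i, α_i)` would be `1`. -/
theorem isGeneric_lieDatum
    (hF : ∀ a, ∃ r : ℚ, 0 < r ∧ F.form ((rootSystem H).root a) ((rootSystem H).root a) = r)
    {hbar : ℂ} (hq : ∀ m : ℕ, 0 < m → Complex.exp hbar ^ m ≠ 1) :
    (lieDatum b F hbar).IsGeneric := by
  intro i hi
  obtain ⟨r, hr, e⟩ := hF i.1
  refine hr.ne' (eq_zero_of_exp_mul_eq_one hq ?_)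
  have h : (lieDatum b F hbar).qi i = Complex.exp (hbar * (r / 2)) := by
    rw [← e]
    rfl
  rw [h, sub_eq_zero, ← Complex.exp_neg] at hi
  have e2 : hbar * (r : ℂ) = hbar * (r / 2) + hbar * (r / 2) := by ring
  rw [e2, Complex.exp_add]
  nth_rw 1 [← hi]
  rw [← Complex.exp_add, neg_add_cancel, Complex.exp_zero]

/-- It is enough to test with `λ` a root `α`. Then `(α, μ) = μ(α^∨) (α, α) / 2` is rational, so
`q^(-(α, μ)) = 1` forces `μ(α^∨) = 0`. The coroots span the Cartan subalgebra, hence `μ = 0`. -/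
theorem isSeparating_lieDatum
    (hF : ∀ a, ∃ r : ℚ, 0 < r ∧ F.form ((rootSystem H).root a) ((rootSystem H).root a) = r)
    {hbar : ℂ} (hq : ∀ m : ℕ, 0 < m → Complex.exp hbar ^ m ≠ 1) :
    (lieDatum b F hbar).IsSeparating := by
  intro m hm
  have key : ∀ a, m.1 ((rootSystem H).coroot a) = 0 := by
    intro a
    obtain ⟨r, hr, e⟩ := hF a
    obtain ⟨n, hn⟩ := m.2.2 a
    have h1 : Complex.exp (hbar * -F.form ((rootSystem H).root a) m.1) = 1 :=
      hm ⟨(rootSystem H).root a, root_mem_weightLattice H a⟩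
    have h2 := two_mul_invariantForm_root F m.1 a
    have h3 : (rootSystem H).toLinearMap m.1 ((rootSystem H).coroot a) = n := hn
    rw [e, h3] at h2
    have h4 : -F.form ((rootSystem H).root a) m.1 = ((-(n * r / 2) : ℚ) : ℂ) := by
      rw [show F.form ((rootSystem H).root a) m.1 = F.form m.1 ((rootSystem H).root a) from
        F.symm.eq _ _]
      push_cast
      linear_combination -(1 / 2 : ℂ) * h2
    rw [h4] at h1
    have h5 := eq_zero_of_exp_mul_eq_one hq h1
    rw [hn]
    have : (n : ℚ) = 0 := by
      rcases mul_eq_zero.1 (by linarith : (n : ℚ) * r = 0) with h | h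
      · exact h
      · exact absurd h hr.ne'
    exact_mod_cast this
  refine Subtype.ext (LinearMap.ext fun x => ?_)
  have hx : x ∈ Submodule.span ℂ (Set.range (rootSystem H).coroot) := by
    rw [RootPairing.IsRootSystem.span_coroot_eq_top]
    trivial
  change m.1 x = 0
  induction hx using Submodule.span_induction with
  | mem y hy => obtain ⟨a, rfl⟩ := hy; exact key a
  | zero => exact map_zero _
  | add y z _ _ hy hz => rw [map_add, hy, hz, add_zero]
  | smul c y _ hy => rw [map_smul, hy, smul_zero]

end
end QuantumWeyl


theorem mainTheorem9 {g : Type*} [LieRing g] [LieAlgebra ℂ g] [FiniteDimensional ℂ g]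
    [LieAlgebra.IsSemisimple ℂ g] (H : LieSubalgebra ℂ g) [H.IsCartanSubalgebra]
    (b : (LieAlgebra.IsKilling.rootSystem H).Base)
    (F : (LieAlgebra.IsKilling.rootSystem H).InvariantForm)
    (hF : ∀ a, ∃ r : ℚ, 0 < r ∧ F.form ((LieAlgebra.IsKilling.rootSystem H).root a)
      ((LieAlgebra.IsKilling.rootSystem H).root a) = r)
    (hbar : ℂ) (hq : ∀ m : ℕ, 0 < m → Complex.exp hbar ^ m ≠ 1)
    (Q : QuantumWeyl.QDatum (QuantumWeyl.SimpleRoots b) (QuantumWeyl.Weights H))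
    (hQ : Q = QuantumWeyl.lieDatum b F hbar) :
    ∃ j : Q.Wq →ₐ[ℂ] Q.Hei,
      (∀ i, j (Q.we' i) = Q.phi.sharp 1 (Q.E' i)) ∧
      (∀ i, j (Q.wf i) = Q.phi.sharp (Q.F i) 1) ∧
      Function.Injective j ∧
      ∃ (act : Q.Uq →ₗ[ℂ] Q.Wq →ₗ[ℂ] Q.Wq) (coact : Q.Wq →ₗ[ℂ] TensorProduct ℂ Q.Uq Q.Wq),
        QuantumWeyl.IsModuleAlgebra act ∧
        QuantumWeyl.IsYetterDrinfeld act coact ∧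
        (∀ (d : Q.Dbl) (w : Q.Wq), j (act (Q.toUq d) w) = Q.phi.heisAct d (j w)) ∧
        (∀ w : Q.Wq, j.toLinearMap.lTensor Q.Uq (coact w) =
          Q.toUq.toLinearMap.rTensor Q.Hei (Q.phi.heisCoact (j w))) := by
  subst hQ
  exact QuantumWeyl.QDatum.exists_weyl_yetterDrinfeld _
    (QuantumWeyl.isSeparating_lieDatum b F hF hq) (QuantumWeyl.isGeneric_lieDatum b F hF hq)
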